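/- Let $N^+=\mathbb{Z}_{\ge 0}^2\setminus\{(0,0)\}$, $\{(a,b),(c,d)\}=bc-ad$, and let $\mathfrak g=\bigoplus_{v\in N^+}\mathbb{Q}X_v$ be the Lie algebra over $\mathbb{Q}$ with $[X_v,X_w]=\{v,w\}X_{v+w}$. Write $\deg(a,b)=a+b$, $\mathfrak g^{>l}=\bigoplus_{\deg v>l}\mathbb{Q}X_v$, and let $G=\varprojlim_l \exp(\mathfrak g/\mathfrak g^{>l})$ be the corresponding pro-unipotent group, with product given by the Baker–Campbell–Hausdorff formula and rational powers $(\exp X)^c=\exp(cX)$. For $v\in N^+$ put $\Psi[v]=\exp\bigl(\sum_{j\ge1}\frac{(-1)^{j+1}}{j^2}X_{jv}\bigr)\in G$. Order $N^+$ totally by: $(a,b)\le(c,d)$ if $\{(a,b),(c,d)\}<0$, or if $(c,d)=k(a,b)$ for some rational $k\ge1$. **Theorem.** For all integers $m,n\ge0$ there is exactly one family of rational numbers $u_{v}(m,n)$ $(v\in N^+)$ such that $$\Psi[(0,1)]^n\,\Psi[(1,0)]^m=\prod^{\rightarrow}_{v\in N^+}\Psi[v]^{u_v(m,n)}\quad\text{in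 } G,$$ where the factors of the product are arranged in increasing order of $v$ from left to right. Moreover, for all positive integers $a,b$ there are nonnegative integers $\alpha_{(a,b)}(i,j)$ $(1\le i\le a,\ 1\le j\le b)$, independent of $m$ and $n$, such that for all integers $m,n\ge 0$ $$u_{(a,b)}(m,n)=\frac1{\gcd(a,b)}\sum_{\substack{1\le i\le a\\ 1\le j\le b}}\alpha_{(a,b)}(i,j)\binom mi\binom nj .$$ -/

import Mathlib

open Finset

/-- The monoid part `N⁺ = ℤ_{≥0}² \ {(0,0)}` of the lattice `N = ℤ²`. -/
@[ext]
structure NPlus where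
  fst : ℕ
  snd : ℕ
  pos : 0 < fst + snd
deriving DecidableEq

namespace NPlus

/-- The degree `deg (a, b) = a + b`. -/
def deg (v : NPlus) : ℕ := v.fst + v.snd

instance : Add NPlus :=
  ⟨fun v w => ⟨v.fst + w.fst, v.snd + w.snd, by have := v.pos; omega⟩⟩

@[simp] theorem add_fst (v w : NPlus) : (v + w).fst = v.fst + w.fst := rfl
@[simp] theorem add_snd (v w : NPlus) : (v + w).snd = v.snd + w.snd := rfl

theorem add_assoc' (u v w : NPlus) : u + v + w = u + (v + w) := by
  ext <;> simp [Nat.add_assoc]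

theorem add_comm' (u v : NPlus) : u + v = v + u := by
  ext <;> simp [Nat.add_comm]

theorem deg_add (v w : NPlus) : (v + w).deg = v.deg + w.deg := by
  simp only [deg, add_fst, add_snd]; omega

/-- The skew-symmetric form `{(a, b), (c, d)} = b c - a d`, so that `{e₂, e₁} = 1`. -/
def form (v w : NPlus) : ℚ := (v.snd : ℚ) * w.fst - (v.fst : ℚ) * w.snd

/-- The finite set `(N⁺)^{≤ l}` of elements of degree at most `l`. -/
def upTo (l : ℕ) : Finset NPlus :=
  ((range (l + 1) ×ˢ range (l + 1)).subtype (fun p => 0 < p.1 + p.2)).map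
    ⟨fun p => ⟨p.1.1, p.1.2, p.2⟩, fun p q h => by
      have h1 := congrArg NPlus.fst h
      have h2 := congrArg NPlus.snd h
      exact Subtype.ext (Prod.ext h1 h2)⟩ |>.filter (fun v => v.deg ≤ l)

@[simp] theorem mem_upTo {l : ℕ} {v : NPlus} : v ∈ upTo l ↔ v.deg ≤ l := by
  constructor
  · intro h
    exact (mem_filter.mp h).2
  · intro h
    refine mem_filter.mpr ⟨mem_map.mpr ⟨⟨(v.fst, v.snd), v.pos⟩, ?_, rfl⟩, h⟩
    unfold deg at h
    simp only [mem_subtype, mem_product, mem_range]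
    omega

/-- The finitely many pairs `(v₁, v₂)` in `N⁺ × N⁺` with `v₁ + v₂ = v`. -/
def splittings (v : NPlus) : Finset (NPlus × NPlus) :=
  (upTo v.deg ×ˢ upTo v.deg).filter (fun p => p.1 + p.2 = v)

@[simp] theorem mem_splittings {v : NPlus} {p : NPlus × NPlus} :
    p ∈ splittings v ↔ p.1 + p.2 = v := by
  unfold splittings
  constructor
  · intro h
    exact (mem_filter.mp h).2
  · rintro rfl
    refine mem_filter.mpr ⟨mem_product.mpr ⟨?_, ?_⟩, rfl⟩ <;>
      rw [mem_upTo, deg_add] <;> omega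

/-- The order on `N⁺` along which products are ordered: `(a, b) ≤ (c, d)` if
`{(a, b), (c, d)} < 0`, or if `(c, d) = k (a, b)` for some rational `k ≥ 1`. -/
def Le (v w : NPlus) : Prop :=
  form v w < 0 ∨ ∃ k : ℚ, 1 ≤ k ∧ (w.fst : ℚ) = k * v.fst ∧ (w.snd : ℚ) = k * v.snd

/-- The form and the degree decide the order. -/
theorem le_iff (v w : NPlus) :
    Le v w ↔ v.snd * w.fst < v.fst * w.snd ∨
      (v.snd * w.fst = v.fst * w.snd ∧ v.deg ≤ w.deg) := by
  have hv := v.pos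
  have hform : form v w < 0 ↔ v.snd * w.fst < v.fst * w.snd := by
    unfold form
    rw [sub_neg]
    exact_mod_cast Iff.rfl
  unfold Le
  rw [hform]
  refine or_congr Iff.rfl ⟨?_, ?_⟩
  · rintro ⟨k, hk, h1, h2⟩
    constructor
    · have : (v.snd : ℚ) * w.fst = v.fst * w.snd := by rw [h1, h2]; ring
      exact_mod_cast this
    · have h3 : (v.deg : ℚ) ≤ w.deg := by
        unfold deg
        push_cast
        rw [h1, h2]
        nlinarith [(Nat.cast_nonneg v.fst : (0 : ℚ) ≤ v.fst),
          (Nat.cast_nonneg v.snd : (0 : ℚ) ≤ v.snd)]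
      exact_mod_cast h3
  · rintro ⟨h, hd⟩
    have hd0 : (0 : ℚ) < v.deg := by exact_mod_cast hv
    have hq : (v.snd : ℚ) * w.fst = v.fst * w.snd := by exact_mod_cast h
    have hdv : (v.deg : ℚ) = v.fst + v.snd := by simp [deg]
    have hdw : (w.deg : ℚ) = w.fst + w.snd := by simp [deg]
    refine ⟨w.deg / v.deg, ?_, ?_, ?_⟩
    · rw [le_div_iff₀ hd0, one_mul]
      exact_mod_cast hd
    · rw [div_mul_eq_mul_div, eq_div_iff hd0.ne', hdv, hdw]
      linarith
    · rw [div_mul_eq_mul_div, eq_div_iff hd0.ne', hdv, hdw]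
      linarith

theorem Le.total (v w : NPlus) : Le v w ∨ Le w v := by
  rw [le_iff, le_iff, Nat.mul_comm w.snd v.fst, Nat.mul_comm w.fst v.snd]
  omega

theorem Le.antisymm (v w : NPlus) (h : Le v w) (h' : Le w v) : v = w := by
  rw [le_iff] at h h'
  rw [Nat.mul_comm w.snd v.fst, Nat.mul_comm w.fst v.snd] at h'
  obtain ⟨h1, h2⟩ : v.snd * w.fst = v.fst * w.snd ∧ v.deg = w.deg := by omega
  have hv := v.pos
  unfold deg at h2
  have h3 : (v.fst + v.snd) * w.fst = (v.fst + v.snd) * v.fst := by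
    calc (v.fst + v.snd) * w.fst = v.fst * w.fst + v.snd * w.fst := by ring
      _ = v.fst * (w.fst + w.snd) := by rw [h1]; ring
      _ = (v.fst + v.snd) * v.fst := by rw [← h2]; ring
  have h4 := Nat.eq_of_mul_eq_mul_left hv h3
  ext
  · exact h4.symm
  · omega

theorem Le.trans (u v w : NPlus) (h : Le u v) (h' : Le v w) : Le u w := by
  rw [le_iff] at *
  have hu := u.pos
  have hv := v.pos
  have hw := w.pos
  unfold deg at *
  rcases Nat.eq_zero_or_pos v.fst with h0 | h0
  · have hvs : 0 < v.snd := by omega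
    simp only [h0, Nat.zero_mul, Nat.mul_zero, Nat.zero_add] at h h'
    have hw0 : w.fst = 0 := by
      by_contra hne
      have : 0 < v.snd * w.fst := Nat.mul_pos hvs (Nat.pos_of_ne_zero hne)
      omega
    rw [hw0]
    simp only [Nat.mul_zero, Nat.zero_add]
    rcases Nat.eq_zero_or_pos u.fst with h1 | h1
    · right
      rw [h1] at h ⊢
      simp only [Nat.zero_mul, Nat.zero_add, hw0, Nat.mul_zero, lt_irrefl, false_or,
        true_and] at h h' ⊢
      omega
    · left
      exact Nat.mul_pos h1 (by omega)
  · have key : v.fst * (u.snd * w.fst) + w.fst * (u.fst * v.snd - u.snd * v.fst : ℤ)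
        + u.fst * (v.fst * w.snd - v.snd * w.fst : ℤ) = (v.fst * (u.fst * w.snd) : ℤ) := by
      ring
    have a1 : (0 : ℤ) ≤ u.fst * v.snd - u.snd * v.fst := by
      have : u.snd * v.fst ≤ u.fst * v.snd := by omega
      have : (u.snd * v.fst : ℤ) ≤ u.fst * v.snd := by exact_mod_cast this
      linarith
    have a2 : (0 : ℤ) ≤ v.fst * w.snd - v.snd * w.fst := by
      have : v.snd * w.fst ≤ v.fst * w.snd := by omega
      have : (v.snd * w.fst : ℤ) ≤ v.fst * w.snd := by exact_mod_cast this
      linarith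
    have b0 : (0 : ℤ) < v.fst := by exact_mod_cast h0
    have b1 : (0 : ℤ) ≤ w.fst := by positivity
    have b2 : (0 : ℤ) ≤ u.fst := by positivity
    have c1 := mul_nonneg b1 a1
    have c2 := mul_nonneg b2 a2
    have hle : (u.snd * w.fst : ℤ) ≤ u.fst * w.snd := by
      by_contra hlt
      push Not at hlt
      have := mul_lt_mul_of_pos_left hlt b0
      linarith
    have hleN : u.snd * w.fst ≤ u.fst * w.snd := by exact_mod_cast hle
    rcases hleN.lt_or_eq with hlt | heq
    · exact Or.inl hlt
    · right
      refine ⟨heq, ?_⟩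
      have heqZ : (u.snd * w.fst : ℤ) = u.fst * w.snd := by exact_mod_cast heq
      rw [heqZ] at key
      have d1 : w.fst * (u.fst * v.snd - u.snd * v.fst : ℤ) = 0 := by linarith
      have d2 : u.fst * (v.fst * w.snd - v.snd * w.fst : ℤ) = 0 := by linarith
      by_cases hs : u.snd * v.fst < u.fst * v.snd
      · have hsZ : (u.snd * v.fst : ℤ) < u.fst * v.snd := by exact_mod_cast hs
        have hw0 : (w.fst : ℤ) = 0 := by
          rcases mul_eq_zero.mp d1 with h5 | h5
          · exact h5
          · linarith
        have hu0 : (0 : ℤ) < u.fst := by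
          rcases b2.lt_or_eq with h5 | h5
          · exact h5
          · rw [← h5] at hsZ
            have : (0 : ℤ) ≤ u.snd * v.fst := by positivity
            linarith
        have h6 : (w.snd : ℤ) = 0 := by
          rcases mul_eq_zero.mp d2 with h5 | h5
          · linarith
          · rw [hw0] at h5
            rcases mul_eq_zero.mp (show (v.fst : ℤ) * w.snd = 0 by linarith) with h7 | h7
            · linarith
            · exact h7
        omega
      · have e1 : u.fst + u.snd ≤ v.fst + v.snd := by omega
        by_cases ht : v.snd * w.fst < v.fst * w.snd
        · have htZ : (v.snd * w.fst : ℤ) < v.fst * w.snd := by exact_mod_cast ht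
          have hu0 : (u.fst : ℤ) = 0 := by
            rcases mul_eq_zero.mp d2 with h5 | h5
            · exact h5
            · linarith
          have hu0' : u.fst = 0 := by exact_mod_cast hu0
          rw [hu0'] at h
          have : 0 < u.snd * v.fst := Nat.mul_pos (by omega) h0
          omega
        · omega

instance : IsTrans NPlus Le := ⟨Le.trans⟩
instance : Std.Antisymm Le := ⟨Le.antisymm⟩
instance : Std.Total Le := ⟨Le.total⟩

open Classical in
/-- The elements of `N⁺` of degree at most `l`, listed in increasing order. -/
noncomputable def ordered (l : ℕ) : List NPlus := (upTo l).sort Le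

end NPlus

/-- The completion `∏_{n ∈ N⁺} ℚ X_n` (the inverse limit of the quotients `𝔤^{≤ l}`) of the
`N⁺`-graded Lie algebra `𝔤 = ⨁_{n ∈ N⁺} ℚ X_n` with `[X_n, X_{n'}] = {n, n'} X_{n + n'}`;
the entry `coeff n` is the coefficient of `X_n`. -/
@[ext]
structure GHat where
  coeff : NPlus → ℚ

namespace GHat

instance : Zero GHat := ⟨⟨fun _ => 0⟩⟩
instance : Add GHat := ⟨fun x y => ⟨fun v => x.coeff v + y.coeff v⟩⟩
instance : Neg GHat := ⟨fun x => ⟨fun v => -x.coeff v⟩⟩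
instance : Sub GHat := ⟨fun x y => ⟨fun v => x.coeff v - y.coeff v⟩⟩
instance instSMulRat : SMul ℚ GHat := ⟨fun c x => ⟨fun v => c * x.coeff v⟩⟩

@[simp] theorem coeff_zero (v : NPlus) : (0 : GHat).coeff v = 0 := rfl
@[simp] theorem coeff_add (x y : GHat) (v : NPlus) :
    (x + y).coeff v = x.coeff v + y.coeff v := rfl
@[simp] theorem coeff_neg (x : GHat) (v : NPlus) : (-x).coeff v = -x.coeff v := rfl
@[simp] theorem coeff_sub (x y : GHat) (v : NPlus) :
    (x - y).coeff v = x.coeff v - y.coeff v := rfl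
@[simp] theorem coeff_smul (c : ℚ) (x : GHat) (v : NPlus) :
    (c • x).coeff v = c * x.coeff v := rfl

instance : AddCommGroup GHat where
  add_assoc x y z := by ext v; simp [add_assoc]
  zero_add x := by ext v; simp
  add_zero x := by ext v; simp
  add_comm x y := by ext v; simp [add_comm]
  neg_add_cancel x := by ext v; simp
  sub_eq_add_neg x y := by ext v; simp [sub_eq_add_neg]
  nsmul := nsmulRec
  zsmul := zsmulRec

instance : Module ℚ GHat where
  one_smul x := by ext v; simp
  mul_smul c d x := by ext v; simp [mul_assoc]
  smul_zero c := by ext v; simp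
  smul_add c x y := by ext v; simp [mul_add]
  add_smul c d x := by ext v; simp [add_mul]
  zero_smul x := by ext v; simp

/-- The bracket determined by `[X_n, X_{n'}] = {n, n'} X_{n + n'}`. -/
instance : Bracket GHat GHat :=
  ⟨fun x y => ⟨fun v => ∑ p ∈ v.splittings, p.1.form p.2 * x.coeff p.1 * y.coeff p.2⟩⟩

theorem coeff_lie (x y : GHat) (v : NPlus) :
    ⁅x, y⁆.coeff v = ∑ p ∈ v.splittings, p.1.form p.2 * x.coeff p.1 * y.coeff p.2 := rfl

theorem sum_swap (f : NPlus → NPlus → ℚ) (v : NPlus) :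
    ∑ p ∈ v.splittings, f p.1 p.2 = ∑ p ∈ v.splittings, f p.2 p.1 := by
  refine sum_nbij' Prod.swap Prod.swap ?_ ?_ ?_ ?_ ?_ <;>
    simp [NPlus.add_comm']

theorem sum_assoc (f : NPlus → NPlus → NPlus → ℚ) (v : NPlus) :
    ∑ p ∈ v.splittings, ∑ q ∈ p.1.splittings, f q.1 q.2 p.2 =
      ∑ p ∈ v.splittings, ∑ q ∈ p.2.splittings, f p.1 q.1 q.2 := by
  rw [sum_sigma', sum_sigma']
  refine sum_nbij' (fun s => ⟨(s.2.1, s.2.2 + s.1.2), (s.2.2, s.1.2)⟩)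
    (fun s => ⟨(s.1.1 + s.2.1, s.2.2), (s.1.1, s.2.1)⟩) ?_ ?_ ?_ ?_ ?_
  · rintro ⟨⟨a, b⟩, c, d⟩ h
    simp only [mem_sigma, NPlus.mem_splittings] at h ⊢
    obtain ⟨rfl, rfl⟩ := h
    simp [NPlus.add_assoc']
  · rintro ⟨⟨a, b⟩, c, d⟩ h
    simp only [mem_sigma, NPlus.mem_splittings] at h ⊢
    obtain ⟨rfl, rfl⟩ := h
    simp [NPlus.add_assoc']
  · rintro ⟨⟨a, b⟩, c, d⟩ h
    simp only [mem_sigma, NPlus.mem_splittings] at h ⊢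
    obtain ⟨rfl, rfl⟩ := h
    rfl
  · rintro ⟨⟨a, b⟩, c, d⟩ h
    simp only [mem_sigma, NPlus.mem_splittings] at h ⊢
    obtain ⟨rfl, rfl⟩ := h
    rfl
  · intro s _
    rfl

theorem lie_lie_right (x y z : GHat) (v : NPlus) :
    ⁅x, ⁅y, z⁆⁆.coeff v = ∑ p ∈ v.splittings, ∑ q ∈ p.2.splittings,
      p.1.form (q.1 + q.2) * q.1.form q.2 * x.coeff p.1 * y.coeff q.1 * z.coeff q.2 := by
  rw [coeff_lie]
  refine sum_congr rfl fun p _ => ?_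
  rw [coeff_lie, mul_sum]
  refine sum_congr rfl fun q hq => ?_
  rw [NPlus.mem_splittings.mp hq]
  ring

theorem lie_lie_left (x y z : GHat) (v : NPlus) :
    ⁅⁅x, y⁆, z⁆.coeff v = ∑ p ∈ v.splittings, ∑ q ∈ p.2.splittings,
      (p.1 + q.1).form q.2 * p.1.form q.1 * x.coeff p.1 * y.coeff q.1 * z.coeff q.2 := by
  rw [coeff_lie, ← sum_assoc (fun a b c =>
    (a + b).form c * a.form b * x.coeff a * y.coeff b * z.coeff c)]
  refine sum_congr rfl fun p _ => ?_
  rw [coeff_lie, mul_sum, sum_mul]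
  refine sum_congr rfl fun q hq => ?_
  rw [NPlus.mem_splittings.mp hq]
  ring

theorem lie_lie_mid (x y z : GHat) (v : NPlus) :
    ⁅y, ⁅x, z⁆⁆.coeff v = ∑ p ∈ v.splittings, ∑ q ∈ p.2.splittings,
      q.1.form (p.1 + q.2) * p.1.form q.2 * x.coeff p.1 * y.coeff q.1 * z.coeff q.2 := by
  rw [lie_lie_right, ← sum_assoc (fun a b c =>
      a.form (b + c) * b.form c * y.coeff a * x.coeff b * z.coeff c),
    ← sum_assoc (fun a b c =>
      b.form (a + c) * a.form c * x.coeff a * y.coeff b * z.coeff c)]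
  refine sum_congr rfl fun p _ => ?_
  rw [sum_swap (fun a b =>
    a.form (b + p.2) * b.form p.2 * y.coeff a * x.coeff b * z.coeff p.2)]
  refine sum_congr rfl fun q _ => ?_
  ring

instance : LieRing GHat where
  add_lie x y z := by
    ext v; simp only [coeff_lie, coeff_add, ← sum_add_distrib]
    exact sum_congr rfl fun p _ => by ring
  lie_add x y z := by
    ext v; simp only [coeff_lie, coeff_add, ← sum_add_distrib]
    exact sum_congr rfl fun p _ => by ring
  lie_self x := by
    ext v
    have h : ⁅x, x⁆.coeff v = -⁅x, x⁆.coeff v := by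
      simp only [coeff_lie]
      conv_lhs => rw [sum_swap (fun a b => a.form b * x.coeff a * x.coeff b)]
      rw [← sum_neg_distrib]
      exact sum_congr rfl fun p _ => by simp only [NPlus.form]; ring
    rw [coeff_zero]
    linarith
  leibniz_lie x y z := by
    ext v
    rw [coeff_add, lie_lie_right, lie_lie_left, lie_lie_mid, ← sum_add_distrib]
    refine sum_congr rfl fun p _ => ?_
    rw [← sum_add_distrib]
    refine sum_congr rfl fun q _ => ?_
    simp only [NPlus.form, NPlus.add_fst, NPlus.add_snd]
    push_cast
    ring

instance : LieAlgebra ℚ GHat where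
  lie_smul c x y := by
    ext v; simp only [coeff_lie, coeff_smul, mul_sum]
    exact sum_congr rfl fun p _ => by ring

end GHat

section BCH

variable {L : Type*} [LieRing L]

/-- The right-nested bracket `[x₁, [x₂, [⋯, [x_{r-1}, x_r]]]]` of a word `x₁ x₂ ⋯ x_r`. -/
def nestedLie : List L → L
  | [] => 0
  | [x] => x
  | x :: y :: t => ⁅x, nestedLie (y :: t)⁆

/-- The word `x^{p₁} y^{q₁} x^{p₂} y^{q₂} ⋯ x^{p_k} y^{q_k}`. -/
def bchWord (x y : L) {k : ℕ} (s : Fin k → ℕ × ℕ) : List L :=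
  (List.ofFn fun i => List.replicate (s i).1 x ++ List.replicate (s i).2 y).flatten

/-- The Baker–Campbell–Hausdorff series `log (exp x exp y)` in Dynkin's form,
`∑_k (-1)^{k+1}/k ∑_{(p_i, q_i) ≠ (0,0)} [x^{p₁} y^{q₁} ⋯ x^{p_k} y^{q_k}] / (r ∏ p_i! q_i!)`
with `r = ∑ (p_i + q_i)`, where only indices `k, p_i, q_i ≤ l` are kept. All terms with
`r ≤ l` are among those. -/
def bchTrunc [LieAlgebra ℚ L] (l : ℕ) (x y : L) : L :=
  ∑ k ∈ Icc 1 l,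
    ∑ s ∈ Fintype.piFinset (fun _ : Fin k => (range (l + 1) ×ˢ range (l + 1)).erase (0, 0)),
      ((-1 : ℚ) ^ (k + 1) /
        (k * (∑ i, ((s i).1 + (s i).2) : ℕ) *
          (∏ i, (s i).1.factorial * (s i).2.factorial : ℕ))) •
        nestedLie (bchWord x y s)

end BCH

/-- The structure group `G = lim G^{≤ l}`: its elements are the formal exponentials `exp X` with
`X` in the completed Lie algebra. -/
@[ext]
structure StructureGroup where
  /-- the formal exponential `exp X` -/
  exp ::
  log : GHat

namespace StructureGroup

instance : One StructureGroup := ⟨exp 0⟩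

/-- The product of `G`, given by the Baker–Campbell–Hausdorff formula. A bracket of more than
`deg v` elements has no `X_v`-component, so truncation at `deg v` computes that component. -/
instance : Mul StructureGroup :=
  ⟨fun g h => exp ⟨fun v => (bchTrunc v.deg g.log h.log).coeff v⟩⟩

/-- Rational powers `(exp X)^c = exp (c X)`. -/
def qpow (g : StructureGroup) (c : ℚ) : StructureGroup := exp (c • g.log)

/-- `g ≡ h mod G^{> l}`: both elements have the same image in `G^{≤ l}`. -/
def ModEq (l : ℕ) (g h : StructureGroup) : Prop :=
  ∀ v : NPlus, v.deg ≤ l → g.log.coeff v = h.log.coeff v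

/-- The dilogarithm element `Ψ[n] = exp (∑_{j ≥ 1} (-1)^{j+1} / j² X_{j n})`. -/
def dilog (n : NPlus) : StructureGroup :=
  exp ⟨fun v => ∑ j ∈ Icc 1 v.deg,
    if v.fst = j * n.fst ∧ v.snd = j * n.snd then (-1 : ℚ) ^ (j + 1) / (j : ℚ) ^ 2 else 0⟩

/-- `g` is the ordered product `∏→_{n ∈ N⁺} Ψ[n]^{u n}`. Since `Ψ[n]` is trivial in `G^{≤ l}`
for `deg n > l`, the image of the infinite product in `G^{≤ l}` is the finite ordered product
over the `n` of degree at most `l`. -/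
def IsOrderedProduct (g : StructureGroup) (u : NPlus → ℚ) : Prop :=
  ∀ l : ℕ, 1 ≤ l →
    ModEq l g (((NPlus.ordered l).map fun n => (dilog n).qpow (u n)).prod)

end StructureGroup

open StructureGroup in
/-- `u v m n` is the exponent of `Ψ[v]` in the ordered product of `Ψ[0,1]^n Ψ[1,0]^m`, for all
`v ∈ N⁺` and all nonnegative integers `m`, `n`. -/
def IsExponentFamily (u : NPlus → ℕ → ℕ → ℚ) : Prop :=
  ∀ m n : ℕ, IsOrderedProduct
    ((dilog ⟨0, 1, by decide⟩).qpow n * (dilog ⟨1, 0, by decide⟩).qpow m) (fun v => u v m n)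

/-!
The proof has three ingredients.

*The group.* For each `l` the elements `exp X` act on the completed Lie algebra by the exponential
of the adjoint action truncated at degree `l`. The Baker–Campbell–Hausdorff formula in Dynkin's form
(`IsNilFiltration.exp_bchTrunc`) makes this multiplicative, and since it is faithful in low degrees
(`modEq_iff_repHom_eq`) it turns the structure group into a group and congruences modulo `G^{> l}`
into equations between operators. Elements with logarithm in degree `l` are central modulo
`G^{> l}`, so exponents of ordered products can be found, uniquely, one degree at a time
(`existsUnique_isOrderedProduct`).

*Dilogarithm elements.* On `X_w` the element `Ψ[v]^s` acts as the power `(1 + S)^{s {v, w}}` of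
the shift `S` by `v` (`repHom_dilog_qpow`). This yields the pentagon relation
`Ψ[e₂] Ψ[e₁] = Ψ[e₁] Ψ[e₁ + e₂] Ψ[e₂]` (`pentagon`), and it shows that a product of powers
`Ψ[v]^{s v}` of distinct `Ψ[v]` respects, like its inverse, integrality of coefficients exactly if
all `gcd(v) s v` are integers (`exponent_integral`). Moreover, `X_v ↦ c⁻¹ X_{v₁ w + v₂ w'}` with
`c = {w', w}` respects brackets and takes `Ψ[v]` to `Ψ[v₁ w + v₂ w']^{1/c}`, so the ordered
factorization of `Ψ[e₂]^N Ψ[e₁]^M` determines that of `Ψ[w']^{N/c} Ψ[w]^{M/c}`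
(`modEq_prod_lin`).

*Positivity.* To see that the coefficients are nonnegative, `m` and `n` are replaced by the sizes of
sets `S` and `T`, and `Ψ[e₂]^n Ψ[e₁]^m` by a word with one letter for each potential element of `T`
and of `S`, the exponent of which indicates whether the element is there. In the process of sorting
this word all exponents are, up to the factor `gcd(v)`, functions of `(S, T)` which count objects
supported on at most `v₁` elements of `S` and `v₂` elements of `T` (`IsCount`). The exchange of two
letters `Ψ[w']^ψ` and `Ψ[w]^φ` preserves this property: for `w = e₁`, `w' = e₂` the exponents are
`0` or `1` and the pentagon relation applies; otherwise the letters commute or the change of lattice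
applies, and the theorem in lower degrees gives the exponents of the new letters as polynomials in
binomial coefficients of counting functions. These are counting functions again; denominators are
removed by integrality, because a counting function all of whose values are divisible by `k` is `k`
times a counting function (`IsCount.of_mul`). Once the word is sorted, uniqueness of the
factorization shows that `gcd(v) u_v(|S|, |T|)` counts objects with supports of bounded size. The
number of objects with support `(S, T)` is the coefficient of `C(m, |S|) C(n, |T|)` in its Newton
expansion (`exists_nat_newton_expansion`).
-/

/-! ### The logarithm of a nilpotent element -/

theorem Finset.sum_Icc_one {M : Type*} [AddCommMonoid M] (f : ℕ → M) (l : ℕ) :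
    ∑ k ∈ Icc 1 l, f k = ∑ k ∈ range l, f (k + 1) := by
  refine (sum_nbij' (fun k => k + 1) (fun k => k - 1) ?_ ?_ ?_ ?_ ?_).symm <;>
    (simp +contextual; try omega)

theorem natCast_mul_eq_smul {A : Type*} [Ring A] [Algebra ℚ A] (n : ℕ) (a : A) :
    (n : A) * a = (n : ℚ) • a := by
  rw [Algebra.smul_def, map_natCast]

/-- The logarithm series `∑_{1 ≤ k ≤ l} (-1)^{k+1}/k u^k` of `1 + u`, truncated after degree `l`. -/
noncomputable def logTrunc {A : Type*} [Ring A] [Algebra ℚ A] (l : ℕ) (u : A) : A :=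
  ∑ k ∈ Icc 1 l, ((-1 : ℚ) ^ (k + 1) / k) • u ^ k

/-- The complete homogeneous sums `h_k(a, b) = ∑_{i + j = k} a^i b^j` satisfy
`(1 + a)(1 + b) ∑_{k < n} (-1)^k h_k = 1` when `n` is large. -/
theorem one_add_mul_one_add_mul_sum {R : Type*} [CommRing R] {a b : R} {h l : ℕ}
    (ha : a ^ h = 0) (hb : b ^ h = 0) (hl : 2 * h ≤ l) :
    (1 + a) * (1 + b) *
      ∑ k ∈ range l, (-1) ^ k * ∑ i ∈ range (k + 1), a ^ i * b ^ (k - i) = 1 := by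
  have step : ∀ n, (1 + a) *
      ∑ k ∈ range (n + 1), (-1) ^ k * ∑ i ∈ range (k + 1), a ^ i * b ^ (k - i) =
      ∑ k ∈ range (n + 1), (-b) ^ k +
        (-1) ^ n * (a * ∑ i ∈ range (n + 1), a ^ i * b ^ (n - i)) := by
    intro n
    induction n with
    | zero => simp
    | succ n ih =>
      rw [sum_range_succ, mul_add, ih, sum_range_succ (fun k => (-b) ^ k) (n + 1)]
      have h1 : ∑ i ∈ range (n + 1 + 1), a ^ i * b ^ (n + 1 - i) =
          a * ∑ i ∈ range (n + 1), a ^ i * b ^ (n - i) + b ^ (n + 1) := by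
        rw [sum_range_succ', mul_sum]
        congr 1
        · refine sum_congr rfl fun i _ => ?_
          rw [show n + 1 - (i + 1) = n - i by omega]
          ring
        · simp
      rw [h1, neg_pow b (n + 1)]
      ring
  rcases l with _ | n
  · have : h = 0 := by omega
    subst this
    have h1 : (1 : R) = 0 := by simpa using ha
    simp [h1]
  · have hz : a * ∑ i ∈ range (n + 1), a ^ i * b ^ (n - i) = 0 := by
      rw [mul_sum]
      refine sum_eq_zero fun i hi => ?_
      by_cases hih : h ≤ i + 1
      · rw [← mul_assoc, ← pow_succ', pow_eq_zero_of_le hih ha, zero_mul]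
      · rw [pow_eq_zero_of_le (by omega) hb, mul_zero, mul_zero]
    rw [mul_comm (1 + a), mul_assoc, step, hz, mul_zero, add_zero]
    have h2 := mul_neg_geom_sum (-b) (n + 1)
    rw [sub_neg_eq_add] at h2
    rw [h2, neg_pow, pow_eq_zero_of_le (by omega) hb, mul_zero, sub_zero]

section CommutativeIdentities

variable {R : Type*} [CommRing R] [Algebra ℚ R]

open Polynomial

theorem Polynomial.eq_of_derivative_eq {P Q : R[X]} (h : derivative P = derivative Q)
    (h0 : P.coeff 0 = Q.coeff 0) : P = Q := by
  ext n
  cases n with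
  | zero => exact h0
  | succ n =>
    have := congrArg (fun p => p.coeff n) h
    simp only [coeff_derivative] at this
    have hn : IsUnit ((n : R) + 1) := by
      have : ((n : R) + 1) = algebraMap ℚ R ((n : ℚ) + 1) := by simp
      rw [this]
      exact (IsUnit.mk0 _ (by positivity)).map _
    exact hn.mul_right_cancel this

theorem Polynomial.derivative_exp {P : R[X]} (hP : IsNilpotent P) :
    derivative (IsNilpotent.exp P) = derivative P * IsNilpotent.exp P := by
  obtain ⟨k, hk⟩ := hP
  have hk' : P ^ (k + 1) = 0 := by rw [pow_succ, hk, zero_mul]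
  rw [IsNilpotent.exp_eq_sum hk', derivative_sum, sum_range_succ', ← IsNilpotent.exp_eq_sum hk',
    IsNilpotent.exp_eq_sum hk, mul_sum]
  simp only [pow_zero, Nat.factorial_zero, Nat.cast_one, inv_one, one_smul, derivative_one,
    add_zero]
  refine sum_congr rfl fun i _ => ?_
  rw [derivative_smul, derivative_pow, Nat.add_sub_cancel, Nat.factorial_succ, mul_assoc,
    C_eq_natCast, natCast_mul_eq_smul, smul_smul, mul_smul_comm, mul_comm (P ^ i)]
  congr 1
  push_cast
  have := Nat.factorial_ne_zero i
  field_simp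

theorem derivative_logTrunc_X_mul (l : ℕ) (u : R) :
    derivative (logTrunc l (X * C u)) = C u * ∑ k ∈ range l, (-(X * C u)) ^ k := by
  rw [logTrunc, sum_Icc_one, derivative_sum, mul_sum]
  refine sum_congr rfl fun k _ => ?_
  rw [derivative_smul, derivative_pow, Nat.add_sub_cancel, derivative_mul, derivative_X,
    derivative_C, mul_zero, add_zero, one_mul, C_eq_natCast, mul_assoc, natCast_mul_eq_smul,
    smul_smul, neg_pow (X * C u), mul_comm (C u), mul_assoc]
  have : ((-1 : ℚ) ^ (k + 1 + 1) / ((k + 1 : ℕ) : ℚ) * ((k + 1 : ℕ) : ℚ)) = (-1) ^ k := by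
    push_cast
    field_simp
    ring
  rw [this, Algebra.smul_def]
  simp

/-- The identity `exp (log (1 + u)) = 1 + u` for a nilpotent element of a commutative algebra. With
`u` replaced by `X u`, the derivative of `exp (-log (1 + X u)) (1 + X u)` vanishes. -/
theorem exp_logTrunc {u : R} {l : ℕ} (hu : u ^ (l + 1) = 0) :
    IsNilpotent.exp (logTrunc l u) = 1 + u := by
  have hnil : ∀ {B : Type _} [CommRing B] [Algebra ℚ B] {v : B}, v ^ (l + 1) = 0 →
      IsNilpotent (logTrunc l v) := by
    intro B _ _ v hv
    refine isNilpotent_sum fun k hk => IsNilpotent.smul ?_ _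
    exact IsNilpotent.pow_of_pos ⟨_, hv⟩ (by simp at hk; omega)
  have hX : (X * C u : R[X]) ^ (l + 1) = 0 := by rw [mul_pow, ← C_pow, hu, C_0, mul_zero]
  have hP := hnil hX
  have key : IsNilpotent.exp (-logTrunc l (X * C u : R[X])) * (1 + X * C u) = 1 := by
    apply Polynomial.eq_of_derivative_eq
    · have h1 : (1 + X * C u) * derivative (logTrunc l (X * C u : R[X])) = C u := by
        have h2 := mul_neg_geom_sum (-(X * C u : R[X])) l
        rw [sub_neg_eq_add] at h2
        rw [derivative_logTrunc_X_mul, mul_left_comm, h2, neg_pow, mul_sub, mul_one,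
          sub_eq_self]
        rw [mul_pow, ← C_pow]
        have h3 : C u * C (u ^ l) = 0 := by rw [← C_mul, ← pow_succ', hu, C_0]
        linear_combination (-1 : R[X]) ^ l * X ^ l * h3
      rw [derivative_mul, Polynomial.derivative_exp hP.neg]
      simp only [derivative_neg, derivative_add, derivative_one, derivative_mul, derivative_X,
        derivative_C, zero_add, one_mul, mul_zero, add_zero]
      linear_combination (-IsNilpotent.exp (-logTrunc l (X * C u : R[X]))) * h1
    · have h1 : (evalRingHom (0 : R)) (IsNilpotent.exp (-logTrunc l (X * C u : R[X]))) = 1 := by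
        rw [IsNilpotent.map_exp hP.neg, map_neg, logTrunc, map_sum,
          sum_eq_zero, neg_zero, IsNilpotent.exp_zero]
        intro k hk
        rw [map_rat_smul, map_pow]
        have : k ≠ 0 := by simp at hk; omega
        simp [this]
      rw [coeff_zero_eq_eval_zero, coeff_zero_eq_eval_zero, eval_mul]
      rw [coe_evalRingHom] at h1
      rw [h1]
      simp
  have h1 := congrArg (evalRingHom (1 : R)) key
  rw [map_mul, IsNilpotent.map_exp hP.neg, map_neg, logTrunc, map_sum] at h1
  have h2 : ∑ k ∈ Icc 1 l, (evalRingHom (1 : R)) (((-1 : ℚ) ^ (k + 1) / k) • (X * C u) ^ k) =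
      logTrunc l u := by
    refine sum_congr rfl fun k _ => ?_
    rw [map_rat_smul, map_pow]
    simp
  rw [h2] at h1
  have h3 : IsNilpotent.exp (-logTrunc l u) * (1 + u) = 1 := by simpa using h1
  calc IsNilpotent.exp (logTrunc l u)
      = IsNilpotent.exp (logTrunc l u) * (IsNilpotent.exp (-logTrunc l u) * (1 + u)) := by
        rw [h3, mul_one]
    _ = 1 + u := by
        rw [← mul_assoc, IsNilpotent.exp_mul_exp_neg_self (hnil hu), one_mul]

/-- The divided difference of the logarithm: `(log (1 + a) - log (1 + b)) / (a - b)` equals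
`log (1 + t) / t · (1 + b)⁻¹` with `t = (a - b) / (1 + b)`, for nilpotent `a` and `b`. Both sides
are compared after the substitution `(a, b) ↦ (X a, X b)`, where their derivatives agree. -/
theorem logTrunc_divided_difference {a b w : R} {h l : ℕ} (ha : a ^ h = 0) (hb : b ^ h = 0)
    (hl : 2 * h ≤ l) (hw : w * (1 + b) = 1) :
    ∑ k ∈ range l, ((-1 : ℚ) ^ k / (k + 1 : ℕ)) • ∑ i ∈ range (k + 1), a ^ i * b ^ (k - i) =
      ∑ k ∈ range l, ((-1 : ℚ) ^ k / (k + 1 : ℕ)) • (((a - b) * w) ^ k * w) := by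
  -- the inverse of `1 + X b`
  set v : R[X] := ∑ i ∈ range h, (-(X * C b)) ^ i with hv
  have hXa : (X * C a : R[X]) ^ h = 0 := by rw [mul_pow, ← C_pow, ha, C_0, mul_zero]
  have hXb : (X * C b : R[X]) ^ h = 0 := by rw [mul_pow, ← C_pow, hb, C_0, mul_zero]
  have hv1 : (1 + X * C b) * v = 1 := by
    have h2 := mul_neg_geom_sum (-(X * C b)) h
    rw [sub_neg_eq_add, neg_pow, hXb, mul_zero, sub_zero] at h2
    exact h2
  have hv' : derivative v = -(C b * v ^ 2) := by
    have h3 := congrArg derivative hv1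
    simp only [derivative_mul, derivative_add, derivative_one, derivative_X, derivative_C,
      zero_add, one_mul, mul_zero, add_zero] at h3
    linear_combination v * h3 - derivative v * hv1
  have hcast : ∀ (k : ℕ) (p : R[X]), ((-1 : ℚ) ^ k / (k + 1 : ℕ)) • ((k + 1 : ℕ) * p) =
      (-1) ^ k * p := by
    intro k p
    rw [natCast_mul_eq_smul, smul_smul, div_mul_cancel₀ _ (by positivity), Algebra.smul_def]
    simp
  have key : ∑ k ∈ range l, ((-1 : ℚ) ^ k / (k + 1 : ℕ)) •
        (X ^ (k + 1) * ∑ i ∈ range (k + 1), C a ^ i * C b ^ (k - i)) =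
      ∑ k ∈ range l, ((-1 : ℚ) ^ k / (k + 1 : ℕ)) •
        (X ^ (k + 1) * ((C a - C b) ^ k * v ^ (k + 1))) := by
    apply Polynomial.eq_of_derivative_eq
    · rw [derivative_sum, derivative_sum]
      have hL : ∑ k ∈ range l, derivative (((-1 : ℚ) ^ k / (k + 1 : ℕ)) •
          (X ^ (k + 1) * ∑ i ∈ range (k + 1), C a ^ i * C b ^ (k - i))) =
          ∑ k ∈ range l, (-1) ^ k *
            ∑ i ∈ range (k + 1), (X * C a) ^ i * (X * C b) ^ (k - i) := by
        refine sum_congr rfl fun k _ => ?_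
        have hc : derivative (∑ i ∈ range (k + 1), C a ^ i * C b ^ (k - i)) = 0 := by
          simp only [← C_pow, ← C_mul, ← map_sum, derivative_C]
        rw [derivative_smul, derivative_mul, hc, mul_zero, add_zero, derivative_X_pow,
          Nat.add_sub_cancel, C_eq_natCast, mul_assoc, hcast, mul_sum]
        congr 1
        refine sum_congr rfl fun i hi => ?_
        have : X ^ k = (X : R[X]) ^ i * X ^ (k - i) := by
          rw [← pow_add]; congr 1; simp at hi; omega
        rw [this]
        ring
      have hR : ∑ k ∈ range l, derivative (((-1 : ℚ) ^ k / (k + 1 : ℕ)) •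
          (X ^ (k + 1) * ((C a - C b) ^ k * v ^ (k + 1)))) =
          v ^ 2 * ∑ k ∈ range l, (-((X * C a - X * C b) * v)) ^ k := by
        rw [mul_sum]
        refine sum_congr rfl fun k _ => ?_
        have hc : derivative ((C a - C b) ^ k : R[X]) = 0 := by
          simp only [← C_pow, ← C_sub, derivative_C]
        rw [derivative_smul, derivative_mul, derivative_mul, hc, derivative_X_pow,
          derivative_pow, Nat.add_sub_cancel, C_eq_natCast, hv']
        have h4 : (((k + 1 : ℕ) : R[X]) * X ^ k * ((C a - C b) ^ k * v ^ (k + 1)) +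
            X ^ (k + 1) * (0 * v ^ (k + 1) + (C a - C b) ^ k *
              (((k + 1 : ℕ) : R[X]) * v ^ k * -(C b * v ^ 2)))) =
            ((k + 1 : ℕ) : R[X]) * (X ^ k * (C a - C b) ^ k * v ^ k * v ^ 2) := by
          have h5 : v - X * C b * v ^ 2 = v ^ 2 := by linear_combination (-v) * hv1
          linear_combination (((k + 1 : ℕ) : R[X]) * X ^ k * (C a - C b) ^ k * v ^ k) * h5
        rw [h4, hcast, neg_pow ((X * C a - X * C b) * v),
          show X * C a - X * C b = X * (C a - C b) by ring, mul_pow, mul_pow]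
        ring
      rw [hL, hR]
      have e1 := one_add_mul_one_add_mul_sum hXa hXb hl
      have hT : ((X * C a - X * C b) * v) ^ l = 0 := by
        rw [mul_pow]
        have := Commute.add_pow_eq_zero_of_add_le_succ_of_pow_eq_zero
          (Commute.all (X * C a : R[X]) (-(X * C b))) hXa
          (by rw [neg_pow, hXb, mul_zero] : (-(X * C b)) ^ h = 0) (k := l) (by omega)
        rw [sub_eq_add_neg, this, zero_mul]
      have e2 := mul_neg_geom_sum (-((X * C a - X * C b) * v)) l
      rw [sub_neg_eq_add, neg_pow, hT, mul_zero, sub_zero] at e2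
      set S1 := ∑ k ∈ range l, (-1) ^ k *
            ∑ i ∈ range (k + 1), (X * C a : R[X]) ^ i * (X * C b) ^ (k - i)
      set S2 := ∑ k ∈ range l, (-((X * C a - X * C b : R[X]) * v)) ^ k
      have e3 : (1 + X * C a) * (1 + X * C b) * (v ^ 2 * S2) = 1 := by
        linear_combination e2 + (S2 + (1 + X * C a) * v * S2) * hv1
      calc S1 = S1 * ((1 + X * C a) * (1 + X * C b) * (v ^ 2 * S2)) := by rw [e3, mul_one]
        _ = (v ^ 2 * S2) * ((1 + X * C a) * (1 + X * C b) * S1) := by ring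
        _ = v ^ 2 * S2 := by rw [e1, mul_one]
    · rw [finsetSum_coeff, finsetSum_coeff]
      refine sum_congr rfl fun k _ => ?_
      simp [coeff_smul, mul_coeff_zero]
  have h1 := congrArg (eval (1 : R)) key
  simp only [eval_finsetSum] at h1
  have hvw : eval 1 v = w := by
    have := congrArg (eval (1 : R)) hv1
    simp only [eval_mul, eval_add, eval_one, eval_X, eval_C, one_mul] at this
    linear_combination w * this - eval 1 v * hw
  have hs : ∀ (q : ℚ) (p : R[X]), eval 1 (q • p) = q • eval 1 p := by
    intro q p
    exact map_rat_smul (evalRingHom (1 : R)) q p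
  simp only [hs, eval_mul, eval_pow, eval_X, one_pow, one_mul, eval_finsetSum, eval_C, eval_sub,
    hvw] at h1
  rw [h1]
  refine sum_congr rfl fun k _ => ?_
  rw [pow_succ, mul_pow, mul_assoc]

end CommutativeIdentities

/-! ### Derivations of logarithms in noncommutative algebras -/

section Noncommutative

open scoped IsMulCommutative

attribute [local instance] LieRing.ofAssociativeRing

variable {A : Type*} [Ring A] [Algebra ℚ A]

theorem map_logTrunc {B : Type*} [Ring B] [Algebra ℚ B] (f : A →ₐ[ℚ] B) (l : ℕ) (u : A) :
    f (logTrunc l u) = logTrunc l (f u) := by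
  simp [logTrunc]

/-- The identity `exp (log (1 + u)) = 1 + u` for a nilpotent element of any `ℚ`-algebra. -/
theorem exp_logTrunc_of_nilpotent {u : A} {l : ℕ} (hu : u ^ (l + 1) = 0) :
    IsNilpotent.exp (logTrunc l u) = 1 + u := by
  have := Algebra.isMulCommutative_adjoin ℚ (s := {u}) (by simp)
  let v : Algebra.adjoin ℚ {u} := ⟨u, Algebra.subset_adjoin rfl⟩
  have hv : v ^ (l + 1) = 0 := Subtype.ext hu
  have hnil : IsNilpotent (logTrunc l v) := by
    refine isNilpotent_sum fun k hk => IsNilpotent.smul ?_ _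
    exact IsNilpotent.pow_of_pos ⟨_, hv⟩ (by simp at hk; omega)
  have h1 := congrArg (Algebra.adjoin ℚ {u}).val (exp_logTrunc hv)
  rw [IsNilpotent.map_exp hnil, map_logTrunc, map_add, map_one] at h1
  exact h1

theorem logTrunc_divided_difference_of_commute {a b w : A} {h l : ℕ} (hab : Commute a b)
    (haw : Commute a w) (hbw : Commute b w) (ha : a ^ h = 0) (hb : b ^ h = 0)
    (hl : 2 * h ≤ l) (hw : w * (1 + b) = 1) :
    ∑ k ∈ range l, ((-1 : ℚ) ^ k / (k + 1 : ℕ)) • ∑ i ∈ range (k + 1), a ^ i * b ^ (k - i) =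
      ∑ k ∈ range l, ((-1 : ℚ) ^ k / (k + 1 : ℕ)) • (((a - b) * w) ^ k * w) := by
  have := Algebra.isMulCommutative_adjoin ℚ (s := {a, b, w}) (by
    rintro _ (rfl | rfl | rfl) _ (rfl | rfl | rfl) <;>
      first
      | rfl
      | exact hab.eq
      | exact hab.eq.symm
      | exact haw.eq
      | exact haw.eq.symm
      | exact hbw.eq
      | exact hbw.eq.symm)
  let a' : Algebra.adjoin ℚ {a, b, w} := ⟨a, Algebra.subset_adjoin (by simp)⟩
  let b' : Algebra.adjoin ℚ {a, b, w} := ⟨b, Algebra.subset_adjoin (by simp)⟩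
  let w' : Algebra.adjoin ℚ {a, b, w} := ⟨w, Algebra.subset_adjoin (by simp)⟩
  have h1 := congrArg (Algebra.adjoin ℚ {a, b, w}).val
    (logTrunc_divided_difference (a := a') (b := b') (w := w') (Subtype.ext ha)
      (Subtype.ext hb) hl (Subtype.ext hw))
  simp only [map_sum, map_smul, map_mul, map_pow, map_sub] at h1
  exact h1

/-- The logarithmic derivative: if `δ (1 + u) = W (1 + u)` for a derivation `δ` and a nilpotent
`u`, then `δ (log (1 + u))` is `log (1 + T) / T` applied to `W`, where `1 + T` is conjugation by
`1 + u`. -/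
theorem derivation_logTrunc (δ : A →ₗ[ℚ] A) (hδ : ∀ a b, δ (a * b) = δ a * b + a * δ b)
    {u v W : A} {h l : ℕ} (hu : u ^ h = 0) (hl : 2 * h ≤ l) (huv : (1 + u) * v = 1)
    (hvu : v * (1 + u) = 1) (hW : δ u = W * (1 + u)) :
    δ (logTrunc l u) = ∑ k ∈ range l, ((-1 : ℚ) ^ k / (k + 1 : ℕ)) •
      ((LinearMap.mulLeft ℚ (1 + u) * LinearMap.mulRight ℚ v - 1) ^ k) W := by
  have hpow : ∀ k, δ (u ^ (k + 1)) = ∑ i ∈ range (k + 1), u ^ i * δ u * u ^ (k - i) := by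
    intro k
    induction k with
    | zero => simp
    | succ k ih =>
      rw [pow_succ, hδ, ih, sum_range_succ _ (k + 1), sum_mul]
      congr 1
      · refine sum_congr rfl fun i hi => ?_
        rw [mul_assoc _ _ u, ← pow_succ]
        congr 2
        simp at hi
        omega
      · simp
  set a : Module.End ℚ A := LinearMap.mulLeft ℚ u with ha
  set b : Module.End ℚ A := LinearMap.mulRight ℚ u with hb
  set w : Module.End ℚ A := LinearMap.mulRight ℚ v with hw
  have huv' : Commute u v := by
    have : u * v = v * u := by
      rw [add_mul, one_mul] at huv
      rw [mul_add, mul_one] at hvu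
      exact add_left_cancel (huv.trans hvu.symm)
    exact this
  have key := logTrunc_divided_difference_of_commute (a := a) (b := b) (w := w) (h := h) (l := l)
    (LinearMap.commute_mulLeft_right _ _) (LinearMap.commute_mulLeft_right _ _)
    (by
      ext z
      simp only [hb, hw, Module.End.mul_apply, LinearMap.mulRight_apply, mul_assoc, huv'.eq])
    (by rw [ha, LinearMap.pow_mulLeft, hu]; simp)
    (by rw [hb, LinearMap.pow_mulRight, hu]; simp) hl
    (by
      ext z
      simp only [hb, hw, Module.End.mul_apply, LinearMap.mulRight_apply, LinearMap.add_apply,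
        Module.End.one_apply, add_mul, mul_assoc]
      rw [← mul_add]
      conv_lhs => rw [show v + u * v = (1 + u) * v by rw [add_mul, one_mul], huv, mul_one])
  have hT : (a - b) * w = LinearMap.mulLeft ℚ (1 + u) * LinearMap.mulRight ℚ v - 1 := by
    ext z
    simp only [ha, hb, hw, Module.End.mul_apply, LinearMap.mulRight_apply, LinearMap.sub_apply,
      LinearMap.mulLeft_apply, Module.End.one_apply]
    have : z * v * (1 + u) = z := by rw [mul_assoc, hvu, mul_one]
    calc u * (z * v) - z * v * u = (1 + u) * (z * v) - z * v * (1 + u) := by noncomm_ring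
      _ = (1 + u) * (z * v) - z := by rw [this]
  have h2 := LinearMap.congr_fun key (δ u)
  rw [hT] at h2
  have hwδ : w (δ u) = W := by
    rw [hW, hw, LinearMap.mulRight_apply, mul_assoc, huv, mul_one]
  simp only [LinearMap.sum_apply, LinearMap.smul_apply, Module.End.mul_apply, hwδ] at h2
  rw [← h2, logTrunc, sum_Icc_one, map_sum]
  refine sum_congr rfl fun k _ => ?_
  rw [map_smul, hpow]
  congr 1
  · ring
  · refine sum_congr rfl fun i _ => ?_
    rw [ha, hb, LinearMap.pow_mulLeft, LinearMap.pow_mulRight, LinearMap.mulLeft_apply,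
      LinearMap.mulRight_apply, mul_assoc]

/-- A derivation that fixes `x` acts on `exp x` as multiplication by `x`. -/
theorem derivation_exp (δ : A →ₗ[ℚ] A) (hδ : ∀ a b, δ (a * b) = δ a * b + a * δ b) {x : A}
    (hx : δ x = x) (hn : IsNilpotent x) :
    δ (IsNilpotent.exp x) = x * IsNilpotent.exp x := by
  obtain ⟨k, hk⟩ := hn
  have hk' : x ^ (k + 1) = 0 := by rw [pow_succ, hk, zero_mul]
  have h1 : δ 1 = 0 := by
    have := hδ 1 1
    simpa using this
  have hpow : ∀ n, δ (x ^ (n + 1)) = ((n + 1 : ℕ) : ℚ) • x ^ (n + 1) := by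
    intro n
    induction n with
    | zero => simp [hx]
    | succ n ih =>
      rw [pow_succ, hδ, ih, hx, smul_mul_assoc, ← pow_succ]
      push_cast
      module
  rw [IsNilpotent.exp_eq_sum hk', map_sum, sum_range_succ', ← IsNilpotent.exp_eq_sum hk',
    IsNilpotent.exp_eq_sum hk, mul_sum]
  simp only [pow_zero, Nat.factorial_zero, Nat.cast_one, inv_one, one_smul, h1, add_zero]
  refine sum_congr rfl fun i _ => ?_
  rw [map_smul, hpow, smul_smul, mul_smul_comm, ← pow_succ', Nat.factorial_succ]
  congr 1
  push_cast
  have := Nat.factorial_ne_zero i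
  field_simp

theorem exp_mulLeft {x : A} (hx : IsNilpotent x) :
    IsNilpotent.exp (LinearMap.mulLeft ℚ x) = LinearMap.mulLeft ℚ (IsNilpotent.exp x) :=
  (IsNilpotent.map_exp hx (Algebra.lmul ℚ A)).symm

theorem exp_mulRight {x : A} (hx : IsNilpotent x) :
    IsNilpotent.exp (LinearMap.mulRight ℚ x) = LinearMap.mulRight ℚ (IsNilpotent.exp x) := by
  obtain ⟨k, hk⟩ := hx
  have hk' : LinearMap.mulRight ℚ x ^ k = 0 := by rw [LinearMap.pow_mulRight, hk]; simp
  ext z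
  rw [IsNilpotent.exp_eq_sum hk', IsNilpotent.exp_eq_sum hk, LinearMap.mulRight_apply, mul_sum,
    LinearMap.sum_apply]
  refine sum_congr rfl fun i _ => ?_
  rw [LinearMap.smul_apply, LinearMap.pow_mulRight, LinearMap.mulRight_apply, mul_smul_comm]

theorem ad_eq_mulLeft_add (x : A) :
    LieAlgebra.ad ℚ A x = LinearMap.mulLeft ℚ x + LinearMap.mulRight ℚ (-x) := by
  ext z
  simp [LieRing.of_associative_ring_bracket, sub_eq_add_neg]

/-- The exponential of `ad x` is conjugation by `exp x`. -/
theorem exp_ad {x : A} (hx : IsNilpotent x) :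
    IsNilpotent.exp (LieAlgebra.ad ℚ A x) =
      LinearMap.mulLeft ℚ (IsNilpotent.exp x) * LinearMap.mulRight ℚ (IsNilpotent.exp (-x)) := by
  have h1 : ∀ y : A, IsNilpotent y → IsNilpotent (LinearMap.mulRight ℚ y) := by
    rintro y ⟨k, hk⟩
    exact ⟨k, by rw [LinearMap.pow_mulRight, hk]; simp⟩
  have h2 : IsNilpotent (LinearMap.mulLeft ℚ x) := hx.map (Algebra.lmul ℚ A)
  rw [ad_eq_mulLeft_add, IsNilpotent.exp_add_of_commute
    (LinearMap.commute_mulLeft_right _ _) h2 (h1 _ hx.neg), exp_mulLeft hx, exp_mulRight hx.neg]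

theorem ad_pow_eq_zero {x : A} {h l : ℕ} (hx : x ^ h = 0) (hl : 2 * h ≤ l + 1) :
    LieAlgebra.ad ℚ A x ^ l = 0 := by
  rw [ad_eq_mulLeft_add]
  refine Commute.add_pow_eq_zero_of_add_le_succ_of_pow_eq_zero
    (LinearMap.commute_mulLeft_right _ _) (m := h) (n := h) ?_ ?_ (by omega)
  · rw [LinearMap.pow_mulLeft, hx]; simp
  · rw [LinearMap.pow_mulRight, neg_pow, hx]; simp

end Noncommutative

/-! ### Dynkin's form of the Baker–Campbell–Hausdorff series -/

theorem nestedLie_cons {L : Type*} [LieRing L] (x : L) {w : List L} (hw : w ≠ []) :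
    nestedLie (x :: w) = ⁅x, nestedLie w⁆ := by
  cases w with
  | nil => exact absurd rfl hw
  | cons y t => rfl

theorem bchWord_cons {L : Type*} (x y : L) {k : ℕ} (a : ℕ × ℕ) (s : Fin k → ℕ × ℕ) :
    bchWord x y (Fin.cons a s : Fin (k + 1) → ℕ × ℕ) =
      List.replicate a.1 x ++ (List.replicate a.2 y ++ bchWord x y s) := by
  simp [bchWord, List.ofFn_succ]

theorem length_bchWord {L : Type*} (x y : L) {k : ℕ} (s : Fin k → ℕ × ℕ) :
    (bchWord x y s).length = ∑ i, ((s i).1 + (s i).2) := by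
  simp [bchWord, List.length_flatten, List.map_ofFn, List.sum_ofFn]

theorem mem_bchWord {L : Type*} {x y z : L} {k : ℕ} {s : Fin k → ℕ × ℕ} (hz : z ∈ bchWord x y s) :
    z = x ∨ z = y := by
  simp only [bchWord, List.mem_flatten, List.mem_ofFn] at hz
  obtain ⟨_, ⟨i, rfl⟩, hz⟩ := hz
  simp only [List.mem_append, List.mem_replicate] at hz
  tauto

section Words

variable {L : Type*} [LieRing L] [LieAlgebra ℚ L]

theorem nestedLie_replicate_append (x : L) (p : ℕ) {w : List L} (hw : w ≠ []) :
    nestedLie (List.replicate p x ++ w) = (LieAlgebra.ad ℚ L x ^ p) (nestedLie w) := by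
  induction p with
  | zero => simp
  | succ p ih =>
    rw [List.replicate_succ, List.cons_append, nestedLie_cons x (by simp [hw]), ih, pow_succ',
      Module.End.mul_apply, LieAlgebra.ad_apply]

theorem nestedLie_replicate (x : L) (p : ℕ) : nestedLie (List.replicate (p + 2) x) = 0 := by
  have h := nestedLie_replicate_append x (p + 1) (w := [x]) (by simp)
  rw [← List.replicate_succ'] at h
  rw [h, pow_succ, Module.End.mul_apply, LieAlgebra.ad_apply]
  simp [nestedLie]

variable {L' : Type*} [LieRing L'] [LieAlgebra ℚ L']

theorem map_nestedLie (f : L →ₗ⁅ℚ⁆ L') (w : List L) :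
    f (nestedLie w) = nestedLie (w.map f) := by
  induction w with
  | nil => simp [nestedLie]
  | cons x t ih =>
    cases t with
    | nil => rfl
    | cons y t => rw [nestedLie_cons x (by simp), f.map_lie, ih]; rfl

theorem map_bchWord (f : L →ₗ⁅ℚ⁆ L') (x y : L) {k : ℕ} (s : Fin k → ℕ × ℕ) :
    (bchWord x y s).map f = bchWord (f x) (f y) s := by
  simp [bchWord, List.map_flatten, List.map_ofFn, Function.comp_def]

theorem map_bchTrunc (f : L →ₗ⁅ℚ⁆ L') (l : ℕ) (x y : L) :
    f (bchTrunc l x y) = bchTrunc l (f x) (f y) := by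
  simp only [bchTrunc, map_sum, map_smul, map_nestedLie, map_bchWord]

end Words

/-- The nonzero blocks of exponents at most `l` in Dynkin's formula. -/
def bchBlocks (l : ℕ) : Finset (ℕ × ℕ) := (range (l + 1) ×ˢ range (l + 1)).erase (0, 0)

theorem Fintype.sum_piFinset_cons {M α : Type*} [AddCommMonoid M] [DecidableEq α] (S : Finset α)
    (k : ℕ) (G : (Fin (k + 1) → α) → M) :
    ∑ s ∈ Fintype.piFinset (fun _ : Fin (k + 1) => S), G s =
      ∑ a ∈ S, ∑ s ∈ Fintype.piFinset (fun _ : Fin k => S), G (Fin.cons a s) := by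
  rw [← sum_product']
  refine sum_nbij' (fun s => (s 0, Fin.tail s)) (fun p => Fin.cons p.1 p.2) ?_ ?_ ?_ ?_ ?_
  · intro s hs
    simp only [Fintype.mem_piFinset] at hs
    simp only [mem_product, Fintype.mem_piFinset]
    exact ⟨hs 0, fun i => hs i.succ⟩
  · rintro ⟨a, s⟩ hs
    simp only [mem_product, Fintype.mem_piFinset] at hs
    simp only [Fintype.mem_piFinset]
    intro i
    refine Fin.cases hs.1 (fun i => ?_) i
    simpa using hs.2 i
  · intro s _
    exact Fin.cons_self_tail s
  · rintro ⟨a, s⟩ _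
    simp
  · intro s _
    rw [Fin.cons_self_tail]

theorem bchWord_ne_nil {L : Type*} (x y : L) {k l : ℕ} {s : Fin (k + 1) → ℕ × ℕ}
    (hs : s ∈ Fintype.piFinset (fun _ : Fin (k + 1) => bchBlocks l)) : bchWord x y s ≠ [] := by
  intro h
  have h1 := congrArg List.length h
  rw [length_bchWord, Fin.sum_univ_succ] at h1
  have h2 := (Fintype.mem_piFinset.mp hs) 0
  rw [bchBlocks, mem_erase] at h2
  apply h2.1
  simp at h1
  exact Prod.ext h1.1.1 h1.1.2

section Dynkin

variable {L : Type*} [LieRing L] [LieAlgebra ℚ L]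

/-- The sum of the nested brackets of all words with `k` blocks, without the factor
`(-1)^{k+1} / k` and without the division by the length of the word. -/
noncomputable def dynkinSum (l : ℕ) (x y : L) (k : ℕ) : L :=
  ∑ s ∈ Fintype.piFinset (fun _ : Fin k => bchBlocks l),
    ((∏ i, (s i).1.factorial * (s i).2.factorial : ℕ) : ℚ)⁻¹ • nestedLie (bchWord x y s)

/-- The operator `exp (ad x) exp (ad y) - 1`, truncated. -/
noncomputable def dynkinOperator (l : ℕ) (x y : L) : Module.End ℚ L :=
  ∑ a ∈ bchBlocks l, ((a.1.factorial * a.2.factorial : ℕ) : ℚ)⁻¹ •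
    (LieAlgebra.ad ℚ L x ^ a.1 * LieAlgebra.ad ℚ L y ^ a.2)

/-- Splitting off the first block of each word. -/
theorem dynkinSum_succ (l : ℕ) (x y : L) (k : ℕ) :
    dynkinSum l x y (k + 2) = dynkinOperator l x y (dynkinSum l x y (k + 1)) := by
  rw [dynkinSum, Fintype.sum_piFinset_cons, dynkinOperator, LinearMap.sum_apply]
  refine sum_congr rfl fun a _ => ?_
  rw [dynkinSum, map_sum]
  refine sum_congr rfl fun s hs => ?_
  have hw := bchWord_ne_nil x y hs
  rw [bchWord_cons, nestedLie_replicate_append _ _ (by simp [hw]),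
    nestedLie_replicate_append _ _ hw, LinearMap.smul_apply, Module.End.mul_apply, map_smul,
    map_smul, smul_smul]
  congr 1
  rw [Fin.prod_univ_succ]
  simp only [Fin.cons_zero, Fin.cons_succ]
  push_cast
  rw [mul_inv]

theorem dynkinSum_eq_pow (l : ℕ) (x y : L) (k : ℕ) :
    dynkinSum l x y (k + 1) = (dynkinOperator l x y ^ k) (dynkinSum l x y 1) := by
  induction k with
  | zero => simp
  | succ k ih => rw [dynkinSum_succ, ih, pow_succ', Module.End.mul_apply]

theorem sum_range_eq_first_two {M : Type*} [AddCommMonoid M] {l : ℕ} (hl : 1 ≤ l) (f : ℕ → M)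
    (hf : ∀ n, f (n + 2) = 0) : ∑ n ∈ range (l + 1), f n = f 0 + f 1 := by
  obtain ⟨m, rfl⟩ := Nat.exists_eq_add_of_le' hl
  rw [sum_range_succ', sum_range_succ', sum_eq_zero (fun i _ => hf i), zero_add, add_comm]

/-- Among the words of one block `x^p y^q`, only `x` and the `x^p y` have a nonzero bracket. -/
theorem dynkinSum_one {l : ℕ} (hl : 1 ≤ l) (x y : L) :
    dynkinSum l x y 1 = x + ∑ p ∈ range (l + 1),
      (p.factorial : ℚ)⁻¹ • (LieAlgebra.ad ℚ L x ^ p) y := by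
  have h0 : dynkinSum l x y 1 = ∑ a ∈ bchBlocks l,
      ((a.1.factorial * a.2.factorial : ℕ) : ℚ)⁻¹ •
        nestedLie (List.replicate a.1 x ++ List.replicate a.2 y) := by
    rw [dynkinSum, Fintype.sum_piFinset_cons]
    refine sum_congr rfl fun a _ => ?_
    rw [Fintype.piFinset_of_isEmpty, univ_unique, sum_singleton, bchWord_cons]
    simp [bchWord]
  rw [h0, bchBlocks, sum_erase _ (by simp [nestedLie]), sum_product]
  have h1 : ∀ p, ∑ q ∈ range (l + 1), ((p.factorial * q.factorial : ℕ) : ℚ)⁻¹ •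
      nestedLie (List.replicate p x ++ List.replicate q y) =
      (p.factorial : ℚ)⁻¹ • nestedLie (List.replicate p x) +
        (p.factorial : ℚ)⁻¹ • (LieAlgebra.ad ℚ L x ^ p) y := by
    intro p
    rw [sum_range_eq_first_two hl]
    · rw [nestedLie_replicate_append _ _ (by simp : List.replicate 1 y ≠ [])]
      simp [nestedLie]
    · intro n
      rw [nestedLie_replicate_append _ _ (by simp), nestedLie_replicate, map_zero, smul_zero]
  simp only [h1, sum_add_distrib]
  congr 1
  rw [sum_range_eq_first_two hl]
  · simp [nestedLie]
  · intro n
    rw [nestedLie_replicate, smul_zero]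

end Dynkin

section BCH

variable {A : Type*} [Ring A] [Algebra ℚ A]

attribute [local instance] LieRing.ofAssociativeRing

theorem derivation_nestedLie (δ : A →ₗ[ℚ] A) (hδ : ∀ a b, δ (a * b) = δ a * b + a * δ b)
    (w : List A) (hw : ∀ a ∈ w, δ a = a) :
    δ (nestedLie w) = (w.length : ℚ) • nestedLie w := by
  induction w with
  | nil => simp [nestedLie]
  | cons x t ih =>
    cases t with
    | nil => simpa [nestedLie] using hw x (by simp)
    | cons y t =>
      have h1 := ih (fun a ha => hw a (List.mem_cons_of_mem _ ha))
      rw [nestedLie_cons x (by simp), LieRing.of_associative_ring_bracket, map_sub, hδ, hδ, h1,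
        hw x (by simp), List.length_cons (a := x)]
      push_cast
      simp only [mul_smul_comm, smul_mul_assoc]
      module

/-- A derivation that fixes `x` and `y` multiplies a bracket by its length, which cancels the length
in the denominators of Dynkin's formula. -/
theorem derivation_bchTrunc (δ : A →ₗ[ℚ] A) (hδ : ∀ a b, δ (a * b) = δ a * b + a * δ b)
    {x y : A} (hx : δ x = x) (hy : δ y = y) (l : ℕ) :
    δ (bchTrunc l x y) = ∑ k ∈ range l, ((-1 : ℚ) ^ k / (k + 1 : ℕ)) •
      dynkinSum l x y (k + 1) := by
  rw [bchTrunc, sum_Icc_one, map_sum]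
  refine sum_congr rfl fun k _ => ?_
  rw [map_sum, dynkinSum, smul_sum]
  refine sum_congr rfl fun s hs => ?_
  have hlen := bchWord_ne_nil x y hs
  rw [map_smul, derivation_nestedLie δ hδ _ (fun a ha => by
    rcases mem_bchWord ha with rfl | rfl <;> assumption), smul_smul, smul_smul]
  congr 1
  rw [Ne, ← List.length_eq_zero_iff, length_bchWord] at hlen
  rw [length_bchWord]
  have h1 : ((∑ i, ((s i).1 + (s i).2) : ℕ) : ℚ) ≠ 0 := by exact_mod_cast hlen
  generalize ((∑ i, ((s i).1 + (s i).2) : ℕ) : ℚ) = r at h1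
  have h2 : ((∏ i, (s i).1.factorial * (s i).2.factorial : ℕ) : ℚ) ≠ 0 := by
    rw [Nat.cast_ne_zero, prod_ne_zero_iff]
    intro i _
    exact Nat.mul_ne_zero (Nat.factorial_ne_zero _) (Nat.factorial_ne_zero _)
  generalize ((∏ i, (s i).1.factorial * (s i).2.factorial : ℕ) : ℚ) = d at h2
  have h3 : ((k + 1 : ℕ) : ℚ) ≠ 0 := by positivity
  field_simp
  ring

/-- In a nilpotent situation the operator in Dynkin's formula is conjugation by `exp x exp y`,
minus the identity. -/
theorem dynkinOperator_eq {x y : A} {h l : ℕ} (hx : x ^ h = 0) (hy : y ^ h = 0)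
    (hl : 2 * h ≤ l) :
    dynkinOperator l x y =
      LinearMap.mulLeft ℚ (IsNilpotent.exp x * IsNilpotent.exp y) *
        LinearMap.mulRight ℚ (IsNilpotent.exp (-y) * IsNilpotent.exp (-x)) - 1 := by
  have h1 : dynkinOperator l x y = IsNilpotent.exp (LieAlgebra.ad ℚ A x) *
      IsNilpotent.exp (LieAlgebra.ad ℚ A y) - 1 := by
    rw [IsNilpotent.exp_eq_sum (ad_pow_eq_zero hx (l := l + 1) (by omega)),
      IsNilpotent.exp_eq_sum (ad_pow_eq_zero hy (l := l + 1) (by omega)), sum_mul_sum,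
      ← sum_product', dynkinOperator, bchBlocks, eq_sub_iff_add_eq']
    rw [← add_sum_erase _ _ (show ((0, 0) : ℕ × ℕ) ∈ range (l + 1) ×ˢ range (l + 1) by simp)]
    congr 1
    · simp
    · refine sum_congr rfl fun a _ => ?_
      rw [smul_mul_smul_comm]
      push_cast
      rw [mul_inv]
  rw [h1, exp_ad ⟨h, hx⟩, exp_ad ⟨h, hy⟩]
  ext z
  simp [mul_assoc]

/-- The Baker–Campbell–Hausdorff formula after applying a derivation `δ` that fixes `x` and `y`:
both sides equal `log (1 + T) / T` applied to the logarithmic derivative `x + e^x y e^{-x}` of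
`e^x e^y`, where `1 + T` is conjugation by `e^x e^y`. -/
theorem derivation_bchTrunc_eq (δ : A →ₗ[ℚ] A) (hδ : ∀ a b, δ (a * b) = δ a * b + a * δ b)
    {x y : A} (hx : δ x = x) (hy : δ y = y) {h l : ℕ} (hxn : x ^ h = 0) (hyn : y ^ h = 0)
    (hu : (IsNilpotent.exp x * IsNilpotent.exp y - 1) ^ h = 0) (hl : 2 * h ≤ l) (hl1 : 1 ≤ l) :
    δ (bchTrunc l x y) = δ (logTrunc l (IsNilpotent.exp x * IsNilpotent.exp y - 1)) := by
  have hxn' : IsNilpotent x := ⟨h, hxn⟩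
  have hyn' : IsNilpotent y := ⟨h, hyn⟩
  have hδ1 : δ 1 = 0 := by simpa using hδ 1 1
  have ex := IsNilpotent.exp_mul_exp_neg_self hxn'
  have ex' := IsNilpotent.exp_neg_mul_exp_self hxn'
  have ey := IsNilpotent.exp_mul_exp_neg_self hyn'
  have ey' := IsNilpotent.exp_neg_mul_exp_self hyn'
  have hW : dynkinSum l x y 1 = x + IsNilpotent.exp x * y * IsNilpotent.exp (-x) := by
    rw [dynkinSum_one hl1]
    congr 1
    have h2 := LinearMap.congr_fun (exp_ad hxn') y
    rw [IsNilpotent.exp_eq_sum (ad_pow_eq_zero hxn (l := l + 1) (by omega))] at h2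
    simpa [mul_assoc] using h2
  rw [derivation_bchTrunc δ hδ hx hy, derivation_logTrunc δ hδ hu hl
    (v := IsNilpotent.exp (-y) * IsNilpotent.exp (-x))
    (W := x + IsNilpotent.exp x * y * IsNilpotent.exp (-x))]
  · refine sum_congr rfl fun k _ => ?_
    rw [dynkinSum_eq_pow, dynkinOperator_eq hxn hyn hl, hW, add_sub_cancel]
  · rw [add_sub_cancel, mul_assoc, ← mul_assoc _ _ (IsNilpotent.exp (-x)), ey, one_mul, ex]
  · rw [add_sub_cancel, mul_assoc, ← mul_assoc _ _ (IsNilpotent.exp y), ex', one_mul, ey']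
  · rw [add_sub_cancel, map_sub, hδ1, sub_zero, hδ, derivation_exp δ hδ hx hxn',
      derivation_exp δ hδ hy hyn', add_mul, mul_assoc x]
    congr 1
    calc IsNilpotent.exp x * (y * IsNilpotent.exp y)
        = IsNilpotent.exp x * y * (IsNilpotent.exp (-x) * IsNilpotent.exp x) *
            IsNilpotent.exp y := by rw [ex', mul_one, mul_assoc]
      _ = _ := by noncomm_ring

end BCH

/-! ### The Baker–Campbell–Hausdorff formula in a nilpotent filtration -/

section NilFiltration

/-- A decreasing multiplicative filtration of an algebra by subspaces whose `h`-th step vanishes.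
The unit is not required to lie in step `0`. -/
structure IsNilFiltration {A : Type*} [Ring A] [Algebra ℚ A] (J : ℕ → Submodule ℚ A) (h : ℕ) :
    Prop where
  mul_mem : ∀ {i j : ℕ} {a b : A}, a ∈ J i → b ∈ J j → a * b ∈ J (i + j)
  anti : Antitone J
  eq_zero : ∀ {a : A}, a ∈ J h → a = 0

open Polynomial in
/-- The polynomials whose coefficients lie in a given step of a filtration. -/
def polynomialFiltration {A : Type*} [Ring A] [Algebra ℚ A] (J : ℕ → Submodule ℚ A) (k : ℕ) :
    Submodule ℚ A[X] where
  carrier := {p | ∀ n, p.coeff n ∈ J k}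
  add_mem' := fun hp hq n => by rw [coeff_add]; exact Submodule.add_mem _ (hp n) (hq n)
  zero_mem' := fun n => by rw [coeff_zero]; exact Submodule.zero_mem _
  smul_mem' := fun c p hp n => by rw [coeff_smul]; exact Submodule.smul_mem _ _ (hp n)

namespace IsNilFiltration

variable {A : Type*} [Ring A] [Algebra ℚ A] {J : ℕ → Submodule ℚ A} {h : ℕ}

theorem mul_mem_one (hJ : IsNilFiltration J h) {a b : A} (ha : a ∈ J 1) (hb : b ∈ J 1) :
    a * b ∈ J 1 := hJ.anti (by omega : 1 ≤ 1 + 1) (hJ.mul_mem ha hb)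

theorem pow_mem (hJ : IsNilFiltration J h) {a : A} (ha : a ∈ J 1) (n : ℕ) :
    a ^ (n + 1) ∈ J (n + 1) := by
  induction n with
  | zero => simpa using ha
  | succ n ih => rw [pow_succ]; exact hJ.mul_mem ih ha

theorem pow_eq_zero (hJ : IsNilFiltration J h) {a : A} (ha : a ∈ J 1) : a ^ (h + 1) = 0 :=
  hJ.eq_zero (hJ.anti (by omega) (hJ.pow_mem ha h))

theorem isNilpotent (hJ : IsNilFiltration J h) {a : A} (ha : a ∈ J 1) : IsNilpotent a :=
  ⟨_, hJ.pow_eq_zero ha⟩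

theorem exp_sub_one_mem (hJ : IsNilFiltration J h) {a : A} (ha : a ∈ J 1) :
    IsNilpotent.exp a - 1 ∈ J 1 := by
  rw [IsNilpotent.exp_eq_sum (hJ.pow_eq_zero ha), sum_range_succ']
  simp only [pow_zero, Nat.factorial_zero, Nat.cast_one, inv_one, one_smul, add_sub_cancel_right]
  exact Submodule.sum_mem _ fun i _ => Submodule.smul_mem _ _
    (hJ.anti (by omega) (hJ.pow_mem ha i))

theorem exp_mul_exp_sub_one_mem (hJ : IsNilFiltration J h) {a b : A} (ha : a ∈ J 1)
    (hb : b ∈ J 1) : IsNilpotent.exp a * IsNilpotent.exp b - 1 ∈ J 1 := by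
  have : IsNilpotent.exp a * IsNilpotent.exp b - 1 =
      (IsNilpotent.exp a - 1) * (IsNilpotent.exp b - 1) + (IsNilpotent.exp a - 1) +
        (IsNilpotent.exp b - 1) := by noncomm_ring
  rw [this]
  exact Submodule.add_mem _ (Submodule.add_mem _ (hJ.mul_mem_one (hJ.exp_sub_one_mem ha)
    (hJ.exp_sub_one_mem hb)) (hJ.exp_sub_one_mem ha)) (hJ.exp_sub_one_mem hb)

/-- The exponential is injective on the first step of a nilpotent filtration. -/
theorem exp_injOn (hJ : IsNilFiltration J h) {a b : A} (ha : a ∈ J 1) (hb : b ∈ J 1)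
    (hab : IsNilpotent.exp a = IsNilpotent.exp b) : a = b := by
  have key : ∀ k, 1 ≤ k → a - b ∈ J k → a - b ∈ J (k + 1) := by
    intro k hk hd
    have hpow : ∀ n, a ^ (n + 2) - b ^ (n + 2) ∈ J (k + 1) := by
      have step : ∀ n, a ^ (n + 1) - b ^ (n + 1) ∈ J k := by
        intro n
        induction n with
        | zero => simpa using hd
        | succ n ih =>
          rw [show a ^ (n + 1 + 1) - b ^ (n + 1 + 1) =
            a * (a ^ (n + 1) - b ^ (n + 1)) + (a - b) * b ^ (n + 1) by
              rw [pow_succ' a, pow_succ' b]; noncomm_ring]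
          exact Submodule.add_mem _ (hJ.anti (by omega) (hJ.mul_mem ha ih))
            (hJ.anti (by omega) (hJ.mul_mem hd (hJ.pow_mem hb n)))
      intro n
      rw [show a ^ (n + 2) - b ^ (n + 2) =
        a * (a ^ (n + 1) - b ^ (n + 1)) + (a - b) * b ^ (n + 1) by
          rw [pow_succ' a, pow_succ' b]; noncomm_ring]
      exact Submodule.add_mem _ (hJ.anti (by omega) (hJ.mul_mem ha (step n)))
        (hJ.anti (by omega) (hJ.mul_mem hd (hJ.pow_mem hb n)))
    have ha0 : a ^ (h + 2) = 0 := by rw [pow_succ, hJ.pow_eq_zero ha, zero_mul]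
    have hb0 : b ^ (h + 2) = 0 := by rw [pow_succ, hJ.pow_eq_zero hb, zero_mul]
    rw [IsNilpotent.exp_eq_sum ha0, IsNilpotent.exp_eq_sum hb0, ← sub_eq_zero,
      ← sum_sub_distrib, sum_range_succ', sum_range_succ'] at hab
    have h1 : a - b = -∑ i ∈ range h, (((i + 1 + 1).factorial : ℚ)⁻¹ • a ^ (i + 1 + 1) -
        ((i + 1 + 1).factorial : ℚ)⁻¹ • b ^ (i + 1 + 1)) := by
      simp only [zero_add, pow_one, Nat.factorial_one, Nat.cast_one, inv_one, one_smul, pow_zero,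
        Nat.factorial_zero, sub_self, add_zero] at hab
      rw [eq_neg_iff_add_eq_zero, add_comm]
      exact hab
    rw [h1]
    refine Submodule.neg_mem _ (Submodule.sum_mem _ fun i _ => ?_)
    rw [← smul_sub]
    exact Submodule.smul_mem _ _ (hpow i)
  have h1 : ∀ k, a - b ∈ J (k + 1) := by
    intro k
    induction k with
    | zero => exact Submodule.sub_mem _ ha hb
    | succ k ih => exact key _ (by omega) ih
  exact sub_eq_zero.mp (hJ.eq_zero (hJ.anti (Nat.le_succ h) (h1 h)))

open Polynomial in
/-- The coefficientwise filtration of the polynomial ring. -/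
theorem polynomial (hJ : IsNilFiltration J h) : IsNilFiltration (polynomialFiltration J) h where
  mul_mem := by
    intro i j a b ha hb n
    rw [coeff_mul]
    exact Submodule.sum_mem _ fun x _ => hJ.mul_mem (ha _) (hb _)
  anti := fun i j hij p hp n => hJ.anti hij (hp n)
  eq_zero := fun {a} ha => by ext n; rw [coeff_zero]; exact hJ.eq_zero (ha n)

attribute [local instance] LieRing.ofAssociativeRing

theorem bchTrunc_zero (l : ℕ) : bchTrunc l (0 : A) 0 = 0 := by
  refine sum_eq_zero fun k _ => sum_eq_zero fun s _ => ?_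
  have : ∀ w : List A, (∀ a ∈ w, a = 0) → nestedLie w = 0 := by
    intro w
    cases w with
    | nil => simp [nestedLie]
    | cons x t =>
      intro hw
      cases t with
      | nil => simpa [nestedLie] using hw
      | cons y t =>
        rw [nestedLie_cons _ (by simp), hw x (by simp), zero_lie]
  rw [this _ fun a ha => by rcases mem_bchWord ha with rfl | rfl <;> rfl, smul_zero]

open Polynomial in
/-- The Baker–Campbell–Hausdorff formula in Dynkin's form, in a nilpotent situation. The logarithm
and Dynkin's sum are compared over `A[X]`, at `X x` and `X y`, by means of the derivation
`X d/dX`. -/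
theorem exp_bchTrunc (hJ : IsNilFiltration J h) {x y : A} (hx : x ∈ J 1) (hy : y ∈ J 1) {l : ℕ}
    (hl : 2 * (h + 1) ≤ l) :
    IsNilpotent.exp (bchTrunc l x y) = IsNilpotent.exp x * IsNilpotent.exp y := by
  have hJX := hJ.polynomial
  have hmem : ∀ {z : A}, z ∈ J 1 → (X * C z : A[X]) ∈ polynomialFiltration J 1 := by
    intro z hz n
    rw [X_mul_C, coeff_C_mul, coeff_X]
    split_ifs
    · simpa using hz
    · simp
  let δ : A[X] →ₗ[ℚ] A[X] := LinearMap.mulLeft ℚ X ∘ₗ (derivative.restrictScalars ℚ)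
  have hδapply : ∀ p : A[X], δ p = X * derivative p := fun p => rfl
  have hδ : ∀ a b : A[X], δ (a * b) = δ a * b + a * δ b := by
    intro a b
    rw [hδapply, hδapply, hδapply, derivative_mul, mul_add, mul_assoc, ← mul_assoc X a,
      X_mul (p := a), mul_assoc]
  have hδX : ∀ z : A, δ (X * C z) = X * C z := by
    intro z
    rw [hδapply, derivative_mul, derivative_X, derivative_C, one_mul, mul_zero, add_zero]
  have hxX := hmem hx
  have hyX := hmem hy
  have huX := hJX.exp_mul_exp_sub_one_mem hxX hyX
  have hu := hJ.exp_mul_exp_sub_one_mem hx hy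
  have key := derivation_bchTrunc_eq δ hδ (hδX x) (hδX y) (hJX.pow_eq_zero hxX)
    (hJX.pow_eq_zero hyX) (hJX.pow_eq_zero huX) hl (by omega)
  -- evaluation at the central points `0` and `1`
  let ev : ∀ c : ℚ, A[X] →ₐ[ℚ] A := fun c =>
    { toRingHom := eval₂RingHom' (RingHom.id A) (algebraMap ℚ A c)
        (fun a => (Algebra.commutes c a).symm)
      commutes' := fun r => by
        show eval₂ (RingHom.id A) _ (algebraMap ℚ A[X] r) = _
        rw [Polynomial.algebraMap_apply, eval₂_C]; rfl }
  have hevX : ∀ (c : ℚ) (z : A), ev c (X * C z) = c • z := by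
    intro c z
    rw [map_mul]
    show eval₂ (RingHom.id A) _ X * eval₂ (RingHom.id A) _ (C z) = _
    rw [eval₂_X, eval₂_C, Algebra.smul_def]
    rfl
  have hevexp : ∀ (c : ℚ) {z : A}, z ∈ J 1 →
      ev c (IsNilpotent.exp (X * C z)) = IsNilpotent.exp (c • z) := by
    intro c z hz
    rw [IsNilpotent.map_exp (hJX.isNilpotent (hmem hz)), hevX]
  have hevbch : ∀ c : ℚ, ev c (bchTrunc l (X * C x) (X * C y)) = bchTrunc l (c • x) (c • y) := by
    intro c
    have := map_bchTrunc (ev c : A[X] →ₗ⁅ℚ⁆ A) l (X * C x) (X * C y)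
    simpa only [AlgHom.coe_toLieHom, hevX] using this
  have hevlog : ∀ c : ℚ,
      ev c (logTrunc l (IsNilpotent.exp (X * C x) * IsNilpotent.exp (X * C y) - 1)) =
        logTrunc l (IsNilpotent.exp (c • x) * IsNilpotent.exp (c • y) - 1) := by
    intro c
    rw [map_logTrunc, map_sub, map_mul, map_one, hevexp c hx, hevexp c hy]
  have hcoeff : ∀ p : A[X], ev 0 p = p.coeff 0 := by
    intro p
    show eval₂ (RingHom.id A) (algebraMap ℚ A 0) p = _
    rw [map_zero, ← eval, coeff_zero_eq_eval_zero]
  have hH : bchTrunc l (X * C x) (X * C y) =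
      logTrunc l (IsNilpotent.exp (X * C x) * IsNilpotent.exp (X * C y) - 1) := by
    ext n
    cases n with
    | zero =>
      rw [← hcoeff, ← hcoeff, hevbch, hevlog]
      simp only [zero_smul, IsNilpotent.exp_zero, mul_one, sub_self, bchTrunc_zero]
      rw [logTrunc, sum_eq_zero]
      intro k hk
      rw [zero_pow (by simp at hk; omega), smul_zero]
    | succ n =>
      have h1 := congrArg (fun p => p.coeff (n + 1)) key
      simp only [hδapply, coeff_X_mul, coeff_derivative] at h1
      have h2 : ∀ a : A, a * ((n : A) + 1) = ((n : ℚ) + 1) • a := by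
        intro a
        rw [Algebra.smul_def, Algebra.commutes]
        simp
      rw [h2, h2] at h1
      exact smul_right_injective A (by positivity : ((n : ℚ) + 1) ≠ 0) h1
  have h1 := congrArg (ev 1) hH
  rw [hevbch, hevlog] at h1
  simp only [one_smul] at h1
  rw [h1, exp_logTrunc_of_nilpotent, add_sub_cancel]
  exact pow_eq_zero_of_le (by omega) (hJ.pow_eq_zero hu)

end IsNilFiltration

end NilFiltration

/-! ### The truncated adjoint representation and the group structure -/

namespace NPlus

theorem deg_pos (v : NPlus) : 0 < v.deg := v.pos

theorem add_right_cancel' {u v w : NPlus} (h : u + w = v + w) : u = v := by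
  have h1 := congrArg NPlus.fst h
  have h2 := congrArg NPlus.snd h
  simp only [add_fst, add_snd] at h1 h2
  ext <;> omega

theorem add_left_cancel' {u v w : NPlus} (h : w + u = w + v) : u = v := by
  rw [add_comm' w u, add_comm' w v] at h
  exact add_right_cancel' h

theorem deg_lt_of_mem_splittings {v : NPlus} {p : NPlus × NPlus} (hp : p ∈ v.splittings) :
    p.1.deg < v.deg ∧ p.2.deg < v.deg := by
  have h1 := deg_add p.1 p.2
  rw [mem_splittings.mp hp] at h1
  have := p.1.deg_pos
  have := p.2.deg_pos
  omega

end NPlus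

namespace GHat

/-- The coefficient of `X_v` as a linear form. -/
def coeffLinear (v : NPlus) : GHat →ₗ[ℚ] ℚ where
  toFun x := x.coeff v
  map_add' _ _ := rfl
  map_smul' _ _ := rfl

theorem coeff_sum {ι : Type*} (s : Finset ι) (f : ι → GHat) (v : NPlus) :
    (∑ i ∈ s, f i).coeff v = ∑ i ∈ s, (f i).coeff v :=
  map_sum (coeffLinear v) f s

/-- The basis element `X_v`. -/
def single (v : NPlus) : GHat := ⟨fun w => if w = v then 1 else 0⟩

@[simp] theorem coeff_single (v w : NPlus) : (single v).coeff w = if w = v then 1 else 0 := rfl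

theorem coeff_lie_single_add (x : GHat) (v w : NPlus) :
    ⁅x, single w⁆.coeff (v + w) = v.form w * x.coeff v := by
  rw [coeff_lie, sum_eq_single (v, w)]
  · simp
  · rintro ⟨a, b⟩ hp hne
    rw [NPlus.mem_splittings] at hp
    have : b ≠ w := by
      rintro rfl
      exact hne (Prod.ext (NPlus.add_right_cancel' hp) rfl)
    simp [this]
  · intro h
    simp at h

/-- A bracket of `r` elements has no component of degree less than `r`. -/
theorem coeff_nestedLie_eq_zero (w : List GHat) (v : NPlus) (hv : v.deg < w.length) :
    (nestedLie w).coeff v = 0 := by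
  induction w generalizing v with
  | nil => simp at hv
  | cons x t ih =>
    cases t with
    | nil =>
      have := v.deg_pos
      simp at hv
      omega
    | cons y t =>
      rw [nestedLie_cons x (by simp), coeff_lie]
      refine sum_eq_zero fun p hp => ?_
      have h1 := NPlus.deg_lt_of_mem_splittings hp
      rw [ih p.2 (by simp at hv ⊢; omega), mul_zero]

/-- The truncation in the Baker–Campbell–Hausdorff sum does not affect components of low degree. -/
theorem coeff_bchTrunc_eq {l : ℕ} {v : NPlus} (hv : v.deg ≤ l) (x y : GHat) :
    (bchTrunc l x y).coeff v = (bchTrunc v.deg x y).coeff v := by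
  simp only [bchTrunc, coeff_sum, coeff_smul]
  have hz : ∀ (k : ℕ) (s : Fin k → ℕ × ℕ), v.deg < ∑ i, ((s i).1 + (s i).2) →
      (nestedLie (bchWord x y s)).coeff v = 0 := by
    intro k s hs
    exact coeff_nestedLie_eq_zero _ _ (by rwa [length_bchWord])
  symm
  have hinner : ∀ k, ∑ s ∈ Fintype.piFinset (fun _ : Fin k =>
        (range (v.deg + 1) ×ˢ range (v.deg + 1)).erase (0, 0)),
      ((-1 : ℚ) ^ (k + 1) / (k * (∑ i, ((s i).1 + (s i).2) : ℕ) *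
          (∏ i, (s i).1.factorial * (s i).2.factorial : ℕ))) *
        (nestedLie (bchWord x y s)).coeff v =
      ∑ s ∈ Fintype.piFinset (fun _ : Fin k => (range (l + 1) ×ˢ range (l + 1)).erase (0, 0)),
      ((-1 : ℚ) ^ (k + 1) / (k * (∑ i, ((s i).1 + (s i).2) : ℕ) *
          (∏ i, (s i).1.factorial * (s i).2.factorial : ℕ))) *
        (nestedLie (bchWord x y s)).coeff v := by
    intro k
    refine sum_subset ?_ ?_
    · refine Fintype.piFinset_subset _ _ fun _ => erase_subset_erase _ ?_
      exact product_subset_product (range_mono (by omega)) (range_mono (by omega))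
    · intro s hs hs'
      rw [hz, mul_zero]
      simp only [Fintype.mem_piFinset, mem_erase, mem_product, mem_range, not_forall] at hs hs'
      obtain ⟨i, hi⟩ := hs'
      have h1 : (s i).1 + (s i).2 ≤ ∑ i, ((s i).1 + (s i).2) :=
        single_le_sum (f := fun i => (s i).1 + (s i).2) (fun _ _ => Nat.zero_le _) (mem_univ i)
      have h2 := (hs i).1
      rw [not_and_or, not_and_or] at hi
      rcases hi with hi | hi | hi
      · exact absurd h2 hi
      · omega
      · omega
  rw [sum_congr rfl fun k _ => hinner k]
  refine sum_subset (Icc_subset_Icc le_rfl hv) ?_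
  intro k hk hk'
  refine sum_eq_zero fun s hs => ?_
  rw [hz, mul_zero]
  have h1 : ∑ _i : Fin k, 1 ≤ ∑ i, ((s i).1 + (s i).2) := by
    refine sum_le_sum fun i _ => ?_
    have := Fintype.mem_piFinset.mp hs i
    rw [mem_erase] at this
    by_contra hlt
    exact this.1 (Prod.ext (by simp; omega) (by simp; omega))
  simp at h1 hk hk'
  omega

/-- The projection of `GHat` that forgets all components of degree greater than `l`. -/
def truncation (l : ℕ) : Module.End ℚ GHat where
  toFun f := ⟨fun v => if v.deg ≤ l then f.coeff v else 0⟩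
  map_add' f g := by ext v; simp only [coeff_add]; split_ifs <;> simp
  map_smul' c f := by ext v; simp

theorem coeff_truncation (l : ℕ) (f : GHat) (v : NPlus) :
    (truncation l f).coeff v = if v.deg ≤ l then f.coeff v else 0 := rfl

attribute [local instance] LieRing.ofAssociativeRing

/-- The truncated adjoint representation: `X` acts by `f ↦ [X, f]` followed by the truncation at
degree `l`. -/
def adTrunc (l : ℕ) : GHat →ₗ⁅ℚ⁆ Module.End ℚ GHat where
  toFun X := truncation l * LieAlgebra.ad ℚ GHat X
  map_add' X Y := by rw [map_add, mul_add]
  map_smul' c X := by rw [map_smul, mul_smul_comm]; rfl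
  map_lie' := by
    have key : ∀ X Y : GHat, truncation l * LieAlgebra.ad ℚ GHat X *
        (truncation l * LieAlgebra.ad ℚ GHat Y) =
        truncation l * (LieAlgebra.ad ℚ GHat X * LieAlgebra.ad ℚ GHat Y) := by
      intro X Y
      ext f v
      simp only [Module.End.mul_apply, LieAlgebra.ad_apply, coeff_truncation]
      split_ifs with hv
      · rw [coeff_lie, coeff_lie]
        refine sum_congr rfl fun p hp => ?_
        have := NPlus.deg_lt_of_mem_splittings hp
        rw [coeff_truncation, if_pos (by omega)]
      · rfl
    intro X Y
    rw [LieRing.of_associative_ring_bracket, key, key, ← mul_sub, LieHom.map_lie,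
      LieRing.of_associative_ring_bracket]

theorem coeff_adTrunc (l : ℕ) (X f : GHat) (v : NPlus) :
    (adTrunc l X f).coeff v = if v.deg ≤ l then ⁅X, f⁆.coeff v else 0 := rfl

theorem adTrunc_congr {l : ℕ} {X Y : GHat} (h : ∀ v : NPlus, v.deg < l → X.coeff v = Y.coeff v) :
    adTrunc l X = adTrunc l Y := by
  ext f v
  rw [coeff_adTrunc, coeff_adTrunc]
  split_ifs with hv
  · rw [coeff_lie, coeff_lie]
    refine sum_congr rfl fun p hp => ?_
    have := NPlus.deg_lt_of_mem_splittings hp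
    rw [h p.1 (by omega)]
  · rfl

theorem form_e1 (v : NPlus) : v.form ⟨1, 0, by decide⟩ = v.snd := by simp [NPlus.form]
theorem form_e2 (v : NPlus) : v.form ⟨0, 1, by decide⟩ = -v.fst := by simp [NPlus.form]

/-- The truncated adjoint representation detects all components of degree less than `l`. -/
theorem coeff_eq_of_adTrunc_eq {l : ℕ} {X Y : GHat} (h : adTrunc (l + 1) X = adTrunc (l + 1) Y)
    {v : NPlus} (hv : v.deg ≤ l) : X.coeff v = Y.coeff v := by
  have key : ∀ w : NPlus, w.deg = 1 → v.form w * X.coeff v = v.form w * Y.coeff v := by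
    intro w hw
    have h1 := congrArg (fun P : Module.End ℚ GHat => (P (single w)).coeff (v + w)) h
    simp only [coeff_adTrunc] at h1
    rwa [if_pos (by rw [NPlus.deg_add]; omega), if_pos (by rw [NPlus.deg_add]; omega),
      coeff_lie_single_add, coeff_lie_single_add] at h1
  have h1 := key ⟨1, 0, by decide⟩ rfl
  have h2 := key ⟨0, 1, by decide⟩ rfl
  rw [form_e1] at h1
  rw [form_e2] at h2
  have hpos := v.pos
  rcases Nat.eq_zero_or_pos v.snd with h0 | h0
  · have : (-(v.fst : ℚ)) ≠ 0 := by
      rw [neg_ne_zero, Nat.cast_ne_zero]; omega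
    exact mul_left_cancel₀ this h2
  · have : (v.snd : ℚ) ≠ 0 := by
      rw [Nat.cast_ne_zero]; omega
    exact mul_left_cancel₀ this h1

/-- The operators that raise degrees by at least `k` and have values in degrees at most `l`. -/
def raising (l k : ℕ) : Submodule ℚ (Module.End ℚ GHat) where
  carrier := {P | (∀ (i : ℕ) (f : GHat), (∀ v : NPlus, v.deg < i → f.coeff v = 0) →
      ∀ v : NPlus, v.deg < i + k → (P f).coeff v = 0) ∧
    ∀ (f : GHat) (v : NPlus), l < v.deg → (P f).coeff v = 0}
  add_mem' := fun {P Q} hP hQ =>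
    ⟨fun i f hf v hv => by
      rw [LinearMap.add_apply, coeff_add, hP.1 i f hf v hv, hQ.1 i f hf v hv, add_zero],
     fun f v hv => by rw [LinearMap.add_apply, coeff_add, hP.2 f v hv, hQ.2 f v hv, add_zero]⟩
  zero_mem' := ⟨fun _ _ _ _ _ => rfl, fun _ _ _ => rfl⟩
  smul_mem' := fun c P hP =>
    ⟨fun i f hf v hv => by rw [LinearMap.smul_apply, coeff_smul, hP.1 i f hf v hv, mul_zero],
     fun f v hv => by rw [LinearMap.smul_apply, coeff_smul, hP.2 f v hv, mul_zero]⟩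

theorem isNilFiltration_raising (l : ℕ) : IsNilFiltration (raising l) l where
  mul_mem := by
    intro i j P Q hP hQ
    refine ⟨fun n f hf v hv => ?_, fun f v hv => hP.2 _ v hv⟩
    exact hP.1 (n + j) (Q f) (hQ.1 n f hf) v (by omega)
  anti := by
    intro i j hij P hP
    exact ⟨fun n f hf v hv => hP.1 n f hf v (by omega), hP.2⟩
  eq_zero := by
    intro P hP
    ext f v
    by_cases hv : l < v.deg
    · exact hP.2 f v hv
    · exact hP.1 1 f (fun v hv => absurd v.deg_pos (by omega)) v (by omega)

theorem adTrunc_mem_raising {l k : ℕ} {X : GHat} (hX : ∀ v : NPlus, v.deg < k → X.coeff v = 0) :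
    adTrunc l X ∈ raising l k := by
  refine ⟨fun i f hf v hv => ?_, fun f v hv => ?_⟩
  · rw [coeff_adTrunc]
    split_ifs
    · rw [coeff_lie]
      refine sum_eq_zero fun p hp => ?_
      have h1 := NPlus.deg_add p.1 p.2
      rw [NPlus.mem_splittings.mp hp] at h1
      by_cases h2 : p.1.deg < k
      · rw [hX _ h2, mul_zero, zero_mul]
      · rw [hf p.2 (by omega), mul_zero]
    · rfl
  · rw [coeff_adTrunc, if_neg (by omega)]

theorem adTrunc_mem_raising_one (l : ℕ) (X : GHat) : adTrunc l X ∈ raising l 1 :=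
  adTrunc_mem_raising fun v hv => absurd v.deg_pos (by omega)

theorem isNilpotent_adTrunc (l : ℕ) (X : GHat) : IsNilpotent (adTrunc l X) :=
  (isNilFiltration_raising l).isNilpotent (adTrunc_mem_raising_one l X)

end GHat

namespace StructureGroup

open GHat

/-- The truncated adjoint representation `exp X ↦ exp (ad X)` of the structure group. -/
noncomputable def rep (l : ℕ) (g : StructureGroup) : Module.End ℚ GHat :=
  IsNilpotent.exp (adTrunc l g.log)

attribute [local instance] LieRing.ofAssociativeRing

theorem rep_mul (l : ℕ) (g h : StructureGroup) : rep l (g * h) = rep l g * rep l h := by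
  have h1 : adTrunc l (g * h).log = adTrunc l (bchTrunc (2 * (l + 1)) g.log h.log) :=
    adTrunc_congr fun v hv => by
      rw [coeff_bchTrunc_eq (l := 2 * (l + 1)) (by omega)]
      rfl
  rw [rep, h1, map_bchTrunc, (isNilFiltration_raising l).exp_bchTrunc
    (adTrunc_mem_raising_one l _) (adTrunc_mem_raising_one l _) le_rfl]
  rfl

theorem rep_one (l : ℕ) : rep l 1 = 1 := by
  rw [rep, show (1 : StructureGroup).log = 0 from rfl, map_zero, IsNilpotent.exp_zero]

theorem modEq_of_rep_eq {l : ℕ} {g h : StructureGroup} (hgh : rep (l + 1) g = rep (l + 1) h) :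
    ModEq l g h := fun _ hv =>
  coeff_eq_of_adTrunc_eq ((isNilFiltration_raising _).exp_injOn (adTrunc_mem_raising_one _ _)
    (adTrunc_mem_raising_one _ _) hgh) hv

theorem eq_of_rep_eq {g h : StructureGroup} (hgh : ∀ l, rep l g = rep l h) : g = h := by
  ext v
  exact modEq_of_rep_eq (hgh (v.deg + 1)) v le_rfl

instance : Inv StructureGroup := ⟨fun g => exp (-g.log)⟩

instance : Group StructureGroup where
  mul_assoc g h k := eq_of_rep_eq fun l => by simp only [rep_mul, mul_assoc]
  one_mul g := eq_of_rep_eq fun l => by rw [rep_mul, rep_one, one_mul]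
  mul_one g := eq_of_rep_eq fun l => by rw [rep_mul, rep_one, mul_one]
  inv_mul_cancel g := eq_of_rep_eq fun l => by
    rw [rep_mul, rep_one, rep, show (g⁻¹).log = -g.log from rfl, map_neg]
    exact IsNilpotent.exp_neg_mul_exp_self (isNilpotent_adTrunc l _)

/-- The truncated adjoint representation as a monoid homomorphism. -/
noncomputable def repHom (l : ℕ) : StructureGroup →* Module.End ℚ GHat where
  toFun := rep l
  map_one' := rep_one l
  map_mul' := rep_mul l

theorem repHom_apply (l : ℕ) (g : StructureGroup) :
    repHom l g = IsNilpotent.exp (adTrunc l g.log) := rfl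

theorem modEq_iff_repHom_eq {l : ℕ} {g h : StructureGroup} :
    ModEq l g h ↔ repHom (l + 1) g = repHom (l + 1) h := by
  refine ⟨fun hgh => ?_, modEq_of_rep_eq⟩
  rw [repHom_apply, repHom_apply, adTrunc_congr]
  exact fun v hv => hgh v (by omega)

theorem ModEq.mul {l : ℕ} {g g' h h' : StructureGroup} (hg : ModEq l g g') (hh : ModEq l h h') :
    ModEq l (g * h) (g' * h') := by
  rw [modEq_iff_repHom_eq] at *
  rw [map_mul, map_mul, hg, hh]

theorem ModEq.mono {k l : ℕ} (hkl : k ≤ l) {g h : StructureGroup} (hg : ModEq l g h) :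
    ModEq k g h := fun v hv => hg v (hv.trans hkl)

end StructureGroup

/-! ### Rational powers and endomorphisms of the structure group -/

namespace StructureGroup

open GHat

attribute [local instance] LieRing.ofAssociativeRing

theorem log_mul_coeff (g h : StructureGroup) (v : NPlus) :
    (g * h).log.coeff v = (bchTrunc v.deg g.log h.log).coeff v := rfl

/-- The endomorphism `exp X ↦ exp (θ X)` of the structure group induced by an endomorphism `θ` of
the completed Lie algebra which does not lower degrees. -/
def mapLie (θ : GHat →ₗ⁅ℚ⁆ GHat)
    (hθ : ∀ (X Y : GHat) (v : NPlus), (∀ w : NPlus, w.deg ≤ v.deg → X.coeff w = Y.coeff w) →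
      (θ X).coeff v = (θ Y).coeff v) : StructureGroup →* StructureGroup where
  toFun g := exp (θ g.log)
  map_one' := by
    show exp (θ 0) = exp 0
    rw [map_zero]
  map_mul' g h := by
    ext v
    rw [log_mul_coeff]
    show (θ (g * h).log).coeff v = (bchTrunc v.deg (θ g.log) (θ h.log)).coeff v
    rw [← map_bchTrunc]
    refine hθ _ _ _ fun w hw => ?_
    rw [log_mul_coeff, coeff_bchTrunc_eq hw]

theorem qpow_log (g : StructureGroup) (c : ℚ) : (g.qpow c).log = c • g.log := rfl

theorem mapLie_qpow (θ : GHat →ₗ⁅ℚ⁆ GHat) (hθ) (g : StructureGroup) (c : ℚ) :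
    mapLie θ hθ (g.qpow c) = (mapLie θ hθ g).qpow c := by
  show exp (θ (c • g.log)) = exp (c • θ g.log)
  rw [map_smul]

/-- If the logarithms of `g` and `h` commute, multiplication in the group adds logarithms. -/
theorem mul_eq_exp_add {g h : StructureGroup} (hgh : ⁅g.log, h.log⁆ = 0) :
    g * h = exp (g.log + h.log) := by
  refine eq_of_rep_eq fun l => ?_
  rw [rep_mul, rep, rep, rep, map_add, IsNilpotent.exp_add_of_commute _
    (isNilpotent_adTrunc l _) (isNilpotent_adTrunc l _)]
  rw [commute_iff_lie_eq, ← LieHom.map_lie, hgh, map_zero]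

theorem mul_comm_of_lie_eq_zero {g h : StructureGroup} (hgh : ⁅g.log, h.log⁆ = 0) :
    g * h = h * g := by
  rw [mul_eq_exp_add hgh, mul_eq_exp_add (by rw [← lie_skew, hgh, neg_zero]), add_comm]

theorem qpow_add (g : StructureGroup) (c d : ℚ) : g.qpow (c + d) = g.qpow c * g.qpow d := by
  rw [mul_eq_exp_add (by rw [qpow_log, qpow_log, lie_smul, smul_lie, lie_self, smul_zero,
    smul_zero]), qpow_log, qpow_log, ← add_smul]
  rfl

theorem qpow_zero (g : StructureGroup) : g.qpow 0 = 1 := by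
  show exp ((0 : ℚ) • g.log) = exp 0
  rw [zero_smul]

theorem qpow_one (g : StructureGroup) : g.qpow 1 = g := by
  show exp ((1 : ℚ) • g.log) = g
  rw [one_smul]

theorem qpow_qpow (g : StructureGroup) (c d : ℚ) : (g.qpow c).qpow d = g.qpow (d * c) := by
  show exp (d • c • g.log) = exp ((d * c) • g.log)
  rw [mul_smul]

theorem one_qpow (c : ℚ) : (1 : StructureGroup).qpow c = 1 := by
  show exp (c • (0 : GHat)) = exp 0
  rw [smul_zero]

theorem qpow_neg (g : StructureGroup) (c : ℚ) : g.qpow (-c) = (g.qpow c)⁻¹ := by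
  rw [eq_inv_iff_mul_eq_one, ← qpow_add, neg_add_cancel, qpow_zero]

/-- The coefficients of `log Ψ[n]`; the number of terms of the sum does not matter. -/
theorem coeff_log_dilog (n v : NPlus) {L : ℕ} (hL : v.deg ≤ L) :
    (dilog n).log.coeff v = ∑ j ∈ Icc 1 L,
      if v.fst = j * n.fst ∧ v.snd = j * n.snd then (-1 : ℚ) ^ (j + 1) / (j : ℚ) ^ 2 else 0 := by
  refine sum_subset (Icc_subset_Icc le_rfl hL) ?_
  intro j hj hj'
  rw [if_neg]
  rintro ⟨h1, h2⟩
  have h3 : v.deg = j * n.deg := by rw [NPlus.deg, NPlus.deg, h1, h2, Nat.mul_add]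
  have h4 := Nat.le_mul_of_pos_right j n.deg_pos
  simp at hj hj'
  omega

end StructureGroup

namespace NPlus

/-- The multiple `j v` for `j ≥ 1`. -/
def mulPos (j : ℕ) (hj : 0 < j) (v : NPlus) : NPlus :=
  ⟨j * v.fst, j * v.snd, by rw [← Nat.mul_add]; exact Nat.mul_pos hj v.pos⟩

theorem eq_mulPos {j : ℕ} (hj : 0 < j) {v w : NPlus} :
    w = mulPos j hj v ↔ w.fst = j * v.fst ∧ w.snd = j * v.snd := by
  rw [NPlus.ext_iff]; rfl

/-- The linear combination `v₁ n + v₂ n'`. -/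
def lin (n n' v : NPlus) : NPlus :=
  ⟨v.fst * n.fst + v.snd * n'.fst, v.fst * n.snd + v.snd * n'.snd, by
    have hn := n.pos
    have hn' := n'.pos
    have hv := v.pos
    have h1 : v.fst * n.fst + v.snd * n'.fst + (v.fst * n.snd + v.snd * n'.snd) =
        v.fst * (n.fst + n.snd) + v.snd * (n'.fst + n'.snd) := by ring
    have h2 := Nat.le_mul_of_pos_right v.fst hn
    have h3 := Nat.le_mul_of_pos_right v.snd hn'
    omega⟩

theorem deg_lin (n n' v : NPlus) : (lin n n' v).deg = v.fst * n.deg + v.snd * n'.deg := by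
  simp only [lin, deg]; ring

theorem deg_le_deg_lin (n n' v : NPlus) : v.deg ≤ (lin n n' v).deg := by
  rw [deg_lin]
  have h2 := Nat.le_mul_of_pos_right v.fst n.deg_pos
  have h3 := Nat.le_mul_of_pos_right v.snd n'.deg_pos
  unfold deg at *
  omega

theorem lin_add (n n' v w : NPlus) : lin n n' (v + w) = lin n n' v + lin n n' w := by
  ext <;> simp only [lin, add_fst, add_snd] <;> ring

theorem form_lin (n n' v w : NPlus) :
    (lin n n' v).form (lin n n' w) = n'.form n * v.form w := by
  simp only [form, lin]; push_cast; ring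

theorem lin_cancel {n n' : NPlus} (hc : n'.form n ≠ 0) {a b a' b' : ℕ}
    (h1 : a * n.fst + b * n'.fst = a' * n.fst + b' * n'.fst)
    (h2 : a * n.snd + b * n'.snd = a' * n.snd + b' * n'.snd) : a = a' ∧ b = b' := by
  have h1' : (a : ℚ) * n.fst + b * n'.fst = a' * n.fst + b' * n'.fst := by exact_mod_cast h1
  have h2' : (a : ℚ) * n.snd + b * n'.snd = a' * n.snd + b' * n'.snd := by exact_mod_cast h2
  unfold form at hc
  have e1 : ((a : ℚ) - a') * (n'.snd * n.fst - n'.fst * n.snd) = 0 := by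
    linear_combination (n'.snd : ℚ) * h1' - n'.fst * h2'
  have e2 : ((b : ℚ) - b') * (n'.snd * n.fst - n'.fst * n.snd) = 0 := by
    linear_combination (n.fst : ℚ) * h2' - n.snd * h1'
  have e3 := (mul_eq_zero.mp e1).resolve_right hc
  have e4 := (mul_eq_zero.mp e2).resolve_right hc
  rw [sub_eq_zero] at e3 e4
  exact ⟨by exact_mod_cast e3, by exact_mod_cast e4⟩

theorem lin_injective {n n' : NPlus} (hc : n'.form n ≠ 0) : Function.Injective (lin n n') := by
  intro v w h
  have h1 := congrArg fst h
  have h2 := congrArg snd h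
  obtain ⟨h3, h4⟩ := lin_cancel hc h1 h2
  exact NPlus.ext h3 h4

end NPlus

namespace GHat

/-- The projection of the Lie algebra onto the face of `N⁺` on which `p a + q b` vanishes. -/
def facePart (p q : ℕ) : GHat →ₗ⁅ℚ⁆ GHat where
  toFun X := ⟨fun v => if p * v.fst + q * v.snd = 0 then X.coeff v else 0⟩
  map_add' X Y := by ext v; simp only [coeff_add]; split_ifs <;> simp
  map_smul' c X := by ext v; simp
  map_lie' := by
    intro X Y
    ext v
    rw [coeff_lie]
    show (if p * v.fst + q * v.snd = 0 then ⁅X, Y⁆.coeff v else 0) =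
      ∑ s ∈ v.splittings, s.1.form s.2 *
        (if p * s.1.fst + q * s.1.snd = 0 then X.coeff s.1 else 0) *
        (if p * s.2.fst + q * s.2.snd = 0 then Y.coeff s.2 else 0)
    have hadd : ∀ s ∈ v.splittings, p * v.fst + q * v.snd =
        p * s.1.fst + q * s.1.snd + (p * s.2.fst + q * s.2.snd) := by
      intro s hs
      rw [← NPlus.mem_splittings.mp hs, NPlus.add_fst, NPlus.add_snd]
      ring
    split_ifs with hv
    · rw [coeff_lie]
      refine sum_congr rfl fun s hs => ?_
      have h1 := hadd s hs
      rw [if_pos (by omega), if_pos (by omega)]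
    · symm
      refine sum_eq_zero fun s hs => ?_
      have h1 := hadd s hs
      by_cases h2 : p * s.1.fst + q * s.1.snd = 0
      · rw [if_neg (by omega : ¬ p * s.2.fst + q * s.2.snd = 0), mul_zero]
      · rw [if_neg h2, mul_zero, zero_mul]

theorem coeff_facePart (p q : ℕ) (X : GHat) (v : NPlus) :
    (facePart p q X).coeff v = if p * v.fst + q * v.snd = 0 then X.coeff v else 0 := rfl

/-- The value at `X` of the change of lattice `X_v ↦ c⁻¹ X_{v₁ n + v₂ n'}` with `c = {n', n}`. -/
def latticeFun (n n' : NPlus) (X : GHat) : GHat :=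
  ⟨fun w => (n'.form n)⁻¹ * ∑ v ∈ NPlus.upTo w.deg, if NPlus.lin n n' v = w then X.coeff v else 0⟩

theorem coeff_latticeFun_lin {n n' : NPlus} (hc : n'.form n ≠ 0) (X : GHat) (v : NPlus) :
    (latticeFun n n' X).coeff (NPlus.lin n n' v) = (n'.form n)⁻¹ * X.coeff v := by
  simp only [latticeFun]
  rw [sum_eq_single v]
  · simp
  · intro w _ hw
    rw [if_neg fun h => hw (NPlus.lin_injective hc h)]
  · intro h
    exact absurd (NPlus.mem_upTo.mpr (NPlus.deg_le_deg_lin n n' v)) h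

theorem coeff_latticeFun_of_ne {n n' : NPlus} (X : GHat) {w : NPlus}
    (hw : ∀ v, NPlus.lin n n' v ≠ w) : (latticeFun n n' X).coeff w = 0 := by
  simp only [latticeFun]
  rw [sum_eq_zero, mul_zero]
  intro v _
  rw [if_neg (hw v)]

/-- The change of lattice `X_v ↦ c⁻¹ X_{v₁ n + v₂ n'}`, where `c = {n', n} ≠ 0`. It respects
brackets because `{v₁ n + v₂ n', w₁ n + w₂ n'} = c {v, w}`. -/
def lattice (n n' : NPlus) (hc : n'.form n ≠ 0) : GHat →ₗ⁅ℚ⁆ GHat where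
  toFun := latticeFun n n'
  map_add' X Y := by
    ext w
    simp only [latticeFun, coeff_add]
    rw [← mul_add, ← sum_add_distrib]
    congr 1
    refine sum_congr rfl fun v _ => ?_
    split_ifs <;> simp
  map_smul' r X := by
    ext w
    simp only [latticeFun, coeff_smul, RingHom.id_apply]
    have h : ∀ v : NPlus, (if NPlus.lin n n' v = w then r * X.coeff v else 0) =
        r * if NPlus.lin n n' v = w then X.coeff v else 0 := by
      intro v
      split_ifs <;> simp
    simp only [h, ← mul_sum]
    ring
  map_lie' := by
    intro X Y
    ext w
    show (latticeFun n n' ⁅X, Y⁆).coeff w = ⁅latticeFun n n' X, latticeFun n n' Y⁆.coeff w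
    rw [coeff_lie]
    by_cases hw : ∃ v, NPlus.lin n n' v = w
    · obtain ⟨v, rfl⟩ := hw
      rw [coeff_latticeFun_lin hc, coeff_lie, mul_sum]
      refine sum_of_injOn (fun p => (NPlus.lin n n' p.1, NPlus.lin n n' p.2)) ?_ ?_ ?_ ?_
      · intro p _ q _ hpq
        simp only [Prod.mk.injEq] at hpq
        exact Prod.ext (NPlus.lin_injective hc hpq.1) (NPlus.lin_injective hc hpq.2)
      · intro p hp
        have hp' := NPlus.mem_splittings.mp (mem_coe.mp hp)
        rw [mem_coe, NPlus.mem_splittings, ← NPlus.lin_add, hp']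
      · intro q hq hq'
        by_cases h1 : ∃ a, NPlus.lin n n' a = q.1
        · by_cases h2 : ∃ b, NPlus.lin n n' b = q.2
          · obtain ⟨a, ha⟩ := h1
            obtain ⟨b, hb⟩ := h2
            exfalso
            apply hq'
            rw [NPlus.mem_splittings, ← ha, ← hb, ← NPlus.lin_add] at hq
            exact ⟨(a, b), mem_coe.mpr (NPlus.mem_splittings.mpr (NPlus.lin_injective hc hq)),
              Prod.ext ha hb⟩
          · rw [coeff_latticeFun_of_ne Y fun b hb => h2 ⟨b, hb⟩, mul_zero]
        · rw [coeff_latticeFun_of_ne X fun a ha => h1 ⟨a, ha⟩, mul_zero, zero_mul]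
      · intro p _
        rw [coeff_latticeFun_lin hc, coeff_latticeFun_lin hc, NPlus.form_lin]
        field_simp
    · rw [coeff_latticeFun_of_ne _ fun v hv => hw ⟨v, hv⟩]
      symm
      refine sum_eq_zero fun q hq => ?_
      by_cases h1 : ∃ a, NPlus.lin n n' a = q.1
      · by_cases h2 : ∃ b, NPlus.lin n n' b = q.2
        · obtain ⟨a, ha⟩ := h1
          obtain ⟨b, hb⟩ := h2
          rw [NPlus.mem_splittings, ← ha, ← hb, ← NPlus.lin_add] at hq
          exact absurd ⟨_, hq⟩ hw
        · rw [coeff_latticeFun_of_ne Y fun b hb => h2 ⟨b, hb⟩, mul_zero]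
      · rw [coeff_latticeFun_of_ne X fun a ha => h1 ⟨a, ha⟩, mul_zero, zero_mul]

end GHat

namespace StructureGroup

open GHat

/-- The projection of the group onto the subgroup of the face of `N⁺` on which `p a + q b`
vanishes. -/
def mapFace (p q : ℕ) : StructureGroup →* StructureGroup :=
  mapLie (facePart p q) fun X Y v h => by
    rw [coeff_facePart, coeff_facePart, h v le_rfl]

/-- The change of lattice on the group. -/
def mapLattice (n n' : NPlus) (hc : n'.form n ≠ 0) : StructureGroup →* StructureGroup :=
  mapLie (lattice n n' hc) fun X Y v h => by
    show (latticeFun n n' X).coeff v = (latticeFun n n' Y).coeff v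
    simp only [latticeFun]
    congr 1
    refine sum_congr rfl fun w hw => ?_
    rw [h w (NPlus.mem_upTo.mp hw)]

theorem log_mapFace (p q : ℕ) (g : StructureGroup) :
    (mapFace p q g).log = facePart p q g.log := rfl

theorem mapFace_qpow (p q : ℕ) (g : StructureGroup) (c : ℚ) :
    mapFace p q (g.qpow c) = (mapFace p q g).qpow c :=
  mapLie_qpow _ _ _ _

theorem mapLattice_qpow {n n' : NPlus} (hc : n'.form n ≠ 0) (g : StructureGroup) (c : ℚ) :
    mapLattice n n' hc (g.qpow c) = (mapLattice n n' hc g).qpow c :=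
  mapLie_qpow _ _ _ _

theorem ModEq.mapFace {l : ℕ} {g h : StructureGroup} (hgh : ModEq l g h) (p q : ℕ) :
    ModEq l (mapFace p q g) (mapFace p q h) := by
  intro v hv
  rw [log_mapFace, log_mapFace, coeff_facePart, coeff_facePart, hgh v hv]

theorem ModEq.mapLattice {l : ℕ} {g h : StructureGroup} (hgh : ModEq l g h) {n n' : NPlus}
    (hc : n'.form n ≠ 0) : ModEq l (mapLattice n n' hc g) (mapLattice n n' hc h) := by
  intro v hv
  show (latticeFun n n' g.log).coeff v = (latticeFun n n' h.log).coeff v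
  simp only [latticeFun]
  congr 1
  refine sum_congr rfl fun w hw => ?_
  rw [hgh w ((NPlus.mem_upTo.mp hw).trans hv)]

theorem mapFace_dilog_of_eq_zero {p q : ℕ} {v : NPlus} (hv : p * v.fst + q * v.snd = 0) :
    mapFace p q (dilog v) = dilog v := by
  ext w
  rw [log_mapFace, coeff_facePart]
  split_ifs with hw
  · rfl
  · rw [coeff_log_dilog v w le_rfl]
    symm
    refine sum_eq_zero fun j _ => ?_
    rw [if_neg]
    rintro ⟨h1, h2⟩
    apply hw
    calc p * w.fst + q * w.snd = j * (p * v.fst + q * v.snd) := by rw [h1, h2]; ring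
      _ = 0 := by rw [hv, Nat.mul_zero]

theorem mapFace_dilog_of_ne_zero {p q : ℕ} {v : NPlus} (hv : p * v.fst + q * v.snd ≠ 0) :
    mapFace p q (dilog v) = 1 := by
  ext w
  rw [log_mapFace, coeff_facePart]
  show _ = (0 : ℚ)
  split_ifs with hw
  · rw [coeff_log_dilog v w le_rfl]
    refine sum_eq_zero fun j hj => ?_
    rw [if_neg]
    rintro ⟨h1, h2⟩
    have h3 : j * (p * v.fst + q * v.snd) = 0 := by
      rw [← hw, h1, h2]
      ring
    simp at hj
    rcases Nat.mul_eq_zero.mp h3 with h | h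
    · omega
    · exact hv h
  · rfl

/-- The change of lattice takes `Ψ[v]` to a power of `Ψ[v₁ n + v₂ n']`. -/
theorem mapLattice_dilog {n n' : NPlus} (hc : n'.form n ≠ 0) (v : NPlus) :
    mapLattice n n' hc (dilog v) = (dilog (NPlus.lin n n' v)).qpow (n'.form n)⁻¹ := by
  ext w
  rw [qpow_log, coeff_smul]
  show (latticeFun n n' (dilog v).log).coeff w = _
  by_cases hw : ∃ u, NPlus.lin n n' u = w
  · obtain ⟨u, rfl⟩ := hw
    rw [coeff_latticeFun_lin hc, coeff_log_dilog v u (NPlus.deg_le_deg_lin n n' u),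
      coeff_log_dilog _ _ le_rfl]
    congr 1
    refine sum_congr rfl fun j _ => ?_
    congr 1
    refine propext ⟨fun h => ?_, fun h => ?_⟩
    · simp only [NPlus.lin, h.1, h.2]
      constructor <;> ring
    · refine NPlus.lin_cancel hc ?_ ?_
      · have := h.1
        simp only [NPlus.lin] at this
        rw [this]; ring
      · have := h.2
        simp only [NPlus.lin] at this
        rw [this]; ring
  · rw [coeff_latticeFun_of_ne _ fun v hv => hw ⟨v, hv⟩, coeff_log_dilog _ _ le_rfl, sum_eq_zero,
      mul_zero]
    intro j hj
    rw [if_neg]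
    rintro ⟨h1, h2⟩
    apply hw
    have hj0 : 0 < j := by simp at hj; omega
    refine ⟨NPlus.mulPos j hj0 v, ?_⟩
    ext
    · rw [h1]; simp only [NPlus.lin, NPlus.mulPos]; ring
    · rw [h2]; simp only [NPlus.lin, NPlus.mulPos]; ring

/-- Elements `Ψ[v]` and `Ψ[w]` with parallel `v` and `w` commute. -/
theorem lie_log_dilog_eq_zero {v w : NPlus} (h : v.form w = 0) :
    ⁅(dilog v).log, (dilog w).log⁆ = 0 := by
  ext u
  rw [coeff_lie, coeff_zero]
  refine sum_eq_zero fun p _ => ?_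
  by_cases hp : p.1.form p.2 = 0
  · rw [hp, zero_mul, zero_mul]
  · by_cases h1 : (dilog v).log.coeff p.1 = 0
    · rw [h1, mul_zero, zero_mul]
    · by_cases h2 : (dilog w).log.coeff p.2 = 0
      · rw [h2, mul_zero]
      · exfalso
        rw [coeff_log_dilog _ _ le_rfl] at h1 h2
        obtain ⟨i, -, hi⟩ := exists_ne_zero_of_sum_ne_zero h1
        obtain ⟨j, -, hj⟩ := exists_ne_zero_of_sum_ne_zero h2
        rw [ne_eq, ite_eq_right_iff, Classical.not_imp] at hi hj
        apply hp
        obtain ⟨⟨a1, a2⟩, -⟩ := hi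
        obtain ⟨⟨b1, b2⟩, -⟩ := hj
        unfold NPlus.form at h ⊢
        rw [a1, a2, b1, b2]
        push_cast
        linear_combination (i : ℚ) * j * h

end StructureGroup

/-! ### The action of the dilogarithm elements and the pentagon relation -/

section NilpotentExp

variable {A : Type*} [Ring A] [Algebra ℚ A]

theorem exp_natCast_smul {a : A} (ha : IsNilpotent a) (n : ℕ) :
    IsNilpotent.exp ((n : ℚ) • a) = IsNilpotent.exp a ^ n := by
  induction n with
  | zero => simp
  | succ n ih =>
    rw [pow_succ, ← ih, ← IsNilpotent.exp_add_of_commute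
      ((Commute.refl a).smul_left _) (ha.smul _) ha]
    push_cast
    rw [add_smul, one_smul]

theorem exp_apply_of_apply_eq_zero {M : Type*} [AddCommGroup M] [Module ℚ M] {D : Module.End ℚ M}
    (hD : IsNilpotent D) {f : M} (hf : D f = 0) : IsNilpotent.exp D f = f := by
  obtain ⟨k, hk⟩ := hD
  have hk' : D ^ (k + 1) = 0 := by rw [pow_succ, hk, zero_mul]
  rw [IsNilpotent.exp_eq_sum hk', LinearMap.sum_apply, sum_range_succ', sum_eq_zero]
  · simp
  · intro i _
    rw [LinearMap.smul_apply, pow_succ, Module.End.mul_apply, hf, map_zero, smul_zero]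

/-- A vector fixed by `exp D` is killed by the nilpotent operator `D`. -/
theorem apply_eq_zero_of_exp_apply {M : Type*} [AddCommGroup M] [Module ℚ M]
    {D : Module.End ℚ M} (hD : IsNilpotent D) {f : M} (hf : IsNilpotent.exp D f = f) :
    D f = 0 := by
  have hD' := hD
  obtain ⟨k, hk⟩ := hD
  have hk' : D ^ (k + 2) = 0 := by rw [pow_succ, pow_succ, hk, zero_mul, zero_mul]
  set V : Module.End ℚ M := ∑ i ∈ range k, ((i + 2).factorial : ℚ)⁻¹ • D ^ i with hV
  have hcomm : Commute D V :=
    Commute.sum_right _ _ _ fun i _ => ((Commute.refl D).pow_right i).smul_right _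
  have h1 : IsNilpotent.exp D = 1 + (1 + D * V) * D := by
    rw [IsNilpotent.exp_eq_sum hk', sum_range_succ', sum_range_succ', hV, mul_sum, add_mul,
      sum_mul]
    simp only [pow_zero, Nat.factorial_zero, Nat.cast_one, inv_one, one_smul, zero_add, pow_one,
      Nat.factorial_one, one_mul]
    rw [add_comm, add_comm (∑ i ∈ range k, _)]
    congr 2
    refine sum_congr rfl fun i _ => ?_
    rw [mul_smul_comm, smul_mul_assoc, ← pow_succ', ← pow_succ]
  have hU : IsUnit (1 + D * V) := (hcomm.isNilpotent_mul_right hD').isUnit_one_add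
  obtain ⟨U, hU⟩ := hU
  rw [h1, LinearMap.add_apply, Module.End.one_apply, add_eq_left, Module.End.mul_apply,
    ← hU] at hf
  have h2 := congrArg (↑U⁻¹ : Module.End ℚ M) hf
  rwa [map_zero, ← Module.End.mul_apply, Units.inv_mul, Module.End.one_apply] at h2

end NilpotentExp

namespace GHat

/-- The shift `X_w ↦ X_{a + w}`, followed by the truncation at degree `l`. -/
def shift (l : ℕ) (a : NPlus) : Module.End ℚ GHat where
  toFun f := ⟨fun p => if p.deg ≤ l then
    ∑ q ∈ p.splittings, (if q.1 = a then f.coeff q.2 else 0) else 0⟩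
  map_add' f g := by
    ext p
    simp only [coeff_add]
    split_ifs
    · rw [← sum_add_distrib]
      exact sum_congr rfl fun q _ => by split_ifs <;> simp
    · simp
  map_smul' c f := by
    ext p
    simp only [coeff_smul, RingHom.id_apply]
    split_ifs
    · rw [mul_sum]
      exact sum_congr rfl fun q _ => by split_ifs <;> simp
    · simp

theorem coeff_shift (l : ℕ) (a : NPlus) (f : GHat) (p : NPlus) :
    (shift l a f).coeff p = if p.deg ≤ l then
      ∑ q ∈ p.splittings, (if q.1 = a then f.coeff q.2 else 0) else 0 := rfl

theorem coeff_shift_add (l : ℕ) (a w : NPlus) (f : GHat) :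
    (shift l a f).coeff (a + w) = if (a + w).deg ≤ l then f.coeff w else 0 := by
  rw [coeff_shift]
  congr 1
  rw [sum_eq_single (a, w)]
  · simp
  · rintro ⟨b, c⟩ hp hne
    rw [NPlus.mem_splittings] at hp
    rw [if_neg]
    rintro rfl
    exact hne (Prod.ext rfl (NPlus.add_left_cancel' hp))
  · intro h
    simp at h

theorem coeff_shift_of_ne (l : ℕ) {a p : NPlus} (f : GHat) (hp : ∀ w, a + w ≠ p) :
    (shift l a f).coeff p = 0 := by
  rw [coeff_shift]
  split_ifs
  · refine sum_eq_zero fun q hq => ?_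
    rw [if_neg]
    intro h
    rw [NPlus.mem_splittings, h] at hq
    exact hp _ hq
  · rfl

theorem shift_mul_shift (l : ℕ) (a b : NPlus) : shift l a * shift l b = shift l (a + b) := by
  ext f p
  rw [Module.End.mul_apply]
  by_cases hp : ∃ w, a + w = p
  · obtain ⟨w, rfl⟩ := hp
    rw [coeff_shift_add]
    by_cases hw : ∃ u, b + u = w
    · obtain ⟨u, rfl⟩ := hw
      rw [coeff_shift_add, ← NPlus.add_assoc', coeff_shift_add]
      have h1 := NPlus.deg_add a (b + u)
      rw [← NPlus.add_assoc'] at h1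
      split_ifs <;> first | rfl | omega
    · rw [coeff_shift_of_ne l f fun u hu => hw ⟨u, hu⟩, coeff_shift_of_ne, ite_self]
      intro u hu
      rw [NPlus.add_assoc'] at hu
      exact hw ⟨u, NPlus.add_left_cancel' hu⟩
  · rw [coeff_shift_of_ne l _ fun u hu => hp ⟨u, hu⟩, coeff_shift_of_ne]
    intro u hu
    rw [NPlus.add_assoc'] at hu
    exact hp ⟨_, hu⟩

theorem shift_pow (l : ℕ) (v : NPlus) (j : ℕ) (hj : 0 < j) :
    shift l v ^ j = shift l (NPlus.mulPos j hj v) := by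
  induction j with
  | zero => omega
  | succ j ih =>
    rcases Nat.eq_zero_or_pos j with rfl | h
    · simp only [zero_add, pow_one]
      congr 1
      ext <;> simp [NPlus.mulPos]
    · rw [pow_succ, ih h, shift_mul_shift]
      congr 1
      ext <;> simp [NPlus.mulPos, Nat.succ_mul]

theorem shift_mem_raising (l : ℕ) (a : NPlus) : shift l a ∈ raising l 1 := by
  refine ⟨fun i f hf v hv => ?_, fun f v hv => ?_⟩
  · rw [coeff_shift]
    split_ifs
    · refine sum_eq_zero fun q hq => ?_
      have := NPlus.deg_lt_of_mem_splittings hq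
      rw [hf q.2 (by omega), ite_self]
    · rfl
  · rw [coeff_shift, if_neg (by omega)]

theorem shift_pow_eq_zero (l : ℕ) (a : NPlus) : shift l a ^ (l + 1) = 0 :=
  (isNilFiltration_raising l).pow_eq_zero (shift_mem_raising l a)

theorem isNilpotent_logTrunc_shift (l : ℕ) (a : NPlus) : IsNilpotent (logTrunc l (shift l a)) := by
  refine (isNilFiltration_raising l).isNilpotent (Submodule.sum_mem _ fun k hk => ?_)
  obtain ⟨k, rfl⟩ := Nat.exists_eq_add_of_le' (mem_Icc.mp hk).1
  exact Submodule.smul_mem _ _ ((isNilFiltration_raising l).anti (by omega)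
    ((isNilFiltration_raising l).pow_mem (shift_mem_raising l a) k))

/-- The eigenvectors, with eigenvalue `κ`, of the operator `X_w ↦ {v, w} X_w`. -/
def weightSpace (v : NPlus) (κ : ℚ) : Submodule ℚ GHat where
  carrier := {f | ∀ w, v.form w * f.coeff w = κ * f.coeff w}
  add_mem' := fun hf hg w => by rw [coeff_add, mul_add, mul_add, hf w, hg w]
  zero_mem' := fun w => by simp
  smul_mem' := fun c f hf w => by rw [coeff_smul, mul_left_comm, hf w, mul_left_comm]

theorem single_mem_weightSpace (v w : NPlus) : single w ∈ weightSpace v (v.form w) := by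
  intro u
  rw [coeff_single]
  split_ifs with h
  · rw [h]
  · simp

theorem truncation_mem_weightSpace {v : NPlus} {κ : ℚ} {f : GHat} (l : ℕ)
    (hf : f ∈ weightSpace v κ) : truncation l f ∈ weightSpace v κ := by
  intro u
  rw [coeff_truncation]
  split_ifs
  · exact hf u
  · simp

theorem shift_mem_weightSpace {v : NPlus} {κ : ℚ} {f : GHat} (l : ℕ)
    (hf : f ∈ weightSpace v κ) : shift l v f ∈ weightSpace v κ := by
  intro p
  by_cases hp : ∃ w, v + w = p
  · obtain ⟨w, rfl⟩ := hp
    rw [coeff_shift_add]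
    split_ifs
    · rw [← hf w]
      congr 1
      simp only [NPlus.form, NPlus.add_fst, NPlus.add_snd]
      push_cast
      ring
    · simp
  · rw [coeff_shift_of_ne l f fun w hw => hp ⟨w, hw⟩, mul_zero, mul_zero]

theorem logTrunc_shift_mem_weightSpace {v : NPlus} {κ : ℚ} {f : GHat} (l : ℕ)
    (hf : f ∈ weightSpace v κ) : logTrunc l (shift l v) f ∈ weightSpace v κ := by
  rw [logTrunc, LinearMap.sum_apply]
  refine Submodule.sum_mem _ fun k _ => Submodule.smul_mem _ _ ?_
  clear * - hf
  induction k with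
  | zero => simpa using hf
  | succ k ih =>
    rw [pow_succ', Module.End.mul_apply]
    exact shift_mem_weightSpace l ih

/-- On vectors of weight `κ`, the operator `ad (log Ψ[v])` is `κ` times the logarithm of
`1 + (shift by v)`. -/
theorem adTrunc_log_dilog {v : NPlus} {κ : ℚ} {f : GHat} (l : ℕ) (hf : f ∈ weightSpace v κ) :
    adTrunc l (StructureGroup.dilog v).log f = κ • logTrunc l (shift l v) f := by
  ext p
  rw [coeff_adTrunc, coeff_smul, logTrunc, LinearMap.sum_apply, coeff_sum]
  by_cases hp : p.deg ≤ l
  · rw [if_pos hp, coeff_lie, mul_sum]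
    have h1 : ∀ q ∈ p.splittings, q.1.form q.2 * (StructureGroup.dilog v).log.coeff q.1 *
        f.coeff q.2 = ∑ j ∈ Icc 1 l, if q.1.fst = j * v.fst ∧ q.1.snd = j * v.snd then
          κ * ((-1 : ℚ) ^ (j + 1) / j * f.coeff q.2) else 0 := by
      intro q hq
      have hdeg := NPlus.deg_lt_of_mem_splittings hq
      rw [StructureGroup.coeff_log_dilog v q.1 (L := l) (by omega), mul_sum, sum_mul]
      refine sum_congr rfl fun j hj => ?_
      split_ifs with h
      · have h2 : q.1.form q.2 = j * v.form q.2 := by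
          simp only [NPlus.form, h.1, h.2]; push_cast; ring
        have hj0 : (j : ℚ) ≠ 0 := by
          simp at hj
          rw [Nat.cast_ne_zero]
          omega
        rw [h2]
        have h3 := hf q.2
        field_simp
        linear_combination h3
      · ring
    rw [sum_congr rfl h1, sum_comm]
    refine sum_congr rfl fun j hj => ?_
    have hj0 : 0 < j := by simp at hj; omega
    rw [LinearMap.smul_apply, coeff_smul, shift_pow l v j hj0, coeff_shift, if_pos hp, mul_sum,
      mul_sum]
    refine sum_congr rfl fun q _ => ?_
    simp only [NPlus.eq_mulPos]
    split_ifs <;> simp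
  · rw [if_neg hp, sum_eq_zero, mul_zero]
    intro j hj
    have hj0 : 0 < j := by simp at hj; omega
    rw [LinearMap.smul_apply, coeff_smul, shift_pow l v j hj0, coeff_shift, if_neg hp, mul_zero]

end GHat

namespace StructureGroup

open GHat

/-- On vectors of weight `κ`, the power `Ψ[v]^s` acts as `(1 + (shift by v))^{κ s}`. -/
theorem repHom_dilog_qpow {v : NPlus} {κ : ℚ} {f : GHat} (l : ℕ) (hf : f ∈ weightSpace v κ)
    (s : ℚ) : repHom l ((dilog v).qpow s) f =
      IsNilpotent.exp ((κ * s) • logTrunc l (shift l v)) f := by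
  have hn1 := isNilpotent_adTrunc l ((dilog v).qpow s).log
  have hn2 : IsNilpotent ((κ * s) • logTrunc l (shift l v)) :=
    (isNilpotent_logTrunc_shift l v).smul _
  have key : ∀ n, (adTrunc l ((dilog v).qpow s).log ^ n) f =
      (((κ * s) • logTrunc l (shift l v)) ^ n) f ∧
      (((κ * s) • logTrunc l (shift l v)) ^ n) f ∈ weightSpace v κ := by
    intro n
    induction n with
    | zero => exact ⟨rfl, hf⟩
    | succ n ih =>
      rw [pow_succ', pow_succ', Module.End.mul_apply, Module.End.mul_apply, ih.1]
      refine ⟨?_, Submodule.smul_mem _ _ (logTrunc_shift_mem_weightSpace l ih.2)⟩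
      rw [qpow_log, map_smul, LinearMap.smul_apply, adTrunc_log_dilog l ih.2, smul_smul,
        mul_comm s, LinearMap.smul_apply]
  obtain ⟨n1, hn1⟩ := hn1
  obtain ⟨n2, hn2⟩ := hn2
  rw [repHom_apply, IsNilpotent.exp_eq_sum (pow_eq_zero_of_le (le_max_left n1 n2) hn1),
    IsNilpotent.exp_eq_sum (pow_eq_zero_of_le (le_max_right n1 n2) hn2), LinearMap.sum_apply,
    LinearMap.sum_apply]
  refine sum_congr rfl fun n _ => ?_
  rw [LinearMap.smul_apply, LinearMap.smul_apply, (key n).1]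

theorem repHom_dilog_qpow_of_mul_eq_zero {v : NPlus} {κ s : ℚ} {f : GHat} (l : ℕ)
    (hf : f ∈ weightSpace v κ) (h : κ * s = 0) : repHom l ((dilog v).qpow s) f = f := by
  rw [repHom_dilog_qpow l hf, h, zero_smul, IsNilpotent.exp_zero, Module.End.one_apply]

theorem repHom_dilog_qpow_of_mul_eq_one {v : NPlus} {κ s : ℚ} {f : GHat} (l : ℕ)
    (hf : f ∈ weightSpace v κ) (h : κ * s = 1) :
    repHom l ((dilog v).qpow s) f = f + shift l v f := by
  rw [repHom_dilog_qpow l hf, h, one_smul, exp_logTrunc_of_nilpotent (shift_pow_eq_zero l v),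
    LinearMap.add_apply, Module.End.one_apply]

/-- Shifting a truncated monomial. Both sides vanish if `deg (v + w) > l`. -/
theorem shift_truncation_single (l : ℕ) (v w : NPlus) :
    shift l v (truncation l (single w)) = truncation l (single (v + w)) := by
  ext p
  by_cases hp : ∃ u, v + u = p
  · obtain ⟨u, rfl⟩ := hp
    rw [coeff_shift_add, coeff_truncation, coeff_truncation, coeff_single, coeff_single]
    have h1 := NPlus.deg_add v u
    by_cases huw : u = w
    · subst huw
      rw [if_pos rfl, if_pos rfl]
      split_ifs <;> first | rfl | omega
    · rw [if_neg huw, if_neg (fun h => huw (NPlus.add_left_cancel' h))]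
      simp
  · rw [coeff_shift_of_ne l _ fun u hu => hp ⟨u, hu⟩, coeff_truncation, coeff_single,
      if_neg (fun h : p = v + w => hp ⟨w, h.symm⟩), ite_self]

theorem repHom_truncation_single_of_eq_zero {v w : NPlus} {s : ℚ} (l : ℕ)
    (h : v.form w * s = 0) :
    repHom l ((dilog v).qpow s) (truncation l (single w)) = truncation l (single w) :=
  repHom_dilog_qpow_of_mul_eq_zero l
    (truncation_mem_weightSpace l (single_mem_weightSpace v w)) h

theorem repHom_truncation_single_of_eq_one {v w : NPlus} {s : ℚ} (l : ℕ)
    (h : v.form w * s = 1) :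
    repHom l ((dilog v).qpow s) (truncation l (single w)) =
      truncation l (single w) + truncation l (single (v + w)) := by
  rw [repHom_dilog_qpow_of_mul_eq_one l
    (truncation_mem_weightSpace l (single_mem_weightSpace v w)) h, shift_truncation_single]

/-- The pentagon relation. Both sides act in the same way on `X_{(1, 0)}`, so that the logarithm of
their quotient is a combination of the `X_{(k, 0)}`; and they have the same image on the face of
the `(k, 0)`. -/
theorem pentagon : dilog ⟨0, 1, by decide⟩ * dilog ⟨1, 0, by decide⟩ =
    dilog ⟨1, 0, by decide⟩ * (dilog ⟨1, 1, by decide⟩ * dilog ⟨0, 1, by decide⟩) := by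
  set x : NPlus := ⟨1, 0, by decide⟩ with hx
  set y : NPlus := ⟨0, 1, by decide⟩ with hy
  set z : NPlus := ⟨1, 1, by decide⟩ with hz
  rw [← inv_mul_eq_iff_eq_mul, ← inv_mul_eq_one]
  set k := ((dilog x)⁻¹ * (dilog y * dilog x))⁻¹ * (dilog z * dilog y) with hk
  have hfst : mapFace 0 1 k = 1 := by
    rw [hk]
    simp only [map_mul, map_inv]
    rw [mapFace_dilog_of_ne_zero (v := y) (by simp [hy]),
      mapFace_dilog_of_ne_zero (v := z) (by simp [hz])]
    group
  have hact : ∀ l, repHom l k (truncation l (single x)) = truncation l (single x) := by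
    intro l
    set e : NPlus → GHat := fun w => truncation l (single w) with he
    have hxz : (⟨2, 1, by decide⟩ : NPlus) = z + x := rfl
    have hxz' : (⟨2, 1, by decide⟩ : NPlus) = x + z := rfl
    have hyx : z = y + x := rfl
    have h1 : ∀ v w : NPlus, v.form w = 0 → repHom l (dilog v) (e w) = e w := by
      intro v w h
      have := repHom_truncation_single_of_eq_zero (v := v) (w := w) (s := 1) l (by rw [h, zero_mul])
      rwa [qpow_one] at this
    have h2 : ∀ v w : NPlus, v.form w = 1 → repHom l (dilog v) (e w) = e w + e (v + w) := by
      intro v w h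
      have := repHom_truncation_single_of_eq_one (v := v) (w := w) (s := 1) l (by rw [h, one_mul])
      rwa [qpow_one] at this
    have hB : repHom l (dilog z * dilog y) (e x) = e x + e (z + x) + e z := by
      rw [map_mul, Module.End.mul_apply, h2 y x (by simp [NPlus.form, hx, hy]), ← hyx, map_add,
        h2 z x (by simp [NPlus.form, hx, hz]), h1 z z (by simp [NPlus.form, hz])]
    have hA : repHom l ((dilog x)⁻¹ * (dilog y * dilog x)) (e x) = e x + e (z + x) + e z := by
      have hinv : (dilog x)⁻¹ = (dilog x).qpow (-1) := by rw [qpow_neg, qpow_one]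
      rw [map_mul, map_mul, Module.End.mul_apply, Module.End.mul_apply,
        h1 x x (by simp [NPlus.form, hx]), h2 y x (by simp [NPlus.form, hx, hy]), ← hyx, map_add,
        hinv, repHom_truncation_single_of_eq_zero l (by simp [NPlus.form, hx]),
        repHom_truncation_single_of_eq_one l (by simp [NPlus.form, hx, hz]), ← hxz', hxz]
      abel
    show repHom l k (e x) = e x
    rw [hk, map_mul, Module.End.mul_apply, hB, ← hA, ← Module.End.mul_apply, ← map_mul,
      inv_mul_cancel, map_one, Module.End.one_apply]
  show k = 1
  ext v
  show k.log.coeff v = 0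
  by_cases hv : v.snd = 0
  · have h1 := congrArg (fun g => g.log.coeff v) hfst
    simp only [log_mapFace, coeff_facePart, zero_mul, one_mul, zero_add, if_pos hv] at h1
    exact h1
  · have h1 := apply_eq_zero_of_exp_apply (isNilpotent_adTrunc (v.deg + 1) k.log)
      (hact (v.deg + 1))
    have h2 := congrArg (fun f => f.coeff (v + x)) h1
    have h3 : truncation (v.deg + 1) (single x) = single x := by
      ext w
      rw [coeff_truncation, coeff_single]
      by_cases h5 : w = x
      · rw [h5, if_pos (show x.deg ≤ v.deg + 1 by rw [show x.deg = 1 from rfl]; omega)]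
      · simp [h5]
    simp only [h3] at h2
    rw [coeff_adTrunc, if_pos (by rw [NPlus.deg_add]; rfl), coeff_lie_single_add, form_e1,
      coeff_zero] at h2
    exact (mul_eq_zero.mp h2).resolve_left (by exact_mod_cast hv)

end StructureGroup

/-! ### Integrality and ordered factorizations -/

namespace GHat

/-- The elements of `GHat` with integral coefficients. -/
def intVec : AddSubgroup GHat where
  carrier := {f | ∀ v, f.coeff v ∈ (Int.castAddHom ℚ).range}
  add_mem' := fun hf hg v => AddSubgroup.add_mem _ (hf v) (hg v)
  zero_mem' := fun _ => AddSubgroup.zero_mem _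
  neg_mem' := fun hf v => AddSubgroup.neg_mem _ (hf v)

/-- The operators that preserve integrality of the coefficients. -/
def intEnd : Subring (Module.End ℚ GHat) where
  carrier := {P | ∀ f ∈ intVec, P f ∈ intVec}
  mul_mem' := fun hP hQ f hf => hP _ (hQ f hf)
  one_mem' := fun _ hf => hf
  add_mem' := fun hP hQ f hf => AddSubgroup.add_mem _ (hP f hf) (hQ f hf)
  zero_mem' := fun _ _ => AddSubgroup.zero_mem _
  neg_mem' := fun hP f hf => AddSubgroup.neg_mem _ (hP f hf)

theorem single_mem_intVec (v : NPlus) : single v ∈ intVec := by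
  intro w
  rw [coeff_single]
  split_ifs
  · exact ⟨1, by simp⟩
  · exact ⟨0, by simp⟩

theorem intCast_smul_mem_intVec {c : ℚ} (hc : c ∈ (Int.castAddHom ℚ).range) {f : GHat}
    (hf : f ∈ intVec) : c • f ∈ intVec := by
  intro v
  obtain ⟨a, ha⟩ := hc
  obtain ⟨b, hb⟩ := hf v
  exact ⟨a * b, by rw [coeff_smul, ← ha, ← hb]; simp⟩

theorem shift_mem_intEnd (l : ℕ) (v : NPlus) : shift l v ∈ intEnd := by
  intro f hf p
  by_cases hp : ∃ w, v + w = p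
  · obtain ⟨w, rfl⟩ := hp
    rw [coeff_shift_add]
    split_ifs
    · exact hf w
    · exact AddSubgroup.zero_mem _
  · rw [coeff_shift_of_ne l f fun w hw => hp ⟨w, hw⟩]
    exact AddSubgroup.zero_mem _

/-- Integral powers of `1 + (shift by v)` preserve integrality. -/
theorem exp_intCast_smul_logTrunc_shift_mem_intEnd (l : ℕ) (v : NPlus) (z : ℤ) :
    IsNilpotent.exp ((z : ℚ) • logTrunc l (shift l v)) ∈ intEnd := by
  have hnil := isNilpotent_logTrunc_shift l v
  have h1 : IsNilpotent.exp (logTrunc l (shift l v)) = 1 + shift l v :=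
    exp_logTrunc_of_nilpotent (shift_pow_eq_zero l v)
  have h2 : IsNilpotent.exp (-logTrunc l (shift l v)) = ∑ i ∈ range (l + 1), (-shift l v) ^ i := by
    have h3 := mul_neg_geom_sum (-shift l v) (l + 1)
    rw [neg_pow (shift l v) (l + 1), shift_pow_eq_zero, mul_zero, sub_zero, sub_neg_eq_add,
      ← h1] at h3
    calc IsNilpotent.exp (-logTrunc l (shift l v))
        = IsNilpotent.exp (-logTrunc l (shift l v)) * (IsNilpotent.exp (logTrunc l (shift l v)) *
            ∑ i ∈ range (l + 1), (-shift l v) ^ i) := by rw [h3, mul_one]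
      _ = _ := by rw [← mul_assoc, IsNilpotent.exp_neg_mul_exp_self hnil, one_mul]
  obtain ⟨n, rfl | rfl⟩ := z.eq_nat_or_neg
  · rw [Int.cast_natCast, exp_natCast_smul hnil, h1]
    exact Subring.pow_mem _ (Subring.add_mem _ (Subring.one_mem _) (shift_mem_intEnd l v)) n
  · rw [Int.cast_neg, Int.cast_natCast, neg_smul, ← smul_neg, exp_natCast_smul hnil.neg, h2]
    exact Subring.pow_mem _ (Subring.sum_mem _ fun i _ =>
      Subring.pow_mem _ (Subring.neg_mem _ (shift_mem_intEnd l v)) i) n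

end GHat

namespace NPlus

/-- The content `gcd (a, b)` of a lattice point. -/
def content (v : NPlus) : ℕ := Nat.gcd v.fst v.snd

theorem content_pos (v : NPlus) : 0 < v.content := by
  have := v.pos
  rw [content, Nat.gcd_pos_iff]
  omega

theorem exists_form_eq_content_mul (v w : NPlus) : ∃ z : ℤ, v.form w = v.content * z := by
  obtain ⟨a, ha⟩ := Nat.gcd_dvd_left v.fst v.snd
  obtain ⟨b, hb⟩ := Nat.gcd_dvd_right v.fst v.snd
  refine ⟨b * w.fst - a * w.snd, ?_⟩
  have ha' : (v.fst : ℚ) = v.content * a := by exact_mod_cast ha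
  have hb' : (v.snd : ℚ) = v.content * b := by exact_mod_cast hb
  rw [form, ha', hb']
  push_cast
  ring

end NPlus

namespace StructureGroup

open GHat

/-- The group elements that act, together with their inverses, by operators preserving integral
coefficients. -/
noncomputable def intGroup : Subgroup StructureGroup where
  carrier := {g | ∀ l, repHom l g ∈ intEnd ∧ repHom l g⁻¹ ∈ intEnd}
  mul_mem' := fun hg hh l => by
    rw [mul_inv_rev, map_mul, map_mul]
    exact ⟨Subring.mul_mem _ (hg l).1 (hh l).1, Subring.mul_mem _ (hh l).2 (hg l).2⟩
  one_mem' := fun l => by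
    rw [inv_one, map_one]
    exact ⟨Subring.one_mem _, Subring.one_mem _⟩
  inv_mem' := fun hg l => by
    rw [inv_inv]
    exact ⟨(hg l).2, (hg l).1⟩

theorem repHom_apply_eq_self {l : ℕ} {f : GHat} (hf : ∀ v : NPlus, v.deg ≤ l → f.coeff v = 0)
    (g : StructureGroup) : repHom l g f = f := by
  rw [repHom_apply]
  refine exp_apply_of_apply_eq_zero (isNilpotent_adTrunc l _) ?_
  ext v
  rw [coeff_adTrunc]
  split_ifs
  · rw [coeff_lie]
    refine sum_eq_zero fun p hp => ?_
    have := NPlus.deg_lt_of_mem_splittings hp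
    rw [hf p.2 (by omega), mul_zero]
  · rfl

/-- On `X_w` the power `Ψ[v]^s` acts as `(1 + (shift by v))^{ {v, w} s}`, and `{v, w}` is a multiple
of `gcd(v)`. -/
theorem repHom_dilog_qpow_mem_intEnd (l : ℕ) (v : NPlus) {s : ℚ} {z : ℤ}
    (hz : (v.content : ℚ) * s = z) : repHom l ((dilog v).qpow s) ∈ intEnd := by
  intro f hf
  set f0 : GHat := ∑ w ∈ NPlus.upTo l, f.coeff w • single w with hf0
  have hf0i : f0 ∈ intVec := AddSubgroup.sum_mem _ fun w _ =>
    intCast_smul_mem_intVec (hf w) (single_mem_intVec w)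
  have htail : ∀ u : NPlus, u.deg ≤ l → (f - f0).coeff u = 0 := by
    intro u hu
    rw [coeff_sub, hf0, coeff_sum, sum_eq_single u]
    · simp
    · intro w _ hw
      simp [Ne.symm hw]
    · intro h
      exact absurd (NPlus.mem_upTo.mpr hu) h
  have h1 : repHom l ((dilog v).qpow s) f = repHom l ((dilog v).qpow s) f0 + (f - f0) := by
    rw [← repHom_apply_eq_self htail ((dilog v).qpow s), ← map_add, add_sub_cancel]
  rw [h1]
  refine AddSubgroup.add_mem _ ?_ (AddSubgroup.sub_mem _ hf hf0i)
  rw [hf0, map_sum]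
  refine AddSubgroup.sum_mem _ fun w _ => ?_
  rw [map_smul]
  refine intCast_smul_mem_intVec (hf w) ?_
  rw [repHom_dilog_qpow l (single_mem_weightSpace v w)]
  obtain ⟨y, hy⟩ := NPlus.exists_form_eq_content_mul v w
  have h2 : v.form w * s = ((y * z : ℤ) : ℚ) := by
    rw [hy]
    push_cast
    rw [← hz]
    ring
  rw [h2]
  exact exp_intCast_smul_logTrunc_shift_mem_intEnd l v _ _ (single_mem_intVec w)

/-- The powers `Ψ[v]^{z / gcd(v)}` with integral `z` act integrally. -/
theorem dilog_qpow_mem_intGroup {v : NPlus} {s : ℚ} {z : ℤ} (hz : (v.content : ℚ) * s = z) :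
    (dilog v).qpow s ∈ intGroup := by
  intro l
  refine ⟨repHom_dilog_qpow_mem_intEnd l v hz, ?_⟩
  rw [← qpow_neg]
  exact repHom_dilog_qpow_mem_intEnd l v (z := -z) (by push_cast; rw [← hz]; ring)

theorem ModEq.refl (l : ℕ) (g : StructureGroup) : ModEq l g g := fun _ _ => rfl

theorem ModEq.symm {l : ℕ} {g h : StructureGroup} (hgh : ModEq l g h) : ModEq l h g :=
  fun v hv => (hgh v hv).symm

theorem ModEq.trans {l : ℕ} {g h k : StructureGroup} (hgh : ModEq l g h) (hhk : ModEq l h k) :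
    ModEq l g k := fun v hv => (hgh v hv).trans (hhk v hv)

/-- An element without components of degree less than `k` is central modulo `G^{> k}`, and
multiplication by it adds logarithms. -/
theorem modEq_mul_of_high {k : ℕ} {z : StructureGroup}
    (hz : ∀ v : NPlus, v.deg < k → z.log.coeff v = 0) (g : StructureGroup) :
    ModEq k (g * z) (exp (g.log + z.log)) ∧ ModEq k (z * g) (exp (g.log + z.log)) := by
  have hJ := isNilFiltration_raising (k + 1)
  have hz' : adTrunc (k + 1) z.log ∈ raising (k + 1) k := adTrunc_mem_raising hz
  have h1 : adTrunc (k + 1) g.log * adTrunc (k + 1) z.log = 0 :=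
    hJ.eq_zero (hJ.anti (by omega) (hJ.mul_mem (adTrunc_mem_raising_one _ g.log) hz'))
  have h2 : adTrunc (k + 1) z.log * adTrunc (k + 1) g.log = 0 :=
    hJ.eq_zero (hJ.mul_mem hz' (adTrunc_mem_raising_one _ g.log))
  have hn := fun X => isNilpotent_adTrunc (k + 1) X
  constructor
  · rw [modEq_iff_repHom_eq, map_mul, repHom_apply, repHom_apply, repHom_apply, map_add,
      IsNilpotent.exp_add_of_commute (h1.trans h2.symm) (hn _) (hn _)]
  · rw [modEq_iff_repHom_eq, map_mul, repHom_apply, repHom_apply, repHom_apply, map_add,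
      add_comm (adTrunc (k + 1) g.log),
      IsNilpotent.exp_add_of_commute (h2.trans h1.symm) (hn _) (hn _)]

theorem coeff_log_dilog_of_deg_le {w v : NPlus} (h : v.deg ≤ w.deg) :
    (dilog w).log.coeff v = if v = w then 1 else 0 := by
  rw [coeff_log_dilog w v (L := v.deg) le_rfl, sum_eq_single 1]
  · simp [NPlus.ext_iff]
  · intro j hj hj1
    rw [if_neg]
    rintro ⟨h1, h2⟩
    have h3 : v.deg = j * w.deg := by rw [NPlus.deg, NPlus.deg, h1, h2, Nat.mul_add]
    have h4 := w.deg_pos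
    have h5 : 2 ≤ j := by simp at hj; omega
    have h6 := Nat.mul_le_mul_right w.deg h5
    omega
  · intro h1
    have := v.deg_pos
    simp at h1
    omega

/-- The product of the powers `Ψ[n]^{e n}` over a list. -/
noncomputable def dilogProd (L : List NPlus) (e : NPlus → ℚ) : StructureGroup :=
  (L.map fun n => (dilog n).qpow (e n)).prod

theorem dilogProd_cons (w : NPlus) (L : List NPlus) (e : NPlus → ℚ) :
    dilogProd (w :: L) e = (dilog w).qpow (e w) * dilogProd L e := by
  simp [dilogProd]

theorem dilogProd_congr {L : List NPlus} {e e' : NPlus → ℚ} (h : ∀ v ∈ L, e v = e' v) :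
    dilogProd L e = dilogProd L e' := by
  unfold dilogProd
  congr 1
  exact List.map_congr_left fun v hv => by rw [h v hv]

theorem dilog_qpow_modEq_one {k : ℕ} {w : NPlus} (hw : k < w.deg) (s : ℚ) :
    ModEq k ((dilog w).qpow s) 1 := by
  intro v hv
  rw [qpow_log, coeff_smul, coeff_log_dilog_of_deg_le (by omega), if_neg, mul_zero]
  · rfl
  · rintro rfl
    omega

/-- Factors of degree greater than `k` do not matter modulo `G^{> k}`. -/
theorem dilogProd_modEq_filter (k : ℕ) (L : List NPlus) (e : NPlus → ℚ) :
    ModEq k (dilogProd L e) (dilogProd (L.filter fun v => v.deg ≤ k) e) := by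
  induction L with
  | nil => exact ModEq.refl _ _
  | cons w L ih =>
    rw [dilogProd_cons, List.filter_cons]
    split_ifs with h
    · rw [dilogProd_cons]
      exact (ModEq.refl _ _).mul ih
    · have := (dilog_qpow_modEq_one (k := k) (w := w) (by simpa using h) (e w)).mul ih
      rwa [one_mul] at this

/-- The factor of a product of dilogarithm elements that is contributed by the factors of degree
`k`. -/
def topPart (k : ℕ) (L : List NPlus) (e : NPlus → ℚ) : StructureGroup :=
  exp ⟨fun v => if v.deg = k then L.count v * e v else 0⟩

theorem coeff_topPart (k : ℕ) (L : List NPlus) (e : NPlus → ℚ) (v : NPlus) :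
    (topPart k L e).log.coeff v = if v.deg = k then L.count v * e v else 0 := rfl

theorem coeff_topPart_of_lt (k : ℕ) (L : List NPlus) (e : NPlus → ℚ) (v : NPlus)
    (hv : v.deg < k) : (topPart k L e).log.coeff v = 0 := by
  rw [coeff_topPart, if_neg (by omega)]

/-- Modulo `G^{> k + 1}` the factors of degree `k + 1` of a product are central, and can be
collected at its end. -/
theorem dilogProd_modEq_mul_topPart (k : ℕ) (L : List NPlus) (e : NPlus → ℚ) :
    ModEq (k + 1) (dilogProd L e)
      (dilogProd (L.filter fun v => v.deg ≤ k) e * topPart (k + 1) L e) := by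
  induction L with
  | nil =>
    intro v _
    have : topPart (k + 1) [] e = 1 := by
      ext v
      rw [coeff_topPart]
      simp
      rfl
    rw [this, mul_one]
    rfl
  | cons w L ih =>
    rw [dilogProd_cons, List.filter_cons]
    split_ifs with h
    · rw [dilogProd_cons, mul_assoc]
      have h1 : topPart (k + 1) (w :: L) e = topPart (k + 1) L e := by
        ext v
        rw [coeff_topPart, coeff_topPart]
        split_ifs with hv
        · rw [List.count_cons_of_ne]
          rintro rfl
          simp at h
          omega
        · rfl
      rw [h1]
      exact (ModEq.refl _ _).mul ih
    · set Q := dilogProd (L.filter fun v => v.deg ≤ k) e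
      have h2 : k + 1 ≤ w.deg := by simpa using h
      have hw : ∀ v : NPlus, v.deg < k + 1 → ((dilog w).qpow (e w)).log.coeff v = 0 := by
        intro v hv
        rw [qpow_log, coeff_smul, coeff_log_dilog_of_deg_le (by omega), if_neg, mul_zero]
        rintro rfl
        omega
      refine ((ModEq.refl _ _).mul ih).trans ?_
      rw [← mul_assoc]
      refine (((modEq_mul_of_high hw Q).2.trans (modEq_mul_of_high hw Q).1.symm).mul
        (ModEq.refl _ _)).trans ?_
      rw [mul_assoc]
      refine (ModEq.refl _ _).mul ((modEq_mul_of_high hw _).2.trans ?_)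
      intro v hv
      show (topPart (k + 1) L e).log.coeff v + (e w) * (dilog w).log.coeff v =
        (topPart (k + 1) (w :: L) e).log.coeff v
      rw [coeff_topPart, coeff_topPart, coeff_log_dilog_of_deg_le (by omega), List.count_cons]
      by_cases hvw : v = w
      · subst hvw
        simp only [show v.deg = k + 1 by omega, if_true, beq_self_eq_true]
        push_cast
        ring
      · have : (w == v) = false := by simpa using fun h => hvw h.symm
        simp [hvw, this]

/-- Up to degree `k + 1`, the factors of degree at most `k` and those of degree `k + 1` contribute
separately to the logarithm of a product. -/
theorem coeff_log_dilogProd {k : ℕ} (L : List NPlus) (e : NPlus → ℚ) {v : NPlus}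
    (hv : v.deg ≤ k + 1) : (dilogProd L e).log.coeff v =
      (dilogProd (L.filter fun v => v.deg ≤ k) e).log.coeff v +
        if v.deg = k + 1 then L.count v * e v else 0 := by
  rw [dilogProd_modEq_mul_topPart k L e v hv,
    (modEq_mul_of_high (coeff_topPart_of_lt (k + 1) L e) _).1 v hv]
  rfl

/-- The exponents of a product of dilogarithm elements over a list without repetitions are
determined by the product. -/
theorem dilogProd_exponents_unique {l : ℕ} {L : List NPlus} (hL : L.Nodup) {e e' : NPlus → ℚ}
    (h : ModEq l (dilogProd L e) (dilogProd L e')) {v : NPlus} (hv : v ∈ L) (hvl : v.deg ≤ l) :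
    e v = e' v := by
  induction hd : v.deg using Nat.strong_induction_on generalizing v with
  | _ d ih =>
    obtain ⟨k, rfl⟩ := Nat.exists_eq_add_of_le' (show 1 ≤ d by rw [← hd]; exact v.deg_pos)
    have h1 := h v hvl
    rw [coeff_log_dilogProd L e hd.le, coeff_log_dilogProd L e' hd.le,
      dilogProd_congr (e' := e') (fun w hw => by
        rw [List.mem_filter] at hw
        have hwk : w.deg ≤ k := by simpa using hw.2
        exact ih w.deg (by omega) hw.1 (by omega) rfl), if_pos hd, if_pos hd,
      List.count_eq_one_of_mem hL hv] at h1
    simpa using h1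

theorem dilogProd_mem_intGroup {L : List NPlus} {e : NPlus → ℚ}
    (h : ∀ v ∈ L, ∃ z : ℤ, (v.content : ℚ) * e v = z) : dilogProd L e ∈ intGroup := by
  refine Subgroup.list_prod_mem _ fun g hg => ?_
  obtain ⟨v, hv, rfl⟩ := List.mem_map.mp hg
  obtain ⟨z, hz⟩ := h v hv
  exact dilog_qpow_mem_intGroup hz

/-- Integrality of exponents: if a product of powers of distinct dilogarithm elements acts
integrally, then the exponent of `Ψ[v]` lies in `gcd(v)⁻¹ ℤ`. -/
theorem exponent_integral {l : ℕ} {L : List NPlus} (hL : L.Nodup) {e : NPlus → ℚ}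
    {g : StructureGroup} (hg : g ∈ intGroup) (h : ModEq l g (dilogProd L e)) {v : NPlus}
    (hv : v ∈ L) (hvl : v.deg ≤ l) : ∃ z : ℤ, (v.content : ℚ) * e v = z := by
  induction hd : v.deg using Nat.strong_induction_on generalizing v with
  | _ d ih =>
    obtain ⟨k, rfl⟩ := Nat.exists_eq_add_of_le' (show 1 ≤ d by rw [← hd]; exact v.deg_pos)
    set Q := dilogProd (L.filter fun v => v.deg ≤ k) e with hQ
    have hQi : Q ∈ intGroup := dilogProd_mem_intGroup fun w hw => by
      rw [List.mem_filter] at hw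
      have hwk : w.deg ≤ k := by simpa using hw.2
      exact ih w.deg (by omega) hw.1 (by omega) rfl
    have h1 : ModEq (k + 1) (Q⁻¹ * g) (topPart (k + 1) L e) := by
      have h2 := (ModEq.refl _ Q⁻¹).mul ((h.mono (by omega)).trans
        (dilogProd_modEq_mul_topPart k L e))
      rwa [inv_mul_cancel_left] at h2
    have h3 := ((Subgroup.mul_mem _ (Subgroup.inv_mem _ hQi) hg) (k + 1 + 1)).1
    rw [modEq_iff_repHom_eq.mp h1, repHom_apply] at h3
    set D := adTrunc (k + 1 + 1) (topPart (k + 1) L e).log with hD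
    have hJ := isNilFiltration_raising (k + 1 + 1)
    have hDr : D ∈ raising (k + 1 + 1) (k + 1) :=
      adTrunc_mem_raising (coeff_topPart_of_lt _ L e)
    have hD2 : D ^ 2 = 0 := by
      rw [pow_two]
      exact hJ.eq_zero (hJ.mul_mem hDr (hJ.anti (by omega) hDr))
    have hexp : IsNilpotent.exp D = 1 + D := by
      rw [IsNilpotent.exp_eq_sum hD2]
      simp [sum_range_succ]
    rw [hexp] at h3
    have key : ∀ w : NPlus, w.deg = 1 → v.form w * e v ∈ (Int.castAddHom ℚ).range := by
      intro w hw
      have h4 := h3 (single w) (single_mem_intVec w) (v + w)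
      rw [LinearMap.add_apply, Module.End.one_apply, coeff_add, coeff_single,
        if_neg (fun hvw => by
          have := congrArg NPlus.deg hvw
          rw [NPlus.deg_add] at this
          omega), zero_add, hD, coeff_adTrunc, if_pos (by rw [NPlus.deg_add]; omega),
        coeff_lie_single_add, coeff_topPart, if_pos hd, List.count_eq_one_of_mem hL hv] at h4
      simpa using h4
    obtain ⟨a, ha⟩ := key ⟨1, 0, by decide⟩ rfl
    obtain ⟨b, hb⟩ := key ⟨0, 1, by decide⟩ rfl
    rw [form_e1] at ha
    rw [form_e2] at hb
    simp only [Int.coe_castAddHom] at ha hb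
    refine ⟨-b * Nat.gcdA v.fst v.snd + a * Nat.gcdB v.fst v.snd, ?_⟩
    have hgcd : (v.content : ℚ) = v.fst * Nat.gcdA v.fst v.snd + v.snd * Nat.gcdB v.fst v.snd := by
      exact_mod_cast Nat.gcd_eq_gcd_ab v.fst v.snd
    rw [hgcd]
    push_cast
    rw [ha, hb]
    ring

end StructureGroup

namespace NPlus

open Classical in
theorem mem_ordered {l : ℕ} {v : NPlus} : v ∈ ordered l ↔ v.deg ≤ l := by
  rw [ordered, Finset.mem_sort, mem_upTo]

open Classical in
theorem nodup_ordered (l : ℕ) : (ordered l).Nodup := Finset.sort_nodup _ _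

open Classical in
theorem pairwise_ordered (l : ℕ) : (ordered l).Pairwise Le := Finset.pairwise_sort _ _

theorem ordered_filter {k l : ℕ} (hkl : k ≤ l) :
    (ordered l).filter (fun v => v.deg ≤ k) = ordered k := by
  refine List.Perm.eq_of_pairwise (fun a b _ _ => Le.antisymm a b)
    ((pairwise_ordered l).filter _) (pairwise_ordered k) ?_
  refine (List.perm_ext_iff_of_nodup ((nodup_ordered l).filter _) (nodup_ordered k)).mpr ?_
  intro v
  rw [List.mem_filter, mem_ordered, mem_ordered]
  simp
  omega

end NPlus

namespace StructureGroup

theorem isOrderedProduct_iff {g : StructureGroup} {u : NPlus → ℚ} :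
    IsOrderedProduct g u ↔ ∀ l, ModEq l g (dilogProd (NPlus.ordered l) u) := by
  refine ⟨fun h l => ?_, fun h l _ => h l⟩
  rcases Nat.eq_zero_or_pos l with rfl | hl
  · intro v hv
    have := v.deg_pos
    omega
  · exact h l hl

theorem dilogProd_ordered_modEq {k l : ℕ} (hkl : k ≤ l) (u : NPlus → ℚ) :
    ModEq k (dilogProd (NPlus.ordered l) u) (dilogProd (NPlus.ordered k) u) := by
  have h := dilogProd_modEq_filter k (NPlus.ordered l) u
  rwa [NPlus.ordered_filter hkl] at h

theorem ordered_exponents_unique {l : ℕ} {u u' : NPlus → ℚ}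
    (h : ModEq l (dilogProd (NPlus.ordered l) u) (dilogProd (NPlus.ordered l) u')) {v : NPlus}
    (hv : v.deg ≤ l) : u v = u' v :=
  dilogProd_exponents_unique (NPlus.nodup_ordered l) h (NPlus.mem_ordered.mpr hv) hv

theorem exists_exponents_modEq (g : StructureGroup) (l : ℕ) :
    ∃ u : NPlus → ℚ, ModEq l g (dilogProd (NPlus.ordered l) u) := by
  induction l with
  | zero =>
    refine ⟨0, fun v hv => ?_⟩
    have := v.deg_pos
    omega
  | succ l ih =>
    obtain ⟨u, hu⟩ := ih
    set u' : NPlus → ℚ := fun v => if v.deg ≤ l then u v else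
      g.log.coeff v - (dilogProd (NPlus.ordered l) u).log.coeff v with hu'
    refine ⟨u', fun v hv => ?_⟩
    rw [coeff_log_dilogProd _ _ hv, NPlus.ordered_filter (Nat.le_succ l),
      dilogProd_congr (e := u') (e' := u) fun w hw => by
        rw [hu']
        exact if_pos (NPlus.mem_ordered.mp hw)]
    split_ifs with h
    · rw [List.count_eq_one_of_mem (NPlus.nodup_ordered _) (NPlus.mem_ordered.mpr hv), hu']
      simp only
      rw [if_neg (by omega)]
      push_cast
      ring
    · rw [add_zero, hu v (by omega)]

/-- Every element of the group has a unique ordered factorization. -/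
theorem existsUnique_isOrderedProduct (g : StructureGroup) :
    ∃! u : NPlus → ℚ, IsOrderedProduct g u := by
  choose U hU using exists_exponents_modEq g
  have hcompat : ∀ {k l : ℕ}, k ≤ l → ∀ v : NPlus, v.deg ≤ k → U l v = U k v := by
    intro k l hkl v hv
    refine ordered_exponents_unique (l := k) ?_ hv
    exact (dilogProd_ordered_modEq hkl _).symm.trans
      (((hU l).mono hkl).symm.trans (hU k))
  refine ⟨fun v => U v.deg v, ?_, ?_⟩
  · simp only
    rw [isOrderedProduct_iff]
    intro l
    rw [dilogProd_congr (e' := U l) fun v hv =>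
      (hcompat (NPlus.mem_ordered.mp hv) v le_rfl).symm]
    exact hU l
  · intro u hu
    rw [isOrderedProduct_iff] at hu
    ext v
    exact ordered_exponents_unique ((hu v.deg).symm.trans (hU v.deg)) le_rfl

end StructureGroup

/-! ### Counting functions and Newton expansions -/

theorem sum_filter_le_eq {ι : Type} [DecidableEq ι] [Fintype ι]
    {M : Type*} [AddCommMonoid M] (β : Finset ι × Finset ι → M)
    (A : Finset ι × Finset ι) :
    ∑ S with S ≤ A, β S = ∑ S ∈ ({S | S ≤ A} : Finset _).erase A, β S + β A :=
  (sum_erase_add _ _ (by simp)).symm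

theorem lt_of_mem_erase_filter_le {ι : Type} [DecidableEq ι] [Fintype ι]
    {A S : Finset ι × Finset ι}
    (h : S ∈ ({S | S ≤ A} : Finset _).erase A) : S < A := by
  rw [mem_erase, mem_filter] at h
  exact lt_of_le_of_ne h.2.2 h.1

/-- A function on pairs `A` of subsets of `ι` is a *counting function of bidegree at most `(a, b)`*
if it counts the elements of a finite set of objects that are supported in `A`, where each object
is supported in a pair of sets of sizes at most `a` and `b`. -/
def IsCount {ι : Type} [DecidableEq ι] (a b : ℕ) (f : Finset ι × Finset ι → ℕ) : Prop :=
  ∃ (X : Type) (_ : Fintype X) (supp : X → Finset ι × Finset ι),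
    (∀ x, #(supp x).1 ≤ a ∧ #(supp x).2 ≤ b) ∧ ∀ A, f A = #{x | supp x ≤ A}

namespace IsCount

variable {ι : Type} [DecidableEq ι] {a b a' b' : ℕ} {f g : Finset ι × Finset ι → ℕ}

theorem mono (hf : IsCount a b f) (ha : a ≤ a') (hb : b ≤ b') : IsCount a' b' f := by
  obtain ⟨X, _, supp, h1, h2⟩ := hf
  exact ⟨X, _, supp, fun x => ⟨(h1 x).1.trans ha, (h1 x).2.trans hb⟩, h2⟩

theorem const (n : ℕ) : IsCount a b (fun _ : Finset ι × Finset ι => n) :=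
  ⟨Fin n, inferInstance, fun _ => ⊥, fun x => by simp, fun A => by simp⟩

theorem indicator (S : Finset ι × Finset ι) :
    IsCount #S.1 #S.2 (fun A => if S ≤ A then 1 else 0) :=
  ⟨Unit, inferInstance, fun _ => S, fun _ => ⟨le_rfl, le_rfl⟩, fun A => by
    by_cases h : S ≤ A <;> simp [h]⟩

theorem add (hf : IsCount a b f) (hg : IsCount a b g) : IsCount a b (fun A => f A + g A) := by
  obtain ⟨X, _, s, h1, h2⟩ := hf
  obtain ⟨Y, _, t, k1, k2⟩ := hg
  refine ⟨X ⊕ Y, inferInstance, Sum.elim s t, ?_, fun A => ?_⟩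
  · rintro (x | y)
    · exact h1 x
    · exact k1 y
  · simp only
    rw [h2, k2, ← card_disjSum]
    congr 1
    ext (x | y) <;> simp

theorem sum {κ : Type*} (s : Finset κ) {F : κ → Finset ι × Finset ι → ℕ}
    (h : ∀ k ∈ s, IsCount a b (F k)) : IsCount a b (fun A => ∑ k ∈ s, F k A) := by
  classical
  induction s using Finset.induction_on with
  | empty => simpa using const 0
  | insert k s hk ih =>
    simp only [sum_insert hk]
    exact (h k (mem_insert_self k s)).add (ih fun j hj => h j (mem_insert_of_mem hj))

theorem mul (hf : IsCount a b f) (hg : IsCount a' b' g) :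
    IsCount (a + a') (b + b') (fun A => f A * g A) := by
  obtain ⟨X, _, s, h1, h2⟩ := hf
  obtain ⟨Y, _, t, k1, k2⟩ := hg
  refine ⟨X × Y, inferInstance, fun p => s p.1 ⊔ t p.2, ?_, fun A => ?_⟩
  · rintro ⟨x, y⟩
    exact ⟨(card_union_le _ _).trans (add_le_add (h1 x).1 (k1 y).1),
      (card_union_le _ _).trans (add_le_add (h1 x).2 (k1 y).2)⟩
  · simp only
    rw [h2, k2, ← card_product]
    congr 1
    ext ⟨x, y⟩
    simp only [mem_product, mem_filter, mem_univ, true_and, sup_le_iff]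

theorem const_mul (n : ℕ) (hf : IsCount a b f) : IsCount a b (fun A => n * f A) := by
  have h := (const (ι := ι) (a := 0) (b := 0) n).mul hf
  simpa using h

/-- Choosing `k` of the counted objects amounts to counting sets of objects, supported in the union
of the supports of their elements. -/
theorem choose (hf : IsCount a b f) (k : ℕ) :
    IsCount (k * a) (k * b) (fun A => (f A).choose k) := by
  classical
  obtain ⟨X, _, s, h1, h2⟩ := hf
  refine ⟨{t : Finset X // #t = k}, inferInstance, fun t => t.1.sup s, ?_, fun A => ?_⟩
  · rintro ⟨t, rfl⟩
    simp only
    induction t using Finset.induction_on with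
    | empty => simp
    | insert x t hx ih =>
      rw [sup_insert, card_insert_of_notMem hx, Nat.add_mul, Nat.add_mul, one_mul, one_mul,
        Nat.add_comm _ a, Nat.add_comm _ b]
      exact ⟨(card_union_le _ _).trans (add_le_add (h1 x).1 ih.1),
        (card_union_le _ _).trans (add_le_add (h1 x).2 ih.2)⟩
  · simp only
    rw [h2, ← card_powersetCard]
    refine (card_bij (fun t _ => t.1) ?_ ?_ ?_).symm
    · rintro ⟨t, ht⟩ h
      simp only [mem_filter, mem_univ, true_and, Finset.sup_le_iff] at h
      rw [mem_powersetCard]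
      exact ⟨fun x hx => by simpa using h x hx, ht⟩
    · rintro ⟨t, ht⟩ _ ⟨t', ht'⟩ _ h
      exact Subtype.ext h
    · intro t ht
      rw [mem_powersetCard] at ht
      refine ⟨⟨t, ht.2⟩, ?_, rfl⟩
      simp only [mem_filter, mem_univ, true_and, Finset.sup_le_iff]
      exact fun x hx => by simpa using ht.1 hx

variable [Fintype ι]

/-- Counting functions are the sums of weights over the pairs of subsets of the argument. -/
theorem iff_exists_weight : IsCount a b f ↔ ∃ β : Finset ι × Finset ι → ℕ,
    (∀ S, β S ≠ 0 → #S.1 ≤ a ∧ #S.2 ≤ b) ∧ ∀ A, f A = ∑ S with S ≤ A, β S := by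
  constructor
  · rintro ⟨X, _, s, h1, h2⟩
    refine ⟨fun S => #{x | s x = S}, fun S hS => ?_, fun A => ?_⟩
    · obtain ⟨x, hx⟩ := card_ne_zero.mp hS
      rw [mem_filter] at hx
      exact hx.2 ▸ h1 x
    · rw [h2, card_eq_sum_card_fiberwise (f := s) (t := {S | S ≤ A})]
      · refine sum_congr rfl fun S hS => ?_
        congr 1
        ext x
        simp only [mem_filter, mem_univ, true_and] at hS ⊢
        exact ⟨fun h => h.2, fun h => ⟨h ▸ hS, h⟩⟩
      · intro x hx
        simpa using hx
  · rintro ⟨β, h1, h2⟩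
    refine ⟨Σ S, Fin (β S), inferInstance, fun x => x.1, fun x => h1 _ ?_, fun A => ?_⟩
    · exact (Nat.zero_le _).trans_lt x.2.isLt |>.ne'
    · rw [h2]
      have : (univ.filter fun x : Σ S, Fin (β S) => x.1 ≤ A) =
          (univ.filter fun S => S ≤ A).sigma fun S => univ := by
        ext x
        simp
      rw [this, card_sigma]
      simp

/-- A function with values in `ℕ` is a counting function as soon as a positive multiple of it
is: by induction, all weights are divisible. -/
theorem of_mul {n : ℕ} (hn : 0 < n) (h : IsCount a b (fun A => n * f A)) : IsCount a b f := by
  rw [iff_exists_weight] at h ⊢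
  obtain ⟨β, h1, h2⟩ := h
  have hdvd : ∀ S, n ∣ β S := by
    intro S
    induction S using WellFoundedLT.induction with
    | _ S ih =>
      have h3 := h2 S
      rw [sum_filter_le_eq] at h3
      exact (Nat.dvd_add_right (dvd_sum fun T hT => ih T (lt_of_mem_erase_filter_le hT))).mp
        ⟨f S, h3.symm⟩
  choose γ hγ using hdvd
  refine ⟨γ, fun S hS => h1 S ?_, fun A => Nat.eq_of_mul_eq_mul_left hn ?_⟩
  · rw [hγ]
    exact Nat.mul_ne_zero hn.ne' hS
  · rw [h2, mul_sum]
    exact sum_congr rfl fun S _ => hγ S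

end IsCount

/-- Möbius inversion: the sums over the pairs of subsets determine the summands. -/
theorem eq_of_sum_filter_le_eq {ι : Type} [DecidableEq ι] [Fintype ι]
    {β γ : Finset ι × Finset ι → ℚ}
    (h : ∀ A, ∑ S with S ≤ A, β S = ∑ S with S ≤ A, γ S) : β = γ := by
  ext S
  induction S using WellFoundedLT.induction with
  | _ S ih =>
    have h3 := h S
    rw [sum_filter_le_eq, sum_filter_le_eq,
      sum_congr rfl fun T hT => ih T (lt_of_mem_erase_filter_le hT)] at h3
    exact add_left_cancel h3

/-- Newton's expansion of a function of two variables in products of binomial coefficients. -/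
theorem exists_newton_expansion (F : ℕ → ℕ → ℚ) : ∃ α : ℕ → ℕ → ℚ, ∀ m n,
    F m n = ∑ i ∈ range (m + 1), ∑ j ∈ range (n + 1), α i j * m.choose i * n.choose j := by
  have h1 : ∀ {M : Type} [AddCommGroup M] (f : ℕ → M), ∃ c : ℕ → M, ∀ n,
      f n = ∑ k ∈ range (n + 1), n.choose k • c k := by
    intro M _ f
    refine ⟨fun k => (fwdDiff 1)^[k] f 0, fun n => ?_⟩
    have := shift_eq_sum_fwdDiff_iter 1 f n 0
    simpa using this
  obtain ⟨c, hc⟩ := h1 F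
  choose α hα using fun i => h1 (c i)
  refine ⟨α, fun m n => ?_⟩
  rw [hc, Finset.sum_apply]
  refine sum_congr rfl fun i _ => ?_
  rw [Pi.smul_apply, hα, smul_sum]
  refine sum_congr rfl fun j _ => ?_
  simp only [nsmul_eq_mul]
  ring

/-- A function of two variables that yields counting functions of bidegree at most `(a, b)` when
evaluated at the cardinalities of subsets of arbitrarily large finite sets is a combination of
products `C(m, i) C(n, j)`, `i ≤ a`, `j ≤ b`, with coefficients in `ℕ`. -/
theorem exists_nat_newton_expansion {a b : ℕ} {F : ℕ → ℕ → ℚ}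
    (h : ∀ N : ℕ, ∃ f : Finset (Fin N) × Finset (Fin N) → ℕ, IsCount a b f ∧
      ∀ A, F #A.1 #A.2 = f A) :
    ∃ α : ℕ → ℕ → ℕ, ∀ m n, F m n =
      ∑ i ∈ range (a + 1), ∑ j ∈ range (b + 1), (α i j : ℚ) * m.choose i * n.choose j := by
  obtain ⟨α, hα⟩ := exists_newton_expansion F
  -- the coefficient `α i j` is the weight of any pair of sets with `i` and `j` elements
  have key : ∀ i j, ∃ k : ℕ, α i j = k ∧ (k ≠ 0 → i ≤ a ∧ j ≤ b) := by
    intro i j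
    obtain ⟨f, hf, hF⟩ := h (i + j)
    obtain ⟨β, h1, h2⟩ := IsCount.iff_exists_weight.mp hf
    have h3 : (fun S : Finset (Fin (i + j)) × Finset (Fin (i + j)) => α #S.1 #S.2) =
        fun S => (β S : ℚ) := by
      refine eq_of_sum_filter_le_eq fun A => ?_
      have h4 : (univ.filter fun S => S ≤ A) = A.1.powerset ×ˢ A.2.powerset := by
        ext S
        simp [Prod.le_def]
      rw [← Nat.cast_sum, ← h2, ← hF, hα, h4, sum_product]
      have h5 : ∀ S : Finset (Fin (i + j)), ∑ T ∈ A.2.powerset, α #S #T =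
          ∑ k ∈ range (#A.2 + 1), (#A.2).choose k • α #S k := fun S =>
        sum_powerset_apply_card (fun k => α #S k)
      simp only [h5]
      rw [sum_powerset_apply_card
        (fun i => ∑ k ∈ range (#A.2 + 1), (#A.2).choose k • α i k)]
      refine sum_congr rfl fun i _ => ?_
      rw [smul_sum]
      refine sum_congr rfl fun k _ => ?_
      simp only [nsmul_eq_mul]
      ring
    obtain ⟨S, -, hS⟩ := exists_subset_card_eq (s := (univ : Finset (Fin (i + j)))) (n := i)
      (by simp)
    obtain ⟨T, -, hT⟩ := exists_subset_card_eq (s := (univ : Finset (Fin (i + j)))) (n := j)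
      (by simp)
    have h6 := congrFun h3 (S, T)
    simp only [hS, hT] at h6
    exact ⟨β (S, T), h6, fun hk => by simpa [hS, hT] using h1 _ hk⟩
  choose k hk1 hk2 using key
  refine ⟨k, fun m n => ?_⟩
  rw [hα]
  simp only [hk1, ← sum_product']
  -- both sides are sums of the same terms, those with `i ≤ min a m` and `j ≤ min b n`
  refine (sum_subset (s₂ := range (m + a + 1) ×ˢ range (n + b + 1)) ?_ ?_).trans
    (sum_subset (s₁ := range (a + 1) ×ˢ range (b + 1)) ?_ ?_).symm
  · exact product_subset_product (range_mono (by omega)) (range_mono (by omega))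
  · rintro ⟨i, j⟩ _ h
    simp only [mem_product, mem_range] at h
    rcases Nat.lt_or_ge m i with h' | h'
    · simp [Nat.choose_eq_zero_of_lt h']
    · simp [Nat.choose_eq_zero_of_lt (show n < j by omega)]
  · exact product_subset_product (range_mono (by omega)) (range_mono (by omega))
  · rintro ⟨i, j⟩ _ h
    simp only [mem_product, mem_range] at h
    have : k i j = 0 := by
      by_contra h'
      have := hk2 i j h'
      omega
    simp [this]

/-! ### Exponents of ordered products -/

/-- If every `a ∈ Y` can be moved to the right of every `b ∈ X` at the cost of replacing it by a
product of elements of `Y`, then every word in `X ∪ Y` can be sorted. -/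
theorem exists_mul_of_mem_closure_union {M : Type*} [Monoid M] {X Y : Set M}
    (h : ∀ a ∈ Y, ∀ b ∈ X, ∃ k ∈ Submonoid.closure Y, a * b = b * k) {x : M}
    (hx : x ∈ Submonoid.closure (X ∪ Y)) :
    ∃ s ∈ Submonoid.closure X, ∃ t ∈ Submonoid.closure Y, x = s * t := by
  have h1 : ∀ b ∈ X, ∀ t ∈ Submonoid.closure Y, ∃ k ∈ Submonoid.closure Y, t * b = b * k := by
    intro b hb t ht
    induction ht using Submonoid.closure_induction with
    | mem a ha => exact h a ha b hb
    | one => exact ⟨1, one_mem _, by simp⟩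
    | mul t t' _ _ ih ih' =>
      obtain ⟨k, hk, e⟩ := ih
      obtain ⟨k', hk', e'⟩ := ih'
      exact ⟨k * k', mul_mem hk hk', by rw [mul_assoc, e', ← mul_assoc, e, mul_assoc]⟩
  have h2 : ∀ s ∈ Submonoid.closure X, ∀ t ∈ Submonoid.closure Y,
      ∃ k ∈ Submonoid.closure Y, t * s = s * k := by
    intro s hs
    induction hs using Submonoid.closure_induction with
    | mem b hb => exact h1 b hb
    | one => exact fun t ht => ⟨t, ht, by simp⟩
    | mul s s' _ _ ih ih' =>
      intro t ht
      obtain ⟨k, hk, e⟩ := ih t ht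
      obtain ⟨k', hk', e'⟩ := ih' k hk
      exact ⟨k', hk', by rw [← mul_assoc, e, mul_assoc, e', mul_assoc]⟩
  induction hx using Submonoid.closure_induction with
  | mem x hx =>
    rcases hx with hx | hx
    · exact ⟨x, Submonoid.subset_closure hx, 1, one_mem _, by simp⟩
    · exact ⟨1, one_mem _, x, Submonoid.subset_closure hx, by simp⟩
  | one => exact ⟨1, one_mem _, 1, one_mem _, by simp⟩
  | mul x x' _ _ ih ih' =>
    obtain ⟨s, hs, t, ht, rfl⟩ := ih
    obtain ⟨s', hs', t', ht', rfl⟩ := ih'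
    obtain ⟨k, hk, e⟩ := h2 s' hs' t ht
    refine ⟨s * s', mul_mem hs hs', k * t', mul_mem hk ht', ?_⟩
    rw [mul_assoc, ← mul_assoc t, e, mul_assoc, mul_assoc]

namespace NPlus

/-- The first basis vector `(1, 0)`. -/
abbrev e₁ : NPlus := ⟨1, 0, by decide⟩

/-- The second basis vector `(0, 1)`. -/
abbrev e₂ : NPlus := ⟨0, 1, by decide⟩

theorem e₁_le (v : NPlus) : Le e₁ v := by
  rw [le_iff]
  have := v.pos
  simp only [deg]
  omega

theorem form_neg_of_lt {v w : NPlus} (h : Le v w) (h0 : v.form w ≠ 0) : v.form w < 0 := by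
  rcases h with h | ⟨k, -, h1, h2⟩
  · exact h
  · refine absurd ?_ h0
    rw [form, h1, h2]
    ring

theorem form_swap (v w : NPlus) : v.form w = -w.form v := by
  simp only [form]
  ring

theorem ordered_eq_cons {l : ℕ} (hl : 1 ≤ l) :
    ∃ rest, ordered l = e₁ :: rest ∧ ∀ w ∈ rest, w ≠ e₁ := by
  have h1 : e₁ ∈ ordered l := mem_ordered.mpr hl
  have h2 := pairwise_ordered l
  have h3 := nodup_ordered l
  revert h1 h2 h3
  cases ordered l with
  | nil => simp
  | cons v rest =>
    intro h1 h2 h3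
    have h4 : v = e₁ := by
      rcases List.mem_cons.mp h1 with h | h
      · exact h.symm
      · exact Le.antisymm _ _ ((List.pairwise_cons.mp h2).1 _ h) (e₁_le v)
    subst h4
    exact ⟨rest, rfl, fun w hw hw1 => (List.nodup_cons.mp h3).1 (hw1 ▸ hw)⟩

end NPlus

namespace StructureGroup

open NPlus GHat

theorem dilogProd_single {L : List NPlus} (hL : L.Nodup) {w : NPlus} (hw : w ∈ L) (c : ℚ) :
    dilogProd L (fun v => if v = w then c else 0) = (dilog w).qpow c := by
  induction L with
  | nil => simp at hw
  | cons v L ih =>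
    rw [List.nodup_cons] at hL
    have h0 : ∀ L' : List NPlus, w ∉ L' →
        dilogProd L' (fun v => if v = w then c else 0) = 1 := by
      intro L' hL'
      unfold dilogProd
      refine List.prod_eq_one fun g hg => ?_
      obtain ⟨v, hv, rfl⟩ := List.mem_map.mp hg
      have hvw : v ≠ w := fun h => hL' (h ▸ hv)
      simp only [if_neg hvw, qpow_zero]
    rw [dilogProd_cons]
    by_cases hvw : v = w
    · subst hvw
      rw [h0 L hL.1, if_pos rfl, mul_one]
    · rw [if_neg hvw, qpow_zero, one_mul,
        ih hL.2 ((List.mem_cons.mp hw).resolve_left (Ne.symm hvw))]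

theorem mapFace_dilogProd (p q : ℕ) (L : List NPlus) (e : NPlus → ℚ) :
    mapFace p q (dilogProd L e) =
      dilogProd L (fun v => if p * v.fst + q * v.snd = 0 then e v else 0) := by
  unfold dilogProd
  rw [map_list_prod, List.map_map]
  congr 1
  refine List.map_congr_left fun v _ => ?_
  rw [Function.comp_apply, mapFace_qpow]
  simp only
  split_ifs with h
  · rw [mapFace_dilog_of_eq_zero h]
  · rw [mapFace_dilog_of_ne_zero h, one_qpow, qpow_zero]

/-- If the image of a group element on a face of `N⁺` is a power of a single `Ψ[w]`, then the
exponents on the face are the obvious ones. -/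
theorem IsOrderedProduct.eq_of_mapFace {g : StructureGroup} {u : NPlus → ℚ}
    (h : IsOrderedProduct g u) {p q : ℕ} {w : NPlus} {c : ℚ}
    (hg : mapFace p q g = (dilog w).qpow c) {v : NPlus} (hv : p * v.fst + q * v.snd = 0) :
    u v = if v = w then c else 0 := by
  set l := max v.deg w.deg
  have h1 := (isOrderedProduct_iff.mp h l).mapFace p q
  rw [hg, mapFace_dilogProd, ← dilogProd_single (nodup_ordered l)
    (mem_ordered.mpr (le_max_right _ _))] at h1
  have h2 := ordered_exponents_unique h1 (le_max_left v.deg w.deg)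
  rw [if_pos hv] at h2
  exact h2.symm

end StructureGroup

namespace IsExponentFamily

open NPlus StructureGroup

variable {u : NPlus → ℕ → ℕ → ℚ}

theorem eq_of_snd_eq_zero (hu : IsExponentFamily u) (m n : ℕ) {v : NPlus} (hv : v.snd = 0) :
    u v m n = if v = e₁ then (m : ℚ) else 0 := by
  refine (hu m n).eq_of_mapFace (p := 0) (q := 1) ?_ (by simpa using hv)
  rw [map_mul, mapFace_qpow, mapFace_qpow, mapFace_dilog_of_ne_zero (by simp),
    mapFace_dilog_of_eq_zero (by simp), one_qpow, one_mul]

theorem eq_of_fst_eq_zero (hu : IsExponentFamily u) (m n : ℕ) {v : NPlus} (hv : v.fst = 0) :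
    u v m n = if v = e₂ then (n : ℚ) else 0 := by
  refine (hu m n).eq_of_mapFace (p := 1) (q := 0) ?_ (by simpa using hv)
  rw [map_mul, mapFace_qpow, mapFace_qpow, mapFace_dilog_of_eq_zero (by simp),
    mapFace_dilog_of_ne_zero (v := e₁) (by simp), one_qpow, mul_one]

theorem eq_zero_of_left (hu : IsExponentFamily u) (n : ℕ) {v : NPlus} (hv : v.fst ≠ 0) :
    u v 0 n = 0 := by
  have h := (hu 0 n).eq_of_mapFace (p := 0) (q := 0) (w := e₂) (c := n) (v := v)
    (by rw [map_mul, mapFace_qpow, mapFace_qpow, mapFace_dilog_of_eq_zero (by simp),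
      Nat.cast_zero, qpow_zero, mul_one]) (by simp)
  rw [h, if_neg]
  rintro rfl
  exact hv rfl

theorem eq_zero_of_right (hu : IsExponentFamily u) (m : ℕ) {v : NPlus} (hv : v.snd ≠ 0) :
    u v m 0 = 0 := by
  have h := (hu m 0).eq_of_mapFace (p := 0) (q := 0) (w := e₁) (c := m) (v := v)
    (by rw [map_mul, mapFace_qpow, mapFace_qpow, mapFace_dilog_of_eq_zero (v := e₁) (by simp),
      Nat.cast_zero, qpow_zero, one_mul]) (by simp)
  rw [h, if_neg]
  rintro rfl
  exact hv rfl

/-- The change of lattice turns the factorization of `Ψ[e₂]^n Ψ[e₁]^m` into one for powers of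
arbitrary elements `Ψ[w']` and `Ψ[w]`. -/
theorem modEq_prod_lin (hu : IsExponentFamily u) {w w' : NPlus} (hc : w'.form w ≠ 0) (l m n : ℕ) :
    ModEq l ((dilog w').qpow (n * (w'.form w)⁻¹) * (dilog w).qpow (m * (w'.form w)⁻¹))
      (((ordered l).map fun v =>
        (dilog (lin w w' v)).qpow (u v m n * (w'.form w)⁻¹)).prod) := by
  have h := (isOrderedProduct_iff.mp (hu m n) l).mapLattice hc
  have h1 : lin w w' e₁ = w := by ext <;> simp [lin]
  have h2 : lin w w' e₂ = w' := by ext <;> simp [lin]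
  rw [map_mul, mapLattice_qpow, mapLattice_qpow, mapLattice_dilog, mapLattice_dilog, h1, h2,
    qpow_qpow, qpow_qpow, dilogProd, map_list_prod, List.map_map] at h
  have h3 : ∀ v, (mapLattice w w' hc ∘ fun v => (dilog v).qpow (u v m n)) v =
      (dilog (lin w w' v)).qpow (u v m n * (w'.form w)⁻¹) := fun v => by
    rw [Function.comp_apply, mapLattice_qpow, mapLattice_dilog, qpow_qpow]
  rwa [List.map_congr_left fun v _ => h3 v] at h

/-- Integrality of the exponents in the factorization of `Ψ[w']^{n/c} Ψ[w]^{m/c}`. -/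
theorem integral_lin (hu : IsExponentFamily u) {w w' : NPlus} (hc : w'.form w ≠ 0) {m n : ℕ}
    (hm : ∃ z : ℤ, (w.content : ℚ) * (m * (w'.form w)⁻¹) = z)
    (hn : ∃ z : ℤ, (w'.content : ℚ) * (n * (w'.form w)⁻¹) = z) (v : NPlus) :
    ∃ z : ℤ, ((lin w w' v).content : ℚ) * (u v m n * (w'.form w)⁻¹) = z := by
  set l := (lin w w' v).deg with hl
  obtain ⟨z, hz⟩ := hm
  obtain ⟨z', hz'⟩ := hn
  have hinj := lin_injective hc
  have h := hu.modEq_prod_lin hc l m n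
  set e : NPlus → ℚ := Function.extend (lin w w') (fun v => u v m n * (w'.form w)⁻¹) 0 with he
  have h1 : ((ordered l).map fun v => (dilog (lin w w' v)).qpow (u v m n * (w'.form w)⁻¹)).prod =
      dilogProd ((ordered l).map (lin w w')) e := by
    unfold dilogProd
    rw [List.map_map]
    congr 1
    refine List.map_congr_left fun v _ => ?_
    rw [Function.comp_apply, he, hinj.extend_apply]
  rw [h1] at h
  have h2 := exponent_integral ((nodup_ordered l).map hinj)
    (Subgroup.mul_mem _ (dilog_qpow_mem_intGroup hz') (dilog_qpow_mem_intGroup hz)) h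
    (v := lin w w' v)
    (List.mem_map_of_mem (mem_ordered.mpr (deg_le_deg_lin w w' v))) le_rfl
  rwa [he, hinj.extend_apply] at h2

end IsExponentFamily

/-! ### Sorting words in the dilogarithm elements -/

open NPlus StructureGroup

section Letters

variable {ι : Type}

/-- The family of the powers `Ψ[v]^{φ A}`, taken modulo `G^{> l}`. It is encoded by the faithful
action of `G^{≤ l}` on `GHat`, so that congruences become equalities. -/
noncomputable def letter (l : ℕ) (v : NPlus) (φ : Finset ι × Finset ι → ℚ) :
    Finset ι × Finset ι → Module.End ℚ GHat :=
  fun A => repHom (l + 1) ((dilog v).qpow (φ A))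

variable {l : ℕ} {v : NPlus} {φ ψ : Finset ι × Finset ι → ℚ}

theorem letter_add (l : ℕ) (v : NPlus) (φ ψ : Finset ι × Finset ι → ℚ) :
    letter l v (fun A => φ A + ψ A) = letter l v φ * letter l v ψ := by
  ext1 A
  rw [Pi.mul_apply, letter, letter, letter, qpow_add, map_mul]

theorem letter_zero (l : ℕ) (v : NPlus) :
    letter l v (fun _ : Finset ι × Finset ι => 0) = 1 := by
  ext1 A
  rw [letter, qpow_zero, map_one, Pi.one_apply]

theorem letter_eq_one (h : l < v.deg) (φ : Finset ι × Finset ι → ℚ) : letter l v φ = 1 := by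
  ext1 A
  rw [letter, Pi.one_apply, modEq_iff_repHom_eq.mp (dilog_qpow_modEq_one h (φ A)), map_one]

variable [DecidableEq ι]

/-- The function `gcd(v) φ` is a counting function of bidegree at most `v`. -/
def IsCountExponent (v : NPlus) (φ : Finset ι × Finset ι → ℚ) : Prop :=
  ∃ f, IsCount v.fst v.snd f ∧ ∀ A, (v.content : ℚ) * φ A = f A

/-- The letters of the words that are to be sorted. For `v` of degree `1` only exponents with
values `0` and `1` are allowed, since the pentagon relation applies to these only. -/
def letters (ι : Type) [DecidableEq ι] (l : ℕ) (v : NPlus) :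
    Set (Finset ι × Finset ι → Module.End ℚ GHat) :=
  {x | ∃ φ, IsCountExponent v φ ∧ (v.deg = 1 → ∀ A, φ A = 0 ∨ φ A = 1) ∧ x = letter l v φ}

/-- The letters that belong after those of `v`. -/
def lettersAbove (ι : Type) [DecidableEq ι] (l : ℕ) (v : NPlus) :
    Set (Finset ι × Finset ι → Module.End ℚ GHat) :=
  {x | ∃ w : NPlus, w.deg ≤ l ∧ Le v w ∧ v ≠ w ∧ x ∈ letters ι l w}

theorem IsCountExponent.add (hφ : IsCountExponent v φ) (hψ : IsCountExponent v ψ) :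
    IsCountExponent v (fun A => φ A + ψ A) := by
  obtain ⟨f, hf, h1⟩ := hφ
  obtain ⟨g, hg, h2⟩ := hψ
  exact ⟨_, hf.add hg, fun A => by rw [mul_add, h1, h2, Nat.cast_add]⟩

theorem exists_letter_of_mem_closure {x : Finset ι × Finset ι → Module.End ℚ GHat}
    (hx : x ∈ Submonoid.closure (letters ι l v)) : ∃ φ, IsCountExponent v φ ∧ x = letter l v φ := by
  induction hx using Submonoid.closure_induction with
  | mem x hx =>
    obtain ⟨φ, h1, -, h2⟩ := hx
    exact ⟨φ, h1, h2⟩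
  | one => exact ⟨fun _ => 0, ⟨fun _ => 0, IsCount.const 0, by simp⟩, (letter_zero l v).symm⟩
  | mul x y _ _ ihx ihy =>
    obtain ⟨φ, h1, rfl⟩ := ihx
    obtain ⟨ψ, h2, rfl⟩ := ihy
    exact ⟨_, h1.add h2, (letter_add l v φ ψ).symm⟩

theorem letter_mem_closure_lettersAbove {w : NPlus} (h1 : Le v w) (h2 : v ≠ w)
    (h3 : w.deg ≤ l → IsCountExponent w φ) (h4 : w.deg = 1 → ∀ A, φ A = 0 ∨ φ A = 1) :
    letter l w φ ∈ Submonoid.closure (lettersAbove ι l v) := by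
  by_cases hw : w.deg ≤ l
  · exact Submonoid.subset_closure ⟨w, hw, h1, h2, φ, h3 hw, h4, rfl⟩
  · rw [letter_eq_one (by omega)]
    exact one_mem _

/-- The pentagon relation exchanges letters of degree `1`. -/
theorem exists_mul_letter_eq_of_deg_one (l : ℕ) (hφ : IsCountExponent e₁ φ)
    (hφ' : ∀ A, φ A = 0 ∨ φ A = 1) (hψ : IsCountExponent e₂ ψ) (hψ' : ∀ A, ψ A = 0 ∨ ψ A = 1) :
    ∃ k ∈ Submonoid.closure (lettersAbove ι l e₁),
      letter l e₂ ψ * letter l e₁ φ = letter l e₁ φ * k := by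
  refine ⟨letter l ⟨1, 1, by decide⟩ (fun A => φ A * ψ A) * letter l e₂ ψ, mul_mem ?_ ?_, ?_⟩
  · refine letter_mem_closure_lettersAbove (e₁_le _) (by decide) (fun _ => ?_)
      (fun h => absurd h (by decide))
    obtain ⟨f, hf, h1⟩ := hφ
    obtain ⟨g, hg, h2⟩ := hψ
    refine ⟨_, hf.mul hg, fun A => ?_⟩
    rw [Nat.cast_mul, ← h1, ← h2]
    simp [content]
  · exact letter_mem_closure_lettersAbove (e₁_le _) (by decide) (fun _ => hψ) (fun _ => hψ')
  · ext1 A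
    simp only [Pi.mul_apply, letter, ← map_mul]
    congr 1
    rcases hφ' A with h1 | h1 <;> rcases hψ' A with h2 | h2 <;>
      simp only [h1, h2, mul_zero, mul_one, one_mul, qpow_zero, qpow_one]
    exact pentagon

end Letters

/-- The exponent `u v` is `gcd(v)⁻¹` times a combination, with coefficients in `ℕ`, of the products
`C(m, i) C(n, j)` with `i ≤ v₁` and `j ≤ v₂`. Here the indices `0` are allowed. -/
def HasNatNewtonExpansion (u : NPlus → ℕ → ℕ → ℚ) (v : NPlus) : Prop :=
  ∃ α : ℕ → ℕ → ℕ, ∀ m n, (v.content : ℚ) * u v m n =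
    ∑ i ∈ range (v.fst + 1), ∑ j ∈ range (v.snd + 1), (α i j : ℚ) * m.choose i * n.choose j

namespace IsExponentFamily

variable {ι : Type} [DecidableEq ι] [Fintype ι] {u : NPlus → ℕ → ℕ → ℚ}

/-- The exponents in the factorization of `Ψ[w']^{N/c} Ψ[w]^{M/c}` are again given by counting
functions. Integrality is what removes the denominators. -/
theorem isCountExponent_lin (hu : IsExponentFamily u) {w w' v : NPlus} {c : ℕ} (hc : 0 < c)
    (hcw : w'.form w = c) {M N : Finset ι × Finset ι → ℕ} (hM : IsCount w.fst w.snd M)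
    (hN : IsCount w'.fst w'.snd N)
    (hM' : ∀ A, ∃ z : ℤ, (w.content : ℚ) * (M A * (c : ℚ)⁻¹) = z)
    (hN' : ∀ A, ∃ z : ℤ, (w'.content : ℚ) * (N A * (c : ℚ)⁻¹) = z)
    (hv : HasNatNewtonExpansion u v) :
    IsCountExponent (lin w w' v) (fun A => u v (M A) (N A) * (c : ℚ)⁻¹) := by
  obtain ⟨α, hα⟩ := hv
  have hcne : w'.form w ≠ 0 := by
    rw [hcw]
    exact_mod_cast hc.ne'
  have hc0 : (c : ℚ) ≠ 0 := by exact_mod_cast hc.ne'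
  have hd := (lin w w' v).content_pos
  have hd0 : (0 : ℚ) < (lin w w' v).content := by exact_mod_cast hd
  have hint : ∀ A, ∃ z : ℤ, ((lin w w' v).content : ℚ) * (u v (M A) (N A) * (c : ℚ)⁻¹) = z := by
    intro A
    have h := hu.integral_lin hcne (m := M A) (n := N A) (by rw [hcw]; exact hM' A)
      (by rw [hcw]; exact hN' A) v
    rwa [hcw] at h
  choose z hz using hint
  set F : Finset ι × Finset ι → ℕ := fun A => ∑ i ∈ range (v.fst + 1), ∑ j ∈ range (v.snd + 1),
    α i j * ((M A).choose i * (N A).choose j) with hF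
  have hFu : ∀ A, (v.content : ℚ) * u v (M A) (N A) = F A := by
    intro A
    rw [hα, hF]
    push_cast
    exact sum_congr rfl fun i _ => sum_congr rfl fun j _ => mul_assoc _ _ _
  have hFc : IsCount (lin w w' v).fst (lin w w' v).snd F := by
    refine IsCount.sum _ fun i hi => IsCount.sum _ fun j hj => IsCount.const_mul _ ?_
    rw [mem_range] at hi hj
    refine ((hM.choose i).mul (hN.choose j)).mono ?_ ?_ <;>
      exact add_le_add (Nat.mul_le_mul_right _ (by omega)) (Nat.mul_le_mul_right _ (by omega))
  have key : ∀ A, ((v.content * c : ℕ) : ℚ) * z A = (lin w w' v).content * F A := by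
    intro A
    rw [← hz, ← hFu]
    push_cast
    field_simp
  have hpos : 0 < v.content * c := Nat.mul_pos v.content_pos hc
  have hz0 : ∀ A, 0 ≤ z A := by
    intro A
    have h1 : (0 : ℚ) ≤ (v.content * c : ℕ) * z A := by
      rw [key]
      positivity
    have h2 : (0 : ℚ) < (v.content * c : ℕ) := by exact_mod_cast hpos
    exact_mod_cast nonneg_of_mul_nonneg_right h1 h2
  have hzc : ∀ A, ((z A).toNat : ℚ) = z A := fun A => by
    exact_mod_cast Int.toNat_of_nonneg (hz0 A)
  refine ⟨fun A => (z A).toNat, IsCount.of_mul (n := v.content * c) hpos ?_, fun A => ?_⟩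
  · have : (fun A => v.content * c * (z A).toNat) = fun A => (lin w w' v).content * F A := by
      ext A
      have h := key A
      rw [← hzc] at h
      exact_mod_cast h
    rw [this]
    exact hFc.const_mul _
  · simp only
    rw [hz, hzc]

/-- Letters exchange at the cost of letters above them if the exponents are known in lower
degrees: the change of lattice reduces the exchange to the factorization of `Ψ[e₂]^N Ψ[e₁]^M`. -/
theorem exists_mul_letter_eq_of_three_le (hu : IsExponentFamily u) {l : ℕ}
    (hl : ∀ v : NPlus, v.deg ≤ l → HasNatNewtonExpansion u v) {w w' : NPlus} (hle : Le w w')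
    (h0 : w'.form w ≠ 0) (hdeg : 3 ≤ w.deg + w'.deg) {φ ψ : Finset ι × Finset ι → ℚ}
    (hφ : IsCountExponent w φ) (hψ : IsCountExponent w' ψ)
    (hψ' : w'.deg = 1 → ∀ A, ψ A = 0 ∨ ψ A = 1) :
    ∃ k ∈ Submonoid.closure (lettersAbove ι (l + 1) w),
      letter (l + 1) w' ψ * letter (l + 1) w φ = letter (l + 1) w φ * k := by
  obtain ⟨f, hf, hφf⟩ := hφ
  obtain ⟨g, hg, hψg⟩ := id hψ
  have hww' : w ≠ w' := by
    rintro rfl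
    apply h0
    rw [form]
    ring
  have hform : w.form w' < 0 := form_neg_of_lt hle (by rwa [form_swap, neg_ne_zero])
  -- `c = {w', w}` is a positive multiple of both contents
  obtain ⟨c, a, a', hc, hcw, hca, hca'⟩ : ∃ c a a' : ℕ, 0 < c ∧ w'.form w = c ∧
      c = w.content * a ∧ c = w'.content * a' := by
    obtain ⟨z, hz⟩ := exists_form_eq_content_mul w w'
    obtain ⟨z', hz'⟩ := exists_form_eq_content_mul w' w
    have hpos : 0 < w'.form w := by
      rw [form_swap]
      linarith
    have h1 : (0 : ℚ) < w.content := by exact_mod_cast w.content_pos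
    have h2 : (0 : ℚ) < w'.content := by exact_mod_cast w'.content_pos
    have hzneg : 0 < -z := by
      have : (0 : ℚ) < ((-z : ℤ) : ℚ) := by
        refine pos_of_mul_pos_right (a := (w.content : ℚ)) ?_ h1.le
        push_cast
        linarith
      exact_mod_cast this
    have hzpos : 0 < z' := by
      have : (0 : ℚ) < (z' : ℚ) := pos_of_mul_pos_right (hz' ▸ hpos) h2.le
      exact_mod_cast this
    obtain ⟨a, ha⟩ := Int.eq_ofNat_of_zero_le hzneg.le
    obtain ⟨a', ha'⟩ := Int.eq_ofNat_of_zero_le hzpos.le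
    have e1 : w'.form w = (w.content * a : ℕ) := by
      rw [form_swap, hz]
      have : (z : ℚ) = -a := by
        have : z = -a := by omega
        rw [this]
        simp
      rw [this]
      push_cast
      ring
    have e2 : w'.form w = (w'.content * a' : ℕ) := by
      rw [hz', ha']
      simp
    refine ⟨w.content * a, a, a', Nat.mul_pos w.content_pos (by omega), e1, rfl, ?_⟩
    rw [e1] at e2
    exact_mod_cast e2
  have hc0 : (c : ℚ) ≠ 0 := by exact_mod_cast hc.ne'
  have hd0 : (w.content : ℚ) ≠ 0 := by exact_mod_cast w.content_pos.ne'
  have hd0' : (w'.content : ℚ) ≠ 0 := by exact_mod_cast w'.content_pos.ne'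
  set M : Finset ι × Finset ι → ℕ := fun A => a * f A with hM
  set N : Finset ι × Finset ι → ℕ := fun A => a' * g A with hN
  have hMφ : ∀ A, (M A : ℚ) * (c : ℚ)⁻¹ = φ A := fun A => by
    rw [← div_eq_mul_inv, div_eq_iff hc0, hca, hM]
    push_cast
    rw [← hφf]
    ring
  have hNψ : ∀ A, (N A : ℚ) * (c : ℚ)⁻¹ = ψ A := fun A => by
    rw [← div_eq_mul_inv, div_eq_iff hc0, hca', hN]
    push_cast
    rw [← hψg]
    ring
  obtain ⟨rest, hrest, hne⟩ := ordered_eq_cons (Nat.le_add_left 1 l)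
  set E : NPlus → Finset ι × Finset ι → ℚ := fun v A => u v (M A) (N A) * (c : ℚ)⁻¹ with hE
  refine ⟨(rest.map fun v => letter (l + 1) (lin w w' v) (E v)).prod, ?_, ?_⟩
  · refine Submonoid.list_prod_mem _ fun x hx => ?_
    obtain ⟨v, hv, rfl⟩ := List.mem_map.mp hx
    have hve : v ≠ e₁ := hne v hv
    by_cases h1 : v.snd = 0
    · have : E v = fun _ => 0 := by
        ext A
        rw [hE]
        simp only
        rw [hu.eq_of_snd_eq_zero _ _ h1, if_neg hve, zero_mul]
      rw [this, letter_zero]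
      exact one_mem _
    by_cases h2 : v.fst = 0
    · by_cases h3 : v = e₂
      · have h4 : lin w w' v = w' := by
          rw [h3]
          ext <;> simp [lin]
        have h5 : E v = ψ := by
          ext A
          rw [hE]
          simp only
          rw [hu.eq_of_fst_eq_zero _ _ h2, if_pos h3, hNψ]
        rw [h4, h5]
        exact letter_mem_closure_lettersAbove hle hww' (fun _ => hψ) hψ'
      · have : E v = fun _ => 0 := by
          ext A
          rw [hE]
          simp only
          rw [hu.eq_of_fst_eq_zero _ _ h2, if_neg h3, zero_mul]
        rw [this, letter_zero]
        exact one_mem _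
    have hdl := deg_lin w w' v
    have hw1 := w.deg_pos
    have hw2 := w'.deg_pos
    have hvd : v.deg + 1 ≤ (lin w w' v).deg := by
      rw [hdl, deg]
      have h3 := Nat.le_mul_of_pos_right v.fst hw1
      have h4 := Nat.le_mul_of_pos_right v.snd hw2
      rcases Nat.lt_or_ge 1 w.deg with h5 | h5
      · have := Nat.mul_le_mul_left v.fst h5
        omega
      · have := Nat.mul_le_mul_left v.snd (show 2 ≤ w'.deg by omega)
        omega
    have hlt : w.form (lin w w' v) < 0 := by
      have : w.form (lin w w' v) = v.snd * w.form w' := by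
        simp only [form, lin]
        push_cast
        ring
      rw [this]
      exact mul_neg_of_pos_of_neg (by exact_mod_cast Nat.pos_of_ne_zero h1) hform
    refine letter_mem_closure_lettersAbove (Or.inl hlt) ?_ (fun h => ?_) (fun h => ?_)
    · intro h
      rw [← h, form, mul_comm, sub_self] at hlt
      exact lt_irrefl _ hlt
    · refine hu.isCountExponent_lin hc hcw (hf.const_mul a) (hg.const_mul a')
        (fun A => ⟨f A, ?_⟩) (fun A => ⟨g A, ?_⟩) (hl v (by omega))
      · rw [hMφ, hφf, Int.cast_natCast]
      · rw [hNψ, hψg, Int.cast_natCast]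
    · have := v.deg_pos
      omega
  · ext1 A
    have h1 := hu.modEq_prod_lin h0 (l + 1) (M A) (N A)
    have h2 : lin w w' e₁ = w := by ext <;> simp [lin]
    rw [hcw, hMφ, hNψ, hrest, List.map_cons, List.prod_cons, h2,
      hu.eq_of_snd_eq_zero _ _ rfl, if_pos rfl, hMφ, modEq_iff_repHom_eq, map_mul, map_mul,
      map_list_prod, List.map_map] at h1
    rw [Pi.mul_apply, Pi.mul_apply, Pi.list_prod_apply, List.map_map]
    exact h1

/-- Any two letters exchange at the cost of letters above them. -/
theorem exists_mul_letter_eq (hu : IsExponentFamily u) {l : ℕ}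
    (hl : ∀ v : NPlus, v.deg ≤ l → HasNatNewtonExpansion u v) {w w' : NPlus} (hle : Le w w')
    (hne : w ≠ w') (hdeg : w'.deg ≤ l + 1) {x y : Finset ι × Finset ι → Module.End ℚ GHat}
    (hx : x ∈ letters ι (l + 1) w) (hy : y ∈ letters ι (l + 1) w') :
    ∃ k ∈ Submonoid.closure (lettersAbove ι (l + 1) w), y * x = x * k := by
  obtain ⟨φ, hφ, hφ', rfl⟩ := hx
  obtain ⟨ψ, hψ, hψ', rfl⟩ := id hy
  by_cases h0 : w'.form w = 0
  · refine ⟨_, Submonoid.subset_closure ⟨w', hdeg, hle, hne, hy⟩, ?_⟩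
    ext1 A
    rw [Pi.mul_apply, Pi.mul_apply, letter, letter, ← map_mul, ← map_mul,
      mul_comm_of_lie_eq_zero]
    rw [qpow_log, qpow_log, smul_lie, lie_smul, lie_log_dilog_eq_zero h0, smul_zero, smul_zero]
  · have h1 := w.pos
    have h2 := w'.pos
    by_cases h3 : 3 ≤ w.deg + w'.deg
    · exact hu.exists_mul_letter_eq_of_three_le hl hle h0 h3 hφ hψ hψ'
    · have h4 : w.form w' < 0 := form_neg_of_lt hle (by rwa [form_swap, neg_ne_zero])
      simp only [deg] at h3
      have h5 : w = e₁ ∧ w' = e₂ := by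
        rw [form, sub_neg] at h4
        have h6 : w.snd * w'.fst < w.fst * w'.snd := by exact_mod_cast h4
        have h7 : 0 < w.fst := Nat.pos_of_ne_zero fun h => by
          rw [h, zero_mul] at h6
          omega
        have h8 : 0 < w'.snd := Nat.pos_of_ne_zero fun h => by
          rw [h, mul_zero] at h6
          omega
        constructor <;> ext <;> simp only <;> omega
      obtain ⟨rfl, rfl⟩ := h5
      exact exists_mul_letter_eq_of_deg_one (l + 1) hφ (hφ' rfl) hψ (hψ' rfl)

/-- Words in the letters can be sorted. -/
theorem exists_sorted (hu : IsExponentFamily u) {l : ℕ}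
    (hl : ∀ v : NPlus, v.deg ≤ l → HasNatNewtonExpansion u v) (V : List NPlus) (hV : V.Nodup)
    (hsort : V.Pairwise Le) (hdeg : ∀ v ∈ V, v.deg ≤ l + 1)
    (hup : ∀ v ∈ V, ∀ w : NPlus, w.deg ≤ l + 1 → Le v w → w ∈ V)
    {x : Finset ι × Finset ι → Module.End ℚ GHat}
    (hx : x ∈ Submonoid.closure {y | ∃ v ∈ V, y ∈ letters ι (l + 1) v}) :
    ∃ Φ : NPlus → Finset ι × Finset ι → ℚ, (∀ v ∈ V, IsCountExponent v (Φ v)) ∧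
      x = (V.map fun v => letter (l + 1) v (Φ v)).prod := by
  induction V generalizing x with
  | nil =>
    refine ⟨fun _ _ => 0, by simp, ?_⟩
    simpa using hx
  | cons v V ih =>
    rw [List.nodup_cons] at hV
    rw [List.pairwise_cons] at hsort
    have hup' : ∀ v' ∈ V, ∀ w : NPlus, w.deg ≤ l + 1 → Le v' w → w ∈ V := by
      intro v' hv' w hw hle
      refine (List.mem_cons.mp (hup v' (List.mem_cons_of_mem _ hv') w hw hle)).resolve_left ?_
      rintro rfl
      exact hV.1 (Le.antisymm _ _ (hsort.1 v' hv') hle ▸ hv')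
    have habove : lettersAbove ι (l + 1) v ⊆ {y | ∃ w ∈ V, y ∈ letters ι (l + 1) w} := by
      rintro y ⟨w, hw, hle, hne, hy⟩
      exact ⟨w, (List.mem_cons.mp (hup v List.mem_cons_self w hw hle)).resolve_left
        (Ne.symm hne), hy⟩
    have hunion : {y | ∃ w ∈ v :: V, y ∈ letters ι (l + 1) w} =
        letters ι (l + 1) v ∪ {y | ∃ w ∈ V, y ∈ letters ι (l + 1) w} := by
      ext y
      simp
    rw [hunion] at hx
    obtain ⟨s, hs, t, ht, rfl⟩ := exists_mul_of_mem_closure_union (fun y hy x hx => by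
      obtain ⟨w, hw, hy⟩ := hy
      obtain ⟨k, hk, e⟩ := hu.exists_mul_letter_eq hl (hsort.1 w hw)
        (fun h => hV.1 (h ▸ hw)) (hdeg w (List.mem_cons_of_mem _ hw)) hx hy
      exact ⟨k, Submonoid.closure_mono habove hk, e⟩) hx
    obtain ⟨φ, hφ, rfl⟩ := exists_letter_of_mem_closure hs
    obtain ⟨Φ, hΦ, rfl⟩ := ih hV.2 hsort.2
      (fun w hw => hdeg w (List.mem_cons_of_mem _ hw)) hup' ht
    have hne : ∀ w ∈ V, w ≠ v := fun w hw h => hV.1 (h ▸ hw)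
    refine ⟨Function.update Φ v φ, ?_, ?_⟩
    · intro w hw
      by_cases h : w = v
      · subst h
        rwa [Function.update_self]
      · rw [Function.update_of_ne h]
        exact hΦ w ((List.mem_cons.mp hw).resolve_left h)
    · rw [List.map_cons, List.prod_cons, Function.update_self]
      congr 2
      exact List.map_congr_left fun w hw => by rw [Function.update_of_ne (hne w hw)]

end IsExponentFamily

/-! ### Newton expansions of the exponents -/

open Finset

/-- The word `Ψ[e₂]^|T| Ψ[e₁]^|S|`, as a function of `(S, T)`, is a product of letters
with exponents `0` and `1`, one for each potential element of `S` and of `T`. -/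
theorem letter_mul_letter_mem_closure (N l : ℕ) :
    (letter (l + 1) e₂ (fun A : Finset (Fin N) × Finset (Fin N) => (#A.2 : ℚ)) *
      letter (l + 1) e₁ (fun A => (#A.1 : ℚ))) ∈
      Submonoid.closure {y | ∃ v ∈ ordered (l + 1), y ∈ letters (Fin N) (l + 1) v} := by
  have key : ∀ (v : NPlus) (p : Fin N → Finset (Fin N) × Finset (Fin N)),
      v.deg = 1 → (∀ j, IsCount v.fst v.snd fun A => if p j ≤ A then 1 else 0) →
      ∀ s : Finset (Fin N), letter (l + 1) v
        (fun A : Finset (Fin N) × Finset (Fin N) => ∑ j ∈ s, if p j ≤ A then (1 : ℚ) else 0) ∈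
      Submonoid.closure {y | ∃ v ∈ ordered (l + 1), y ∈ letters (Fin N) (l + 1) v} := by
    intro v p hv hp s
    have hc : v.content = 1 := by
      rw [deg] at hv
      have h4 : v.fst = 0 ∧ v.snd = 1 ∨ v.fst = 1 ∧ v.snd = 0 := by omega
      rcases h4 with ⟨h5, h6⟩ | ⟨h5, h6⟩ <;> simp [content, h5, h6]
    induction s using Finset.induction_on with
    | empty =>
      simp only [sum_empty, letter_zero]
      exact one_mem _
    | insert j s hj ih =>
      simp only [sum_insert hj]
      rw [letter_add]
      refine mul_mem (Submonoid.subset_closure ⟨v, mem_ordered.mpr (by omega), _, ⟨_, hp j, ?_⟩,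
        fun _ A => ?_, rfl⟩) ih
      · intro A
        rw [hc]
        split_ifs <;> simp
      · split_ifs <;> simp
  have h2 := key e₂ (fun j => (∅, {j})) rfl
    (fun j => IsCount.indicator ((∅, {j}) : Finset (Fin N) × Finset (Fin N))) univ
  have h1 := key e₁ (fun j => ({j}, ∅)) rfl
    (fun j => IsCount.indicator (({j}, ∅) : Finset (Fin N) × Finset (Fin N))) univ
  simpa [Prod.le_def] using mul_mem h2 h1

namespace IsExponentFamily

variable {u : NPlus → ℕ → ℕ → ℚ}

/-- The exponents have a Newton expansion with coefficients in `gcd(v)⁻¹ ℕ`. -/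
theorem hasNatNewtonExpansion (hu : IsExponentFamily u) (v : NPlus) :
    HasNatNewtonExpansion u v := by
  suffices h : ∀ l : ℕ, ∀ v : NPlus, v.deg ≤ l → HasNatNewtonExpansion u v from h v.deg v le_rfl
  intro l
  induction l with
  | zero =>
    intro v hv
    have := v.deg_pos
    omega
  | succ l ih =>
    intro v hv
    refine exists_nat_newton_expansion fun N => ?_
    obtain ⟨Φ, hΦ, h⟩ := hu.exists_sorted ih (ordered (l + 1)) (nodup_ordered _)
      (pairwise_ordered _) (fun w hw => mem_ordered.mp hw)
      (fun _ _ w hw _ => mem_ordered.mpr hw) (letter_mul_letter_mem_closure N l)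
    obtain ⟨f, hf, hfΦ⟩ := hΦ v (mem_ordered.mpr hv)
    refine ⟨f, hf, fun A => ?_⟩
    have h1 : ModEq (l + 1) ((dilog e₂).qpow #A.2 * (dilog e₁).qpow #A.1)
        (dilogProd (ordered (l + 1)) fun w => Φ w A) := by
      have h2 := congrFun h A
      rw [Pi.mul_apply, Pi.list_prod_apply, List.map_map] at h2
      rw [modEq_iff_repHom_eq, map_mul, dilogProd, map_list_prod, List.map_map]
      exact h2
    rw [← hfΦ, ← ordered_exponents_unique
      ((isOrderedProduct_iff.mp (hu #A.1 #A.2) (l + 1)).symm.trans h1) hv]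

end IsExponentFamily

theorem sum_Icc_eq_sum_range {f : ℕ → ℚ} {a : ℕ} (h : f 0 = 0) :
    ∑ i ∈ Finset.Icc 1 a, f i = ∑ i ∈ range (a + 1), f i := by
  rw [sum_range_succ', h, add_zero, range_eq_Ico, sum_Ico_add' f 0 a 1, zero_add]
  rfl

/-- A combination of binomial coefficients that vanishes at the nonnegative integers is trivial. -/
theorem eq_zero_of_sum_choose_eq_zero {a : ℕ} {c : ℕ → ℚ}
    (h : ∀ m : ℕ, ∑ i ∈ range (a + 1), c i * m.choose i = 0) : ∀ i ≤ a, c i = 0 := by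
  intro i hi
  induction i using Nat.strong_induction_on with
  | _ i ih =>
    have h1 := h i
    rw [sum_eq_single i] at h1
    · simpa using h1
    · intro j _ hj
      rcases Nat.lt_or_ge j i with h2 | h2
      · rw [ih j h2 (by omega), zero_mul]
      · rw [Nat.choose_eq_zero_of_lt (by omega), Nat.cast_zero, mul_zero]
    · intro h2
      simp at h2
      omega

theorem theorem5p1 :
    (∃! u : NPlus → ℕ → ℕ → ℚ, IsExponentFamily u) ∧
    ∀ u : NPlus → ℕ → ℕ → ℚ, IsExponentFamily u →
      ∀ (a b : ℕ) (ha : 0 < a) (_hb : 0 < b),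
        ∃ α : ℕ → ℕ → ℕ, ∀ m n : ℕ,
          u ⟨a, b, Nat.add_pos_left ha b⟩ m n =
            (Nat.gcd a b : ℚ)⁻¹ *
              ∑ i ∈ Finset.Icc 1 a, ∑ j ∈ Finset.Icc 1 b,
                (α i j : ℚ) * (m.choose i : ℚ) * (n.choose j : ℚ) := by
  constructor
  · choose U hU hU' using fun m n : ℕ =>
      existsUnique_isOrderedProduct ((dilog e₂).qpow n * (dilog e₁).qpow m)
    refine ⟨fun v m n => U m n v, fun m n => hU m n, fun u hu => ?_⟩
    ext v m n
    exact congrFun (hU' m n _ (hu m n)) v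
  · intro u hu a b ha hb
    set v : NPlus := ⟨a, b, Nat.add_pos_left ha b⟩ with hv
    obtain ⟨α, hα⟩ := hu.hasNatNewtonExpansion v
    have hrow : ∀ n : ℕ, ∑ j ∈ range (b + 1), (α 0 j : ℚ) * n.choose j = 0 := by
      intro n
      have h := hα 0 n
      rw [hu.eq_zero_of_left n ha.ne', mul_zero, sum_range_succ', sum_eq_zero, zero_add] at h
      · simpa using h.symm
      · intro i _
        simp
    have hcol : ∀ m : ℕ, ∑ i ∈ range (a + 1), (α i 0 : ℚ) * m.choose i = 0 := by
      intro m
      have h := hα m 0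
      rw [hu.eq_zero_of_right m hb.ne', mul_zero] at h
      rw [h]
      refine sum_congr rfl fun i _ => ?_
      rw [sum_range_succ', sum_eq_zero, zero_add]
      · simp
      · intro j _
        simp
    have hrow' := eq_zero_of_sum_choose_eq_zero hrow
    have hcol' := eq_zero_of_sum_choose_eq_zero hcol
    refine ⟨α, fun m n => ?_⟩
    have hd : ((Nat.gcd a b : ℕ) : ℚ) ≠ 0 := by
      exact_mod_cast v.content_pos.ne'
    rw [eq_inv_mul_iff_mul_eq₀ hd]
    refine (hα m n).trans ?_
    rw [sum_Icc_eq_sum_range]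
    · refine sum_congr rfl fun i hi => ?_
      rw [sum_Icc_eq_sum_range]
      rw [hcol' i (by simpa [Nat.lt_succ_iff] using hi), zero_mul, zero_mul]
    · refine sum_eq_zero fun j hj => ?_
      rw [hrow' j (mem_Icc.mp hj).2, zero_mul, zero_mul]
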